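/- Conventions. Running times are bit complexities. A probabilistic algorithm has running time at most $B$ on an input if its expected running time is at most $B$ (its output is always correct). A finite abelian group is encoded by positive integers $d_1,\dots,d_n$, standing for $\mathbf Z/d_1\mathbf Z\times\dots\times\mathbf Z/d_n\mathbf Z$, and its elements by integers $x_1,\dots,x_n$ with $0\le x_i<d_i$. A finite (associative, unital) ring $R$ is encoded by its additive group in this form together with the products of the standard generators; its length is the length of this encoding, and units are encoded as elements of $R$. Words in $x_1,\dots,x_n$ and their inverses are encoded as sequences of powers $x_i^e$ with $e \in \mathbf Z$ written in binary. An *effective presentation* of $R^\times$ consists of a finite presentation $P=\langle X\mid T\rangle$, a probabilistic polynomial-time algorithm that computes from $g\in R^\times$ a word $\alpha(g)$ in $X\cup X^{-1}$, and a probabilistic polynomial-time algorithm that computes from a word $w$ in $X\cup X^{-1}$ an element $\beta(w)\in R^\times$, such that $\alpha$ induces a group isomorphism $R^\times\to P$ with inverse induced by $\beta$. An *abelianization* of $R^\times$ consists of a finite abelian group $A=\mathbf Z/d_1\mathbf Z\times\dots\times\mathbf Z/d_n\mathbf Z$ with $d_1\mid d_2\mid\dots\mid d_n$, together with probabilistic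 polynomial-time algorithms that compute images and preimages under a surjective homomorphism $R^\times\to A$ with kernel $[R^\times,R^\times]$. The algorithms that belong to an effective presentation or to an abelianization may query a fixed but arbitrary auxiliary oracle $\Omega$; their running time is bounded by a fixed polynomial (the same for all $R$) in the sum of the lengths of $R$ and of the input. Proposition. The problem of computing an abelianization of $R^\times$ for a given finite ring $R$ reduces in polynomial time to the problem of computing an effective presentation of $R^\times$ for a given finite ring $R$. That is, there is a deterministic oracle algorithm $M$ such that for every polynomial $p$ there is a polynomial $q$ with the following property. Let $\Omega$ be any auxiliary oracle, and let $O$ be any oracle that answers the encoding of each finite ring $R$ with an effective presentation of $R^\times$ of length at most $p(\text{length of }R)$ whose algorithms, with access to $\Omega$, have expected running time bounded by $p$. Then $M$ with the oracle $O$ computes, for every finite ring $R$, in time at most $q(\text{length of }R)$ an abelianization of $R^\times$ whose algorithms, with access to $\Omega$, have expected running time bounded by $q$. -/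

import Mathlib

open scoped ENNReal

namespace UnitAb

/-! ## Data, programs, bit cost -/

/-- The data on which programs work: binary trees whose leaves are empty or hold an integer. -/
inductive Data : Type
  | nil : Data
  | int (z : ℤ) : Data
  | pair (a b : Data) : Data

namespace Data

/-- The length of an object in bits, up to a constant factor: integers are written in binary. -/
def size : Data → ℕ
  | nil => 1
  | int z => 1 + Nat.size z.natAbs
  | pair a b => 1 + a.size + b.size

/-- A finite sequence as data. -/
def ofList : List Data → Data
  | [] => nil
  | a :: l => pair a (ofList l)

/-- First component (`nil` if the argument is not a pair). -/
def fst : Data → Data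
  | pair a _ => a
  | _ => nil

/-- Second component (`nil` if the argument is not a pair). -/
def snd : Data → Data
  | pair _ b => b
  | _ => nil

/-- The integer at a leaf (`0` if the argument is not an integer leaf). -/
def toInt : Data → ℤ
  | int z => z
  | _ => 0

/-- A truth value as data: `1` for true, `0` for false. -/
def ofBool (b : Bool) : Data := int (if b then 1 else 0)

/-- Is the argument a pair? -/
def isPair : Data → Bool
  | pair _ _ => true
  | _ => false

/-- Is the argument an integer leaf? -/
def isInt : Data → Bool
  | int _ => true
  | _ => false

end Data

/-- The primitive operations. The binary operations on integers act on the two components of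
their argument. -/
inductive Op : Type
  | id | fst | snd | isPair | isInt | add | sub | mul | div | mod | le

/-- The effect of a primitive operation. -/
def Op.eval : Op → Data → Data
  | .id, x => x
  | .fst, x => x.fst
  | .snd, x => x.snd
  | .isPair, x => .ofBool x.isPair
  | .isInt, x => .ofBool x.isInt
  | .add, x => .int (x.fst.toInt + x.snd.toInt)
  | .sub, x => .int (x.fst.toInt - x.snd.toInt)
  | .mul, x => .int (x.fst.toInt * x.snd.toInt)
  | .div, x => .int (x.fst.toInt / x.snd.toInt)
  | .mod, x => .int (x.fst.toInt % x.snd.toInt)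
  | .le, x => .ofBool (decide (x.fst.toInt ≤ x.snd.toInt))

/-- The number under which a primitive operation occurs in the code of a program. -/
def Op.code : Op → ℤ
  | .id => 0
  | .fst => 1
  | .snd => 2
  | .isPair => 3
  | .isInt => 4
  | .add => 5
  | .sub => 6
  | .mul => 7
  | .div => 8
  | .mod => 9
  | .le => 10

/-- Programs: a programming language for probabilistic oracle algorithms. -/
inductive Prog : Type
  /-- apply a primitive operation -/
  | op (o : Op) : Prog
  /-- return a fixed object -/
  | const (d : Data) : Prog
  /-- return a random bit -/
  | coin : Prog
  /-- return the answer of the oracle to the input -/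
  | query : Prog
  /-- run the first program, then the second one on its output -/
  | seq (p q : Prog) : Prog
  /-- run both programs on the input and return the pair of the outputs -/
  | fork (p q : Prog) : Prog
  /-- run `q` on the input if `c` does not return `0` on it, and `r` otherwise -/
  | cond (c q r : Prog) : Prog
  /-- while `c` does not return `0` on the current object, replace it by the output of `q` -/
  | loop (c q : Prog) : Prog

namespace Prog

/-- Programs are themselves data, so that they can be the output of a program. -/
def encode : Prog → Data
  | op o => .pair (.int 0) (.int o.code)
  | const d => .pair (.int 1) d
  | coin => .pair (.int 2) .nil
  | query => .pair (.int 3) .nil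
  | seq p q => .pair (.int 4) (.pair p.encode q.encode)
  | fork p q => .pair (.int 5) (.pair p.encode q.encode)
  | cond c q r => .pair (.int 6) (.pair c.encode (.pair q.encode r.encode))
  | loop c q => .pair (.int 7) (.pair c.encode q.encode)

/-- The program does not use random bits, that is, it is a deterministic (oracle) algorithm. -/
def CoinFree : Prog → Prop
  | op _ => True
  | const _ => True
  | coin => False
  | query => True
  | seq p q => p.CoinFree ∧ q.CoinFree
  | fork p q => p.CoinFree ∧ q.CoinFree
  | cond c q r => c.CoinFree ∧ q.CoinFree ∧ r.CoinFree
  | loop c q => c.CoinFree ∧ q.CoinFree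

end Prog

/-- `Eval Ω p x ω y ω' t`: with the oracle `Ω` and the sequence `ω` of random bits, the program `p`
halts on the input `x` with output `y` after `t` bit operations, and `ω'` is the sequence of the
random bits that it has not used. Every elementary action is charged with the bit lengths of the
objects it reads, copies and writes; an oracle query is charged with the lengths of the query and of
the answer. -/
inductive Eval (Ω : Data → Data) :
    Prog → Data → (ℕ → Bool) → Data → (ℕ → Bool) → ℕ → Prop
  | op (o : Op) (x : Data) (ω : ℕ → Bool) :
      Eval Ω (.op o) x ω (o.eval x) ω (1 + x.size + (o.eval x).size)
  | const (d x : Data) (ω : ℕ → Bool) :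
      Eval Ω (.const d) x ω d ω (1 + x.size + d.size)
  | coin (x : Data) (ω : ℕ → Bool) :
      Eval Ω .coin x ω (.ofBool (ω 0)) (fun i => ω (i + 1)) (1 + x.size + (Data.ofBool (ω 0)).size)
  | query (x : Data) (ω : ℕ → Bool) :
      Eval Ω .query x ω (Ω x) ω (1 + x.size + (Ω x).size)
  | seq {p q : Prog} {x y z : Data} {ω ω₁ ω₂ : ℕ → Bool} {t₁ t₂ : ℕ} :
      Eval Ω p x ω y ω₁ t₁ → Eval Ω q y ω₁ z ω₂ t₂ →
      Eval Ω (.seq p q) x ω z ω₂ (1 + t₁ + t₂)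
  | fork {p q : Prog} {x y z : Data} {ω ω₁ ω₂ : ℕ → Bool} {t₁ t₂ : ℕ} :
      Eval Ω p x ω y ω₁ t₁ → Eval Ω q x ω₁ z ω₂ t₂ →
      Eval Ω (.fork p q) x ω (.pair y z) ω₂ (1 + x.size + t₁ + t₂)
  | condThen {c q r : Prog} {x v y : Data} {ω ω₁ ω₂ : ℕ → Bool} {t₁ t₂ : ℕ} :
      Eval Ω c x ω v ω₁ t₁ → v ≠ .int 0 → Eval Ω q x ω₁ y ω₂ t₂ →
      Eval Ω (.cond c q r) x ω y ω₂ (1 + x.size + t₁ + t₂)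
  | condElse {c q r : Prog} {x y : Data} {ω ω₁ ω₂ : ℕ → Bool} {t₁ t₂ : ℕ} :
      Eval Ω c x ω (.int 0) ω₁ t₁ → Eval Ω r x ω₁ y ω₂ t₂ →
      Eval Ω (.cond c q r) x ω y ω₂ (1 + x.size + t₁ + t₂)
  | loopStop {c q : Prog} {x : Data} {ω ω₁ : ℕ → Bool} {t₁ : ℕ} :
      Eval Ω c x ω (.int 0) ω₁ t₁ →
      Eval Ω (.loop c q) x ω x ω₁ (1 + x.size + t₁)
  | loopStep {c q : Prog} {x v y z : Data} {ω ω₁ ω₂ ω₃ : ℕ → Bool} {t₁ t₂ t₃ : ℕ} :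
      Eval Ω c x ω v ω₁ t₁ → v ≠ .int 0 → Eval Ω q x ω₁ y ω₂ t₂ →
      Eval Ω (.loop c q) y ω₂ z ω₃ t₃ →
      Eval Ω (.loop c q) x ω z ω₃ (1 + x.size + t₁ + t₂ + t₃)

/-- The law of a sequence of independent fair random bits. -/
noncomputable def coinMeasure : MeasureTheory.Measure (ℕ → Bool) :=
  MeasureTheory.Measure.infinitePi fun _ => (PMF.uniformOfFintype Bool).toMeasure

/-- The running time of `p` on the input `x` with random bits `ω`; it is `∞` if `p` does not halt. -/
noncomputable def runTime (Ω : Data → Data) (p : Prog) (x : Data) (ω : ℕ → Bool) : ℝ≥0∞ :=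
  ⨅ (t : ℕ) (_ : ∃ y ω', Eval Ω p x ω y ω' t), (t : ℝ≥0∞)

/-- The probabilistic algorithm `p` on the input `x`: every output has the property `good`, and the
expected running time is at most `B` (in particular `p` halts almost surely). -/
def RunsInExpectedTime (Ω : Data → Data) (p : Prog) (x : Data) (good : Data → Prop) (B : ℕ) :
    Prop :=
  (∀ ω y ω' t, Eval Ω p x ω y ω' t → good y) ∧
    ∫⁻ ω, runTime Ω p x ω ∂coinMeasure ≤ (B : ℝ≥0∞)

/-- The program `p` on the input `x` outputs `y` in time at most `B`, whatever the random bits. -/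
def RunsInTime (Ω : Data → Data) (p : Prog) (x y : Data) (B : ℕ) : Prop :=
  ∀ ω, ∃ ω' t, t ≤ B ∧ Eval Ω p x ω y ω' t

/-! ## Finite abelian groups and finite rings -/

/-- Finite abelian groups are given by a sequence of positive integers `d₁, …, dₙ`. -/
structure FinAb where
  n : ℕ
  d : Fin n → ℕ
  d_pos : ∀ i, 0 < d i

namespace FinAb

/-- The group `ℤ/d₁ × ⋯ × ℤ/dₙ`. -/
abbrev Elem (A : FinAb) : Type := (i : Fin A.n) → ZMod (A.d i)

/-- The encoding of the group: the sequence `d₁, …, dₙ`. -/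
def encode (A : FinAb) : Data :=
  .ofList (List.ofFn fun i => .int (A.d i))

/-- The encoding of an element: the integers `x₁, …, xₙ` with `0 ≤ xᵢ < dᵢ`. -/
def encodeElem (A : FinAb) (x : A.Elem) : Data :=
  .ofList (List.ofFn fun i => .int ((x i).val : ℤ))

end FinAb

/-- A finite ring (associative, with one): a finite abelian group together with a biadditive
multiplication. The one is determined by the multiplication. -/
structure FinRing where
  add : FinAb
  mul : add.Elem →+ add.Elem →+ add.Elem
  one : add.Elem
  mul_assoc : ∀ x y z, mul (mul x y) z = mul x (mul y z)
  one_mul : ∀ x, mul one x = x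
  mul_one : ∀ x, mul x one = x

namespace FinRing

/-- The underlying set of the ring. -/
def Carrier (R : FinRing) : Type := R.add.Elem

instance (R : FinRing) : AddCommGroup R.Carrier :=
  inferInstanceAs (AddCommGroup R.add.Elem)

instance (R : FinRing) : Ring R.Carrier :=
  { (inferInstance : AddCommGroup R.Carrier) with
    mul := fun x y => R.mul x y
    one := R.one
    mul_assoc := R.mul_assoc
    one_mul := R.one_mul
    mul_one := R.mul_one
    left_distrib := fun x y z => map_add (R.mul x) y z
    right_distrib := fun x y z => DFunLike.congr_fun (map_add R.mul (x : R.add.Elem) y) z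
    zero_mul := fun x => DFunLike.congr_fun (map_zero R.mul) x
    mul_zero := fun x => map_zero (R.mul x) }

/-- The encoding of the ring: its additive group and the products of the standard generators. -/
def encode (R : FinRing) : Data :=
  .pair R.add.encode
    (.ofList (List.ofFn fun i => .ofList (List.ofFn fun j =>
      R.add.encodeElem (R.mul (Pi.single i 1) (Pi.single j 1)))))

/-- The length of the encoding of the ring. -/
def size (R : FinRing) : ℕ := R.encode.size

/-- Units are encoded as elements of the ring. -/
def encodeUnit (R : FinRing) (g : R.Carrierˣ) : Data :=
  R.add.encodeElem (g : R.Carrier)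

end FinRing

/-! ## Finitely presented groups and effective presentations -/

/-- Words in `x₁, …, xₙ` and their inverses, as sequences of powers of generators. -/
abbrev Word (n : ℕ) : Type := List (Fin n × ℤ)

/-- The element of the free group that a word represents. -/
def Word.toFree {n : ℕ} (w : Word n) : FreeGroup (Fin n) :=
  (w.map fun l => FreeGroup.of l.1 ^ l.2).prod

/-- The encoding of a word, with exponents in binary. -/
def Word.encode {n : ℕ} (w : Word n) : Data :=
  .ofList (w.map fun l => .pair (.int (l.1 : ℕ)) (.int l.2))

/-- A finite presentation: the number of generators and the list of relators. -/
structure Presentation where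
  n : ℕ
  relators : List (Word n)

namespace Presentation

/-- The finitely presented group `⟨x₁, …, xₙ | relators⟩`. -/
abbrev Grp (P : Presentation) : Type :=
  PresentedGroup {r : FreeGroup (Fin P.n) | ∃ w ∈ P.relators, r = w.toFree}

/-- The element of the finitely presented group that a word represents. -/
def eval (P : Presentation) (w : Word P.n) : P.Grp :=
  PresentedGroup.mk _ w.toFree

/-- The encoding of a presentation. -/
def encode (P : Presentation) : Data :=
  .pair (.int P.n) (.ofList (P.relators.map Word.encode))

end Presentation

/-- `D` is (the encoding of) an effective presentation of the unit group of `R`, with algorithms that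
may query the oracle `Ω` and have expected running time bounded by the polynomial `p`: it consists
of a finite presentation `P`, a probabilistic algorithm `a` that computes a word `α g` from a unit
`g`, and a probabilistic algorithm `b` that computes a unit `β w` from a word `w`, such that `α`
induces an isomorphism from the unit group to the group presented by `P`, with inverse induced by
`β`. -/
def IsEffectivePresentation (Ω : Data → Data) (p : Polynomial ℕ) (R : FinRing) (D : Data) : Prop :=
  ∃ (P : Presentation) (a b : Prog) (α : R.Carrierˣ → Word P.n) (β : Word P.n → R.Carrierˣ),
    D = .pair P.encode (.pair a.encode b.encode) ∧
    (∃ f : R.Carrierˣ ≃* P.Grp,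
      (∀ g, f g = P.eval (α g)) ∧ (∀ w, f.symm (P.eval w) = β w)) ∧
    (∀ g, RunsInExpectedTime Ω a (R.encodeUnit g) (fun y => y = (α g).encode)
      (p.eval (R.size + (R.encodeUnit g).size))) ∧
    (∀ w : Word P.n, RunsInExpectedTime Ω b w.encode (fun y => y = R.encodeUnit (β w))
      (p.eval (R.size + w.encode.size)))

/-- `D` is (the encoding of) an abelianization of the unit group of `R`, with algorithms that may
query the oracle `Ω` and have expected running time bounded by the polynomial `q`: it consists of a
finite abelian group `A = ℤ/d₁ × ⋯ × ℤ/dₙ` with `d₁ ∣ d₂ ∣ ⋯ ∣ dₙ` and of probabilistic algorithms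
`a` and `b` that compute images and preimages under a surjective homomorphism `φ` from the unit
group to `A` whose kernel is the commutator subgroup. -/
def IsAbelianization (Ω : Data → Data) (q : Polynomial ℕ) (R : FinRing) (D : Data) : Prop :=
  ∃ (A : FinAb) (a b : Prog) (φ : R.Carrierˣ →* Multiplicative A.Elem),
    D = .pair A.encode (.pair a.encode b.encode) ∧
    (∀ i j, i ≤ j → A.d i ∣ A.d j) ∧
    Function.Surjective φ ∧
    φ.ker = commutator R.Carrierˣ ∧
    (∀ g, RunsInExpectedTime Ω a (R.encodeUnit g)
      (fun y => y = A.encodeElem (φ g).toAdd)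
      (q.eval (R.size + (R.encodeUnit g).size))) ∧
    (∀ x : A.Elem, RunsInExpectedTime Ω b (A.encodeElem x)
      (fun y => ∃ g, φ g = Multiplicative.ofAdd x ∧ y = R.encodeUnit g)
      (q.eval (R.size + (A.encodeElem x).size)))

/-- The oracle `O` solves the problem of computing effective presentations of unit groups of finite
rings: to the query `R` it answers with an effective presentation of the unit group of `R` of length
at most `p (size of R)`, whose algorithms may query the oracle `Ω` and have expected running time
bounded by the polynomial `p`. -/
def SolvesEffectivePresentation (Ω : Data → Data) (p : Polynomial ℕ) (O : Data → Data) : Prop :=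
  ∀ R : FinRing, (O R.encode).size ≤ p.eval R.size ∧ IsEffectivePresentation Ω p R (O R.encode)

end UnitAb

/-! The abelianization of `⟨x₁, …, xₙ | T⟩` is `ℤⁿ/Λ`, where `Λ` is spanned by the exponent-sum
vectors of the relators. A Smith form of the relation matrix gives a coordinate change `U` that
identifies `ℤⁿ/Λ` with `∏ ℤ/dⱼ`. The image of a unit is found by applying `α`, taking exponent sums,
multiplying by `U` and reducing; a preimage is found by multiplying with the inverse of `U`, writing
the result as a word with binary exponents, and applying `β`. The kernel is the commutator subgroup
because vectors with zero coordinates are exactly those of `Λ` (`Presentation.coord_eq_zero_iff`,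
`Presentation.ker_eq_commutator`).

The difficulty is to keep the integers short. The unit group is finite, so `Λ` has full rank and
some `n × n` minor of the relation matrix is nonzero. Let `E` be its absolute value. By `adj B * B =
det B`, `E ℤⁿ ⊆ Λ` (`Presentation.modulus_spec`), so `Λ` is determined by its reduction modulo `E`
(`Presentation.mem_span_rowSet_iff`) and the Smith form can be computed in `ZMod E`. The minor is
found by starting from the identity matrix and exchanging its rows one at a time for relators while
carrying along determinant and adjugate; both consist of determinants of matrices with small
entries, hence stay short (`MinorInv`).

A Smith step modulo `E` needs a pivot that generates the ideal of all remaining entries. It is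
reached with one operation per row and per column, because `stab` supplies `t` such that `a + t b`
has the same common divisors with `E` as the pair `a, b` (`dvd_of_dvd_add_stab`). `smith_spec`
collects what the algorithm guarantees.

For running times, `PT` is the class of functions computed by coin-free programs in polynomial time,
whatever the oracle. It is closed under composition and under folds with bounded states, so that
most bounds follow from the formulas by `fun_prop`. The programs in the output run a given
probabilistic program before or after a deterministic one; expected times add
(`RunsInExpectedTime.seq_right`, `RunsInExpectedTime.seq_left`), and the word between them is short
because an output that does not depend on the random bits is no longer than the expected time
(`RunsInExpectedTime.size_le`). -/

namespace UnitAb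

/-! ## Typed data and polynomial time -/

/-- Types whose elements are encoded as data. -/
class Enc (α : Type) where
  enc : α → Data

open Enc (enc)

/-- The length of the encoding. -/
def sz {α : Type} [Enc α] (a : α) : ℕ := (enc a).size

instance : Enc Data := ⟨fun d => d⟩
instance : Enc ℤ := ⟨Data.int⟩
instance : Enc ℕ := ⟨fun n => Data.int n⟩
instance : Enc Bool := ⟨Data.ofBool⟩
instance {α β : Type} [Enc α] [Enc β] : Enc (α × β) := ⟨fun p => .pair (enc p.1) (enc p.2)⟩
instance {α : Type} [Enc α] : Enc (List α) := ⟨fun l => Data.ofList (l.map enc)⟩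

/-! ### Lengths of encodings under list and integer operations. -/

section Sizes

variable {α β : Type} [Enc α] [Enc β]

theorem enc_pair (a : α) (b : β) : enc (a, b) = .pair (enc a) (enc b) := rfl
theorem enc_bool (b : Bool) : enc b = .int (if b then 1 else 0) := rfl

theorem sz_pair (a : α) (b : β) : sz (a, b) = 1 + sz a + sz b := rfl
theorem sz_prod (p : α × β) : sz p = 1 + sz p.1 + sz p.2 := rfl
theorem sz_nil : sz ([] : List α) = 1 := rfl
theorem sz_cons (a : α) (l : List α) : sz (a :: l) = 1 + sz a + sz l := rfl
theorem sz_int (z : ℤ) : sz z = 1 + Nat.size z.natAbs := rfl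
theorem sz_nat (n : ℕ) : sz n = 1 + Nat.size n := rfl
theorem sz_bool (b : Bool) : sz b ≤ 2 := by cases b <;> decide

theorem Data.one_le_size (d : Data) : 1 ≤ d.size := by
  cases d <;> simp [Data.size, Nat.add_assoc]

theorem one_le_sz (a : α) : 1 ≤ sz a := Data.one_le_size _

/-- The right side counts two empty tails, the concatenation has one. -/
theorem sz_append (l m : List α) : sz (l ++ m) + 1 = sz l + sz m := by
  induction l with
  | nil => simp [sz_nil, Nat.add_comm]
  | cons a l ih => simp only [List.cons_append, sz_cons]; omega

theorem length_lt_sz (l : List α) : l.length < sz l := by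
  induction l with
  | nil => simp [sz_nil]
  | cons a l ih => simp only [sz_cons, List.length_cons]; omega

theorem sz_le_of_mem {a : α} {l : List α} (h : a ∈ l) : sz a < sz l := by
  induction l with
  | nil => simp at h
  | cons b l ih =>
    rw [sz_cons]
    rcases List.mem_cons.1 h with rfl | h
    · omega
    · have := ih h; omega

theorem sz_take_le (l : List α) (k : ℕ) : sz (l.take k) ≤ sz l := by
  induction l generalizing k with
  | nil => simp
  | cons a l ih =>
    cases k with
    | zero => simp [sz_cons, sz_nil, Nat.add_assoc]
    | succ k => have := ih k; simp only [List.take_succ_cons, sz_cons]; omega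

theorem sz_drop_le (l : List α) (k : ℕ) : sz (l.drop k) ≤ sz l := by
  induction l generalizing k with
  | nil => simp
  | cons a l ih =>
    cases k with
    | zero => simp
    | succ k => have := ih k; simp only [List.drop_succ_cons, sz_cons]; omega

theorem sz_list_le {l : List α} {B : ℕ} (h : ∀ a ∈ l, sz a ≤ B) :
    sz l ≤ 1 + l.length * (1 + B) := by
  induction l with
  | nil => simp [sz_nil]
  | cons a l ih =>
    have h1 := h a (by simp)
    have h2 := ih fun b hb => h b (by simp [hb])
    rw [sz_cons, List.length_cons, Nat.succ_mul]; omega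

theorem sz_int_le_of_natAbs_le {x y : ℤ} (h : x.natAbs ≤ y.natAbs) : sz x ≤ sz y := by
  rw [sz_int, sz_int]; exact Nat.add_le_add_left (Nat.size_le_size h) 1

theorem sz_int_le_of_lt {x : ℤ} {k : ℕ} (h : x.natAbs < 2 ^ k) : sz x ≤ 1 + k := by
  rw [sz_int]; exact Nat.add_le_add_left (Nat.size_le.2 h) 1

theorem natAbs_lt_two_pow_sz (x : ℤ) : x.natAbs < 2 ^ (sz x - 1) := by
  rw [sz_int, Nat.add_sub_cancel_left]; exact Nat.lt_size_self _

theorem sz_add_le (x y : ℤ) : sz (x + y) ≤ sz x + sz y := by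
  have hx := natAbs_lt_two_pow_sz x
  have hy := natAbs_lt_two_pow_sz y
  have h1 := one_le_sz x
  have h2 := one_le_sz y
  have := Int.natAbs_add_le x y
  have hx' : (2 : ℕ) ^ (sz x - 1) ≤ 2 ^ ((sz x - 1) + (sz y - 1)) :=
    Nat.pow_le_pow_right (by norm_num) (by omega)
  have hy' : (2 : ℕ) ^ (sz y - 1) ≤ 2 ^ ((sz x - 1) + (sz y - 1)) :=
    Nat.pow_le_pow_right (by norm_num) (by omega)
  have h := sz_int_le_of_lt (x := x + y) (k := (sz x - 1) + (sz y - 1) + 1)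
    (by rw [pow_succ]; omega)
  omega

theorem sz_neg (x : ℤ) : sz (-x) = sz x := by simp [sz_int]

theorem sz_sub_le (x y : ℤ) : sz (x - y) ≤ sz x + sz y := by
  have := sz_add_le x (-y)
  rwa [sz_neg] at this

theorem sz_mul_le (x y : ℤ) : sz (x * y) ≤ sz x + sz y := by
  have hx := natAbs_lt_two_pow_sz x
  have hy := natAbs_lt_two_pow_sz y
  have h1 := one_le_sz x
  have h2 := one_le_sz y
  have h := sz_int_le_of_lt (x := x * y) (k := (sz x - 1) + (sz y - 1))
    (by rw [Int.natAbs_mul, pow_add]; exact Nat.mul_lt_mul'' hx hy)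
  omega

theorem sz_ediv_le (x y : ℤ) : sz (x / y) ≤ sz x :=
  sz_int_le_of_natAbs_le (Int.natAbs_ediv_le_natAbs x y)

theorem sz_emod_le (x y : ℤ) : sz (x % y) ≤ sz x + sz y := by
  rcases eq_or_ne y 0 with rfl | hy
  · simp
  · have := sz_int_le_of_natAbs_le (x := x % y) (y := y)
      (by have := Int.emod_lt x hy; have := Int.emod_nonneg x hy; omega)
    omega

end Sizes

/-- Each elementary action is charged for what it writes. This turns every time bound into a length
bound. -/
theorem Eval.size_le {Ω : Data → Data} {p : Prog} {x y : Data} {ω ω' : ℕ → Bool} {t : ℕ}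
    (h : Eval Ω p x ω y ω' t) : y.size ≤ t := by
  induction h with
  | fork _ _ h1 h2 => simp only [Data.size]; omega
  | _ => omega

/-- Natural coefficients make all bounds monotone, so they compose when only an upper bound on an
intermediate length is known. -/
theorem eval_mono (q : Polynomial ℕ) {m n : ℕ} (h : m ≤ n) : q.eval m ≤ q.eval n := by
  induction q using Polynomial.induction_on' with
  | add p q hp hq => simp only [Polynomial.eval_add]; exact Nat.add_le_add hp hq
  | monomial k a =>
    simp only [Polynomial.eval_monomial]
    exact Nat.mul_le_mul_left _ (Nat.pow_le_pow_left h k)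

/-! ### Polynomial bounds and the closure properties of polynomial time. -/

section Bounds

variable {α β γ : Type} [Enc α] [Enc β] [Enc γ]

/-- Functions that are bounded by a polynomial in the length of the argument. -/
def PB (f : α → ℕ) : Prop := ∃ q : Polynomial ℕ, ∀ a, f a ≤ q.eval (sz a)

theorem PB.of_le {f g : α → ℕ} (hg : PB g) (h : ∀ a, f a ≤ g a) : PB f :=
  let ⟨q, hq⟩ := hg
  ⟨q, fun a => (h a).trans (hq a)⟩

theorem PB.const (n : ℕ) : PB fun _ : α => n := ⟨Polynomial.C n, fun a => by simp⟩

theorem PB.self : PB fun a : α => sz a := ⟨Polynomial.X, fun a => by simp⟩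

theorem PB.add {f g : α → ℕ} (hf : PB f) (hg : PB g) : PB fun a => f a + g a :=
  let ⟨q, hq⟩ := hf
  let ⟨r, hr⟩ := hg
  ⟨q + r, fun a => by rw [Polynomial.eval_add]; exact Nat.add_le_add (hq a) (hr a)⟩

theorem PB.mul {f g : α → ℕ} (hf : PB f) (hg : PB g) : PB fun a => f a * g a :=
  let ⟨q, hq⟩ := hf
  let ⟨r, hr⟩ := hg
  ⟨q * r, fun a => by rw [Polynomial.eval_mul]; exact Nat.mul_le_mul (hq a) (hr a)⟩

theorem PB.eval (q : Polynomial ℕ) {f : α → ℕ} (hf : PB f) : PB fun a => q.eval (f a) :=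
  let ⟨r, hr⟩ := hf
  ⟨q.comp r, fun a => by rw [Polynomial.eval_comp]; exact eval_mono q (hr a)⟩

/-- `f` is computed in polynomial time by a deterministic program without oracle queries. -/
@[fun_prop]
def PT (f : α → β) : Prop :=
  ∃ P : Prog, P.CoinFree ∧ ∃ q : Polynomial ℕ, ∀ a (Ω : Data → Data) (ω : ℕ → Bool),
    ∃ t ≤ q.eval (sz a), Eval Ω P (enc a) ω (enc (f a)) ω t

theorem PT.pb_sz {f : α → β} (hf : PT f) : PB fun a => sz (f a) :=
  let ⟨_, _, q, h⟩ := hf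
  ⟨q, fun a =>
    let ⟨_, ht, he⟩ := h a (fun d => d) (fun _ => true)
    he.size_le.trans ht⟩

theorem PT.mk {f : α → β} (P : Prog) (hP : P.CoinFree) {T : α → ℕ} (hT : PB T)
    (h : ∀ a (Ω : Data → Data) (ω : ℕ → Bool), ∃ t ≤ T a, Eval Ω P (enc a) ω (enc (f a)) ω t) :
    PT f :=
  let ⟨q, hq⟩ := hT
  ⟨P, hP, q, fun a Ω ω =>
    let ⟨t, ht, he⟩ := h a Ω ω
    ⟨t, ht.trans (hq a), he⟩⟩

theorem PT.of_op {f : α → β} (o : Op) (h : ∀ a, o.eval (enc a) = enc (f a))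
    (hf : PB fun a => sz (f a)) : PT f :=
  PT.mk (.op o) trivial (T := fun a => 1 + sz a + sz (f a)) (((PB.const 1).add PB.self).add hf)
    fun a Ω ω => ⟨_, le_rfl, by
      have := Eval.op (Ω := Ω) o (enc a) ω
      rw [h a] at this
      exact this⟩

/-- For maps invisible in the encoding: naturals are encoded as integers, and a nonempty list as the
pair of its head and its tail. -/
theorem PT.of_enc_eq {f : α → β} (h : ∀ a, enc (f a) = enc a) : PT f :=
  PT.of_op .id (fun a => (h a).symm) (PB.self.of_le fun a => by simp only [sz, h]; exact le_rfl)

@[fun_prop]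
theorem PT.id : PT fun a : α => a := PT.of_enc_eq fun _ => rfl

@[fun_prop]
theorem PT.const (b : β) : PT fun _ : α => b :=
  PT.mk (.const (enc b)) trivial (T := fun a => 1 + sz a + sz b)
    (((PB.const 1).add PB.self).add (PB.const _))
    fun a _ ω => ⟨_, le_rfl, Eval.const (enc b) (enc a) ω⟩

theorem PT.comp {g : β → γ} {f : α → β} (hg : PT g) (hf : PT f) : PT fun a => g (f a) := by
  have hs := hf.pb_sz
  obtain ⟨P, hP, q, h⟩ := hf
  obtain ⟨Q, hQ, r, k⟩ := hg
  refine PT.mk (.seq P Q) ⟨hP, hQ⟩ (T := fun a => 1 + q.eval (sz a) + r.eval (sz (f a)))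
    (((PB.const 1).add (PB.eval q PB.self)).add (PB.eval r hs)) fun a Ω ω => ?_
  obtain ⟨t, ht, he⟩ := h a Ω ω
  obtain ⟨u, hu, ke⟩ := k (f a) Ω ω
  exact ⟨_, by omega, .seq he ke⟩

@[fun_prop]
theorem PT.prodMk {f : α → β} {g : α → γ} (hf : PT f) (hg : PT g) : PT fun a => (f a, g a) := by
  obtain ⟨P, hP, q, h⟩ := hf
  obtain ⟨Q, hQ, r, k⟩ := hg
  refine PT.mk (.fork P Q) ⟨hP, hQ⟩ (T := fun a => 1 + sz a + q.eval (sz a) + r.eval (sz a))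
    ((((PB.const 1).add PB.self).add (PB.eval q PB.self)).add (PB.eval r PB.self))
    fun a Ω ω => ?_
  obtain ⟨t, ht, he⟩ := h a Ω ω
  obtain ⟨u, hu, ke⟩ := k a Ω ω
  exact ⟨_, by change 1 + sz a + t + u ≤ _; omega, .fork he ke⟩

theorem PT.fst' : PT fun p : α × β => p.1 :=
  PT.of_op .fst (fun _ => rfl) (PB.self.of_le fun p => by
    change sz p.1 ≤ 1 + sz p.1 + sz p.2; omega)

theorem PT.snd' : PT fun p : α × β => p.2 :=
  PT.of_op .snd (fun _ => rfl) (PB.self.of_le fun p => by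
    change sz p.2 ≤ 1 + sz p.1 + sz p.2; omega)

@[fun_prop]
theorem PT.fst {f : α → β × γ} (hf : PT f) : PT fun a => (f a).1 := PT.fst'.comp hf

@[fun_prop]
theorem PT.snd {f : α → β × γ} (hf : PT f) : PT fun a => (f a).2 := PT.snd'.comp hf

attribute [fun_prop] PT.comp

theorem PT.congr {f g : α → β} (hf : PT f) (h : ∀ a, g a = f a) : PT g := by
  rwa [funext h]

/-! ### Integers and truth values -/

@[fun_prop]
theorem PT.int_add {f g : α → ℤ} (hf : PT f) (hg : PT g) : PT fun a => f a + g a :=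
  PT.comp (g := fun p : ℤ × ℤ => p.1 + p.2)
    (PT.of_op .add (fun _ => rfl) (PB.self.of_le fun p =>
      (sz_add_le p.1 p.2).trans (by change _ ≤ 1 + sz p.1 + sz p.2; omega))) (hf.prodMk hg)

@[fun_prop]
theorem PT.int_sub {f g : α → ℤ} (hf : PT f) (hg : PT g) : PT fun a => f a - g a :=
  PT.comp (g := fun p : ℤ × ℤ => p.1 - p.2)
    (PT.of_op .sub (fun _ => rfl) (PB.self.of_le fun p =>
      (sz_sub_le p.1 p.2).trans (by change _ ≤ 1 + sz p.1 + sz p.2; omega))) (hf.prodMk hg)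

@[fun_prop]
theorem PT.int_mul {f g : α → ℤ} (hf : PT f) (hg : PT g) : PT fun a => f a * g a :=
  PT.comp (g := fun p : ℤ × ℤ => p.1 * p.2)
    (PT.of_op .mul (fun _ => rfl) (PB.self.of_le fun p =>
      (sz_mul_le p.1 p.2).trans (by change _ ≤ 1 + sz p.1 + sz p.2; omega))) (hf.prodMk hg)

@[fun_prop]
theorem PT.int_ediv {f g : α → ℤ} (hf : PT f) (hg : PT g) : PT fun a => f a / g a :=
  PT.comp (g := fun p : ℤ × ℤ => p.1 / p.2)
    (PT.of_op .div (fun _ => rfl) (PB.self.of_le fun p =>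
      (sz_ediv_le p.1 p.2).trans (by change _ ≤ 1 + sz p.1 + sz p.2; omega))) (hf.prodMk hg)

@[fun_prop]
theorem PT.int_emod {f g : α → ℤ} (hf : PT f) (hg : PT g) : PT fun a => f a % g a :=
  PT.comp (g := fun p : ℤ × ℤ => p.1 % p.2)
    (PT.of_op .mod (fun _ => rfl) (PB.self.of_le fun p =>
      (sz_emod_le p.1 p.2).trans (by change _ ≤ 1 + sz p.1 + sz p.2; omega))) (hf.prodMk hg)

@[fun_prop]
theorem PT.int_neg {f : α → ℤ} (hf : PT f) : PT fun a => -f a :=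
  ((PT.const (0 : ℤ)).int_sub hf).congr fun a => by simp

@[fun_prop]
theorem PT.natCast {f : α → ℕ} (hf : PT f) : PT fun a => (f a : ℤ) :=
  PT.comp (g := fun n : ℕ => (n : ℤ)) (PT.of_enc_eq fun _ => rfl) hf

/-- True by definition, since a natural number and its cast have the same encoding. Computations on
naturals are thus reduced to integers. -/
theorem PT.of_natCast {f : α → ℕ} (hf : PT fun a => (f a : ℤ)) : PT f := hf

@[fun_prop]
theorem PT.int_le {f g : α → ℤ} (hf : PT f) (hg : PT g) : PT fun a => decide (f a ≤ g a) :=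
  PT.comp (g := fun p : ℤ × ℤ => decide (p.1 ≤ p.2))
    (PT.of_op .le (fun _ => rfl) ((PB.const 2).of_le fun _ => sz_bool _)) (hf.prodMk hg)

@[fun_prop]
theorem PT.cond {c : α → Bool} {f g : α → β} (hc : PT c) (hf : PT f) (hg : PT g) :
    PT fun a => bif c a then f a else g a := by
  obtain ⟨C, hC, s, l⟩ := hc
  obtain ⟨P, hP, q, h⟩ := hf
  obtain ⟨Q, hQ, r, k⟩ := hg
  refine PT.mk (.cond C P Q) ⟨hC, hP, hQ⟩
    (T := fun a => 1 + sz a + s.eval (sz a) + q.eval (sz a) + r.eval (sz a))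
    (((((PB.const 1).add PB.self).add (PB.eval s PB.self)).add (PB.eval q PB.self)).add
      (PB.eval r PB.self)) fun a Ω ω => ?_
  obtain ⟨v, hv, le⟩ := l a Ω ω
  cases hca : c a with
  | true =>
    obtain ⟨t, ht, he⟩ := h a Ω ω
    rw [hca] at le
    exact ⟨_, by change 1 + sz a + v + t ≤ _; omega, .condThen le (by simp [enc_bool]) he⟩
  | false =>
    obtain ⟨t, ht, he⟩ := k a Ω ω
    rw [hca] at le
    exact ⟨_, by change 1 + sz a + v + t ≤ _; omega, .condElse le he⟩

@[fun_prop]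
theorem PT.ite {p : α → Prop} [DecidablePred p] {f g : α → β} (hc : PT fun a => decide (p a))
    (hf : PT f) (hg : PT g) : PT fun a => if p a then f a else g a :=
  (PT.cond hc hf hg).congr fun a => by by_cases h : p a <;> simp [h]

@[fun_prop]
theorem PT.and {c d : α → Bool} (hc : PT c) (hd : PT d) : PT fun a => c a && d a :=
  (PT.cond hc hd (PT.const false)).congr fun a => by cases c a <;> rfl

@[fun_prop]
theorem PT.not {c : α → Bool} (hc : PT c) : PT fun a => !c a :=
  (PT.cond hc (PT.const false) (PT.const true)).congr fun a => by cases c a <;> rfl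

@[fun_prop]
theorem PT.decide_not {p : α → Prop} [DecidablePred p] (hc : PT fun a => decide (p a)) :
    PT fun a => decide (¬ p a) :=
  hc.not.congr fun a => by simp

@[fun_prop]
theorem PT.int_eq {f g : α → ℤ} (hf : PT f) (hg : PT g) : PT fun a => decide (f a = g a) :=
  ((hf.int_le hg).and (hg.int_le hf)).congr fun a => by
    rw [Bool.eq_iff_iff]; simp [le_antisymm_iff]

@[fun_prop]
theorem PT.int_lt {f g : α → ℤ} (hf : PT f) (hg : PT g) : PT fun a => decide (f a < g a) :=
  (hg.int_le hf).not.congr fun a => by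
    rw [Bool.eq_iff_iff]; simp

@[fun_prop]
theorem PT.nat_lt {f g : α → ℕ} (hf : PT f) (hg : PT g) : PT fun a => decide (f a < g a) :=
  (hf.natCast.int_lt hg.natCast).congr fun a => by
    rw [Bool.eq_iff_iff]; simp

@[fun_prop]
theorem PT.nat_eq {f g : α → ℕ} (hf : PT f) (hg : PT g) : PT fun a => decide (f a = g a) :=
  (hf.natCast.int_eq hg.natCast).congr fun a => by
    rw [Bool.eq_iff_iff]; simp

@[fun_prop]
theorem PT.nat_add {f g : α → ℕ} (hf : PT f) (hg : PT g) : PT fun a => f a + g a :=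
  PT.of_natCast ((hf.natCast.int_add hg.natCast).congr fun a => by push_cast; rfl)

@[fun_prop]
theorem PT.int_natAbs {f : α → ℤ} (hf : PT f) : PT fun a => (f a).natAbs :=
  PT.of_natCast ((PT.ite ((PT.const (0 : ℤ)).int_le hf) hf hf.int_neg).congr fun a => by
    by_cases h : 0 ≤ f a <;> (simp [h]; try omega))

end Bounds

/-! ### Loops, folds and list operations. -/

/-- A fold is run as a loop whose state holds the parameter, the unread part of the list and the
accumulator. The element `d` only makes `headD` total and is never read before the list is
exhausted. -/
theorem iterate_foldl_step {α β σ : Type} (g : α → σ → β → σ) (d : β) (a : α) (i : ℕ) (l : List β)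
    (hi : i ≤ l.length) (s : σ) :
    (fun p : (α × β) × List β × σ =>
      (p.1, p.2.1.tail, g p.1.1 p.2.2 (p.2.1.headD p.1.2)))^[i] ((a, d), l, s) =
    ((a, d), l.drop i, (l.take i).foldl (g a) s) := by
  induction i generalizing l s with
  | zero => simp
  | succ i ih =>
    cases l with
    | nil => simp at hi
    | cons b l =>
      rw [Function.iterate_succ_apply]
      simp only [List.tail_cons, List.headD_cons, List.drop_succ_cons, List.take_succ_cons,
        List.foldl_cons]
      exact ih l (by simpa using hi) _

theorem foldl_cons_eq {β γ : Type} (f : β → γ) (l : List β) (m : List γ) :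
    l.foldl (fun acc b => f b :: acc) m = (l.map f).reverse ++ m := by
  induction l generalizing m with
  | nil => rfl
  | cons b l ih => simp [ih]

theorem sz_reverse {β : Type} [Enc β] (m : List β) : sz m.reverse = sz m := by
  induction m with
  | nil => rfl
  | cons b m ih =>
    have := sz_append m.reverse [b]
    rw [List.reverse_cons, sz_cons]; simp only [sz_cons, sz_nil] at this; omega

section Lists

variable {α β γ σ : Type} [Enc α] [Enc β] [Enc γ] [Enc σ]

@[fun_prop]
theorem PT.cons {f : α → β} {g : α → List β} (hf : PT f) (hg : PT g) : PT fun a => f a :: g a :=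
  PT.comp (g := fun p : β × List β => p.1 :: p.2) (PT.of_enc_eq fun _ => rfl) (hf.prodMk hg)

@[fun_prop]
theorem PT.isEmpty {l : α → List β} (hl : PT l) : PT fun a => (l a).isEmpty :=
  PT.congr (f := fun a => !!(l a).isEmpty)
    (PT.not (PT.comp (g := fun l : List β => !l.isEmpty) (PT.of_op .isPair
      (fun l => by cases l <;> rfl) ((PB.const 2).of_le fun _ => sz_bool _)) hl))
    fun a => by simp

@[fun_prop]
theorem PT.headD {l : α → List β} {d : α → β} (hl : PT l) (hd : PT d) :
    PT fun a => (l a).headD (d a) := by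
  refine PT.comp (g := fun p : List β × β => p.1.headD p.2) ?_ (hl.prodMk hd)
  obtain ⟨C, hC, q, h⟩ := PT.isEmpty (α := List β × β) (PT.fst PT.id)
  refine PT.mk (.cond C (.op .snd) (.seq (.op .fst) (.op .fst)))
    ⟨hC, trivial, trivial, trivial⟩ (T := fun p => 1 + sz p + q.eval (sz p) + 5 * sz p + 5)
    (((((PB.const 1).add PB.self).add (PB.eval q PB.self)).add ((PB.const 5).mul PB.self)).add
      (PB.const 5)) fun p Ω ω => ?_
  obtain ⟨t, ht, he⟩ := h p Ω ω
  obtain ⟨l, d⟩ := p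
  cases l with
  | nil =>
    refine ⟨_, ?_, .condThen he (by simp [enc_bool]) (Eval.op .snd _ _)⟩
    change 1 + sz (([] : List β), d) + t + (1 + sz (([] : List β), d) + sz d) ≤ _
    simp only [sz_pair, sz_nil] at *; omega
  | cons b l =>
    refine ⟨_, ?_, .condElse he (.seq (Eval.op .fst _ _) (Eval.op .fst _ _))⟩
    change 1 + sz (b :: l, d) + t + (1 + (1 + sz (b :: l, d) + sz (b :: l)) +
      (1 + sz (b :: l) + sz b)) ≤ _
    simp only [sz_pair, sz_cons] at *; omega

@[fun_prop]
theorem PT.tail {l : α → List β} (hl : PT l) : PT fun a => (l a).tail := by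
  refine PT.comp (g := fun l : List β => l.tail) (PT.of_op .snd (fun l => by cases l <;> rfl)
    (PB.self.of_le fun l => ?_)) hl
  cases l with
  | nil => exact le_rfl
  | cons b l => simp only [List.tail_cons, sz_cons]; omega

/-- Induction on the number of rounds, all of whose states have length at most `B`; the factor `N +
1` accounts for the last test, which ends the loop. -/
theorem exists_eval_loop {c : σ → Bool} {g : σ → σ} {C G : Prog} {q r : Polynomial ℕ}
    {Ω : Data → Data} {ω : ℕ → Bool}
    (hC : ∀ s, ∃ t ≤ q.eval (sz s), Eval Ω C (enc s) ω (enc (c s)) ω t)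
    (hG : ∀ s, ∃ t ≤ r.eval (sz s), Eval Ω G (enc s) ω (enc (g s)) ω t) {B : ℕ} (N : ℕ) (s : σ)
    (hcont : ∀ i < N, c (g^[i] s) = true) (hend : c (g^[N] s) = false)
    (hB : ∀ i ≤ N, sz (g^[i] s) ≤ B) :
    ∃ t ≤ (N + 1) * (1 + B + q.eval B + r.eval B),
      Eval Ω (.loop C G) (enc s) ω (enc (g^[N] s)) ω t := by
  induction N generalizing s with
  | zero =>
    obtain ⟨t, ht, he⟩ := hC s
    have h0 : sz s ≤ B := hB 0 le_rfl
    have := eval_mono q h0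
    rw [Function.iterate_zero_apply] at hend
    rw [hend] at he
    exact ⟨_, by change 1 + sz s + t ≤ _; rw [zero_add, one_mul]; omega, .loopStop he⟩
  | succ N ih =>
    have h0 : sz s ≤ B := hB 0 (Nat.zero_le _)
    obtain ⟨t, ht, he⟩ := hC s
    obtain ⟨u, hu, ke⟩ := hG s
    obtain ⟨v, hv, le⟩ := ih (g s) (fun i hi => hcont (i + 1) (by omega)) hend
      (fun i hi => hB (i + 1) (by omega))
    have h1 := eval_mono q h0
    have h2 := eval_mono r h0
    have hc : c s = true := hcont 0 (Nat.succ_pos _)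
    rw [hc] at he
    refine ⟨_, ?_, .loopStep he (by simp [enc_bool]) ke le⟩
    change 1 + sz s + t + u + v ≤ _
    rw [Nat.succ_mul (N + 1)]; omega

/-- A loop with polynomially many steps through states of polynomially bounded length. -/
theorem PT.while_iterate {c : σ → Bool} {g : σ → σ} {init : α → σ} (hc : PT c) (hg : PT g)
    (hi : PT init) (N : α → ℕ) (hN : PB N) (B : α → ℕ) (hB : PB B)
    (hcont : ∀ a, ∀ i < N a, c (g^[i] (init a)) = true)
    (hend : ∀ a, c (g^[N a] (init a)) = false)
    (hsz : ∀ a, ∀ i ≤ N a, sz (g^[i] (init a)) ≤ B a) :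
    PT fun a => g^[N a] (init a) := by
  obtain ⟨C, hC, q, h⟩ := hc
  obtain ⟨G, hG, r, k⟩ := hg
  obtain ⟨I, hI, s, l⟩ := hi
  refine PT.mk (.seq I (.loop C G)) ⟨hI, hC, hG⟩
    (T := fun a => 1 + s.eval (sz a) + (N a + 1) * (1 + B a + q.eval (B a) + r.eval (B a)))
    (((PB.const 1).add (PB.eval s PB.self)).add ((hN.add (PB.const 1)).mul
      ((((PB.const 1).add hB).add (PB.eval q hB)).add (PB.eval r hB)))) fun a Ω ω => ?_
  obtain ⟨t, ht, he⟩ := l a Ω ω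
  obtain ⟨u, hu, ke⟩ := exists_eval_loop (fun s => h s Ω ω) (fun s => k s Ω ω) (N a) (init a)
    (hcont a) (hend a) (hsz a)
  exact ⟨_, by omega, .seq he ke⟩

/-- The bound on the intermediate states cannot be dropped: a polynomial-time step may double the
length in each round. -/
theorem PT.foldl_of_inhabited (d : β) {l : α → List β} {init : α → σ} {g : α → σ → β → σ}
    (hl : PT l) (hi : PT init)
    (hg : PT fun p : α × σ × β => g p.1 p.2.1 p.2.2) (B : α → ℕ) (hB : PB B)
    (h : ∀ a, ∀ i ≤ (l a).length, sz (((l a).take i).foldl (g a) (init a)) ≤ B a) :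
    PT fun a => (l a).foldl (g a) (init a) := by
  have hlen : PB fun a => (l a).length := hl.pb_sz.of_le fun a => (length_lt_sz _).le
  have := PT.while_iterate (σ := (α × β) × List β × σ) (α := α) (c := fun p => !p.2.1.isEmpty)
    (g := fun p => (p.1, p.2.1.tail, g p.1.1 p.2.2 (p.2.1.headD p.1.2)))
    (init := fun a => ((a, d), l a, init a)) (by fun_prop) (by fun_prop) (by fun_prop)
    (fun a => (l a).length) hlen (fun a => 3 + sz a + sz d + sz (l a) + B a)
    (((((PB.const 3).add PB.self).add (PB.const _)).add hl.pb_sz).add hB)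
    (fun a i hi => by
      rw [iterate_foldl_step g d a i _ hi.le]
      simpa using hi)
    (fun a => by
      rw [iterate_foldl_step g d a _ _ le_rfl]
      simp)
    (fun a i hi => by
      rw [iterate_foldl_step g d a i _ hi]
      have h1 := h a i hi
      have h2 := sz_drop_le (l a) i
      simp only [sz_pair]; omega)
  refine (PT.snd (PT.snd this)).congr fun a => ?_
  rw [iterate_foldl_step g d a _ _ le_rfl]
  simp

/-- Folds over lists through states of polynomially bounded length. -/
theorem PT.foldl {l : α → List β} {init : α → σ} {g : α → σ → β → σ} (hl : PT l)
    (hi : PT init) (hg : PT fun p : α × σ × β => g p.1 p.2.1 p.2.2) (B : α → ℕ) (hB : PB B)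
    (h : ∀ a, ∀ i ≤ (l a).length, sz (((l a).take i).foldl (g a) (init a)) ≤ B a) :
    PT fun a => (l a).foldl (g a) (init a) := by
  -- Without an element of `β` there is no default for `headD`, but then all lists are empty.
  rcases isEmpty_or_nonempty β with hβ | ⟨⟨d⟩⟩
  · exact hi.congr fun a => by
      cases hla : l a with
      | nil => rfl
      | cons b _ => exact hβ.elim b
  · exact PT.foldl_of_inhabited d hl hi hg B hB h

/-- Folds over lists through states that satisfy an invariant which bounds their length. -/
theorem PT.foldl_of_inv {l : α → List β} {init : α → σ} {g : α → σ → β → σ} (hl : PT l)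
    (hi : PT init) (hg : PT fun p : α × σ × β => g p.1 p.2.1 p.2.2) (I : α → ℕ → σ → Prop)
    (h0 : ∀ a, I a 0 (init a)) (hs : ∀ a i s b, I a i s → I a (i + 1) (g a s b))
    (B : α → ℕ) (hB : PB B) (h : ∀ a s i, i ≤ (l a).length → I a i s → sz s ≤ B a) :
    PT fun a => (l a).foldl (g a) (init a) := by
  refine PT.foldl hl hi hg B hB fun a i hi => h a _ i hi ?_
  have key : ∀ (m : List β) (j : ℕ) (s : σ), I a j s → I a (j + m.length) (m.foldl (g a) s) := by
    intro m
    induction m with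
    | nil => intro j s h; exact h
    | cons b m ih =>
      intro j s h
      have := ih (j + 1) _ (hs a j s b h)
      rw [List.length_cons, Nat.add_comm m.length 1, ← Nat.add_assoc]
      exact this
  have := key ((l a).take i) 0 _ (h0 a)
  rwa [List.length_take, min_eq_left hi, Nat.zero_add] at this

@[fun_prop]
theorem PT.reverse {l : α → List β} (hl : PT l) : PT fun a => (l a).reverse := by
  have := PT.foldl (l := l) (init := fun _ => ([] : List β)) (g := fun _ acc b => b :: acc) hl
    (by fun_prop) (by fun_prop) (fun a => sz (l a)) hl.pb_sz (fun a i _ => by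
      have h := foldl_cons_eq (fun b : β => b) ((l a).take i) []
      rw [h, List.map_id', List.append_nil, sz_reverse]
      exact sz_take_le _ _)
  exact this.congr fun a => by rw [foldl_cons_eq (fun b : β => b)]; simp

@[fun_prop]
theorem PT.map {l : α → List β} {g : α → β → γ} (hl : PT l)
    (hg : PT fun p : α × β => g p.1 p.2) : PT fun a => (l a).map (g a) := by
  have hgs := hg.pb_sz
  obtain ⟨q, hq⟩ := hgs
  have := PT.foldl (l := l) (init := fun _ => ([] : List γ)) (g := fun a acc b => g a b :: acc) hl
    (by fun_prop) (by fun_prop)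
    (fun a => 1 + sz (l a) * (1 + q.eval (1 + sz a + sz (l a))))
    ((PB.const 1).add (hl.pb_sz.mul ((PB.const 1).add (PB.eval q
      (((PB.const 1).add PB.self).add hl.pb_sz))))) (fun a i _ => by
      rw [foldl_cons_eq, List.append_nil]
      refine (sz_list_le (B := q.eval (1 + sz a + sz (l a))) ?_).trans ?_
      · intro c hc
        obtain ⟨b, hb, rfl⟩ := List.mem_map.1 (List.mem_reverse.1 hc)
        refine (hq (a, b)).trans (eval_mono q ?_)
        rw [sz_pair]
        have := sz_le_of_mem (List.mem_of_mem_take hb)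
        omega
      · have h1 : (((l a).take i).map (g a)).reverse.length ≤ sz (l a) := by
          have := length_lt_sz (l a)
          simp; omega
        exact Nat.add_le_add_left (Nat.mul_le_mul_right _ h1) 1)
  exact this.reverse.congr fun a => by rw [foldl_cons_eq]; simp

@[fun_prop]
theorem PT.append {l m : α → List β} (hl : PT l) (hm : PT m) : PT fun a => l a ++ m a := by
  have := PT.foldl (l := fun a => (l a).reverse) (init := m) (g := fun _ acc b => b :: acc)
    (by fun_prop) hm (by fun_prop) (fun a => sz (l a).reverse + sz (m a))
    (PB.add (PT.pb_sz (by fun_prop)) hm.pb_sz) (fun a i _ => by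
      rw [foldl_cons_eq (fun b : β => b), List.map_id']
      have h := sz_append ((l a).reverse.take i).reverse (m a)
      rw [sz_reverse] at h
      have := sz_take_le (l a).reverse i
      omega)
  exact this.congr fun a => by rw [foldl_cons_eq (fun b : β => b)]; simp

@[fun_prop]
theorem PT.sum {l : α → List ℤ} (hl : PT l) : PT fun a => (l a).sum := by
  have key : ∀ (m : List ℤ) (z : ℤ), sz (m.foldl (fun s b => s + b) z) ≤ sz z + sz m := by
    intro m
    induction m with
    | nil => intro z; simp
    | cons b m ih =>
      intro z
      have h1 := ih (z + b)
      have h2 := sz_add_le z b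
      rw [List.foldl_cons, sz_cons]; omega
  have := PT.foldl (l := l) (init := fun _ => (0 : ℤ)) (g := fun _ s b => s + b) hl
    (by fun_prop) (by fun_prop) (fun a => sz (0 : ℤ) + sz (l a))
    ((PB.const _).add hl.pb_sz) (fun a i _ => (key _ _).trans
      (Nat.add_le_add_left (sz_take_le _ _) _))
  exact this.congr fun a => by rw [List.sum_eq_foldl]

@[fun_prop]
theorem PT.getD {l : α → List β} {i : α → ℕ} {d : α → β} (hl : PT l) (hi : PT i) (hd : PT d) :
    PT fun a => (l a).getD (i a) (d a) := by
  -- The counter descends from the index, and the element read at `0` is kept. As an integer it then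
  -- becomes negative, so no later element is taken.
  let step : α → ℤ × β → β → ℤ × β := fun _ s b => (s.1 - 1, if s.1 = 0 then b else s.2)
  have key : ∀ (a : α) (m : List β) (z : ℤ) (b : β),
      (m.foldl (step a) (z, b)).1 = z - m.length ∧
      ((m.foldl (step a) (z, b)).2 ∈ m ∨ (m.foldl (step a) (z, b)).2 = b) := by
    intro a m
    induction m with
    | nil => intro z b; simp
    | cons c m ih =>
      intro z b
      rw [List.foldl_cons]
      have h1 := ih (z - 1) (if z = 0 then c else b)
      refine ⟨by rw [h1.1, List.length_cons]; push_cast; ring, ?_⟩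
      change (m.foldl (step a) (z - 1, if z = 0 then c else b)).2 ∈ c :: m ∨
        (m.foldl (step a) (z - 1, if z = 0 then c else b)).2 = b
      rcases h1.2 with h | h
      · exact .inl (List.mem_cons_of_mem _ h)
      · rw [h]; by_cases hz : z = 0 <;> simp [hz]
  have := PT.foldl (l := l) (init := fun a => ((i a : ℤ), d a)) (g := step) hl
    (by fun_prop) (by simp only [step]; fun_prop)
    (fun a => 1 + (sz (i a : ℤ) + sz (l a)) + (sz (l a) + sz (d a)))
    (((PB.const 1).add ((PT.pb_sz (by fun_prop)).add hl.pb_sz)).add (hl.pb_sz.add hd.pb_sz))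
    (fun a k hk => by
      obtain ⟨h1, h2⟩ := key a ((l a).take k) (i a) (d a)
      rw [← Prod.mk.eta (p := List.foldl _ _ _), sz_pair, h1]
      have h3 := sz_sub_le (i a : ℤ) (((l a).take k).length : ℤ)
      have h4 : sz (((l a).take k).length : ℤ) ≤ sz (l a) := by
        rw [sz_int, Int.natAbs_natCast]
        have h5 := length_lt_sz (l a)
        have h6 : Nat.size ((l a).take k).length ≤ ((l a).take k).length :=
          Nat.size_le.2 Nat.lt_two_pow_self
        rw [List.length_take] at *; omega
      have h7 : sz (((l a).take k).foldl (step a) ((i a : ℤ), d a)).2 ≤ sz (l a) + sz (d a) := by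
        rcases h2 with h | h
        · have := sz_le_of_mem (List.mem_of_mem_take h); omega
        · rw [h]; omega
      omega)
  refine this.snd.congr fun a => ?_
  have neg : ∀ (m : List β) (z : ℤ) (b : β), z < 0 → (m.foldl (step a) (z, b)).2 = b := by
    intro m
    induction m with
    | nil => intro z b _; rfl
    | cons c m ih =>
      intro z b hz
      rw [List.foldl_cons]
      have := ih (z - 1) (if z = 0 then c else b) (by omega)
      rw [if_neg hz.ne] at this
      simpa [step, hz.ne] using this
  have main : ∀ (m : List β) (k : ℕ) (b : β), m.getD k b = (m.foldl (step a) ((k : ℤ), b)).2 := by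
    intro m
    induction m with
    | nil => intro k b; simp
    | cons c m ih =>
      intro k b
      rw [List.foldl_cons]
      cases k with
      | zero => simp [step, neg m (-1)]
      | succ k =>
        have e : step a (((k + 1 : ℕ) : ℤ), b) c = ((k : ℤ), b) := by
          simp [step]; omega
        rw [e, ← ih]; simp
  exact main _ _ _

@[fun_prop]
theorem PT.filter {l : α → List β} {g : α → β → Bool} (hl : PT l)
    (hg : PT fun p : α × β => g p.1 p.2) : PT fun a => (l a).filter (g a) := by
  have key : ∀ (a : α) (m acc : List β),
      m.foldl (fun acc b => bif g a b then b :: acc else acc) acc =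
        (m.filter (g a)).reverse ++ acc := by
    intro a m
    induction m with
    | nil => intro acc; rfl
    | cons b m ih =>
      intro acc
      rw [List.foldl_cons, ih]
      cases hb : g a b <;> simp [hb]
  have ef : ∀ a (m : List β), sz (m.filter (g a)) ≤ sz m := fun a m => by
    induction m with
    | nil => simp
    | cons b m ih =>
      cases hb : g a b <;> simp only [hb, List.filter_cons, sz_cons, if_true, Bool.false_eq_true,
        if_false] <;> omega
  have := PT.foldl (l := l) (init := fun _ => ([] : List β))
    (g := fun a acc b => bif g a b then b :: acc else acc) hl
    (by fun_prop) (by fun_prop) (fun a => sz (l a)) hl.pb_sz (fun a i _ => by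
      rw [key, List.append_nil, sz_reverse]
      exact (ef _ _).trans (sz_take_le _ _))
  exact this.reverse.congr fun a => by rw [key]; simp

/-- The indices `0, …, length - 1` of a list. -/
theorem PT.range_length {l : α → List β} (hl : PT l) : PT fun a => List.range (l a).length := by
  have key : ∀ (m : List β) (k : ℕ),
      m.foldl (fun (s : ℕ × List ℕ) _ => (s.1 + 1, s.1 :: s.2)) (k, (List.range k).reverse) =
        (k + m.length, (List.range (k + m.length)).reverse) := by
    intro m
    induction m with
    | nil => intro k; simp
    | cons b m ih =>
      intro k
      rw [List.foldl_cons]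
      have h := ih (k + 1)
      rw [List.range_succ, List.reverse_append] at h
      rw [List.length_cons, Nat.add_comm m.length 1, ← Nat.add_assoc]
      exact h
  have hsz : ∀ k n : ℕ, k ≤ n → sz k ≤ 1 + n := fun k n h => by
    rw [sz_nat]
    have : Nat.size k ≤ k := Nat.size_le.2 Nat.lt_two_pow_self
    omega
  have hsz' : ∀ k n : ℕ, k ≤ n → sz (List.range k).reverse ≤ 1 + n * (2 + n) := fun k n h => by
    refine (sz_list_le (B := 1 + n) ?_).trans ?_
    · intro c hc
      have := List.mem_range.1 (List.mem_reverse.1 hc)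
      exact hsz _ _ (by omega)
    · rw [List.length_reverse, List.length_range]
      have := Nat.mul_le_mul_right (1 + (1 + n)) h
      rw [show 2 + n = 1 + (1 + n) by omega]; omega
  have hlen : PB fun a => (l a).length := hl.pb_sz.of_le fun a => (length_lt_sz _).le
  have := PT.foldl (l := l) (init := fun _ => ((0, []) : ℕ × List ℕ))
    (g := fun _ s _ => (s.1 + 1, s.1 :: s.2)) hl
    (by fun_prop) (by fun_prop)
    (fun a => 1 + (1 + (l a).length) + (1 + (l a).length * (2 + (l a).length)))
    (((PB.const 1).add ((PB.const 1).add hlen)).add ((PB.const 1).add (hlen.mul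
      ((PB.const 2).add hlen)))) (fun a i _ => by
      have h := key ((l a).take i) 0
      simp only [List.range_zero, List.reverse_nil, Nat.zero_add] at h
      rw [h, sz_pair]
      have h1 : ((l a).take i).length ≤ (l a).length := by simp
      have h2 := hsz _ _ h1
      have h3 := hsz' _ _ h1
      omega)
  exact this.snd.reverse.congr fun a => by
    have h := key (l a) 0
    simp only [List.range_zero, List.reverse_nil, Nat.zero_add] at h
    simp [h]

/-- A list whose length is the number of binary digits. -/
def fuel (z : ℤ) : List ℤ := List.replicate (Nat.size z.natAbs) 0

-- Doubles `1` until it exceeds `|z|` and adds one list entry per doubling. Such lists drive the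
-- Euclidean algorithm and `stab`, which thereby become folds with a number of rounds known in
-- advance.
@[fun_prop]
theorem PT.fuel {f : α → ℤ} (hf : PT f) : PT fun a => fuel (f a) := by
  refine PT.comp (g := UnitAb.fuel) ?_ hf
  have key : ∀ (z : ℤ) (i : ℕ) (k : ℕ),
      (fun p : ℤ × ℤ × List ℤ => (p.1, p.2.1 * 2, 0 :: p.2.2))^[i]
        (z, 2 ^ k, List.replicate k 0) = (z, 2 ^ (k + i), List.replicate (k + i) 0) := by
    intro z i
    induction i with
    | zero => intro k; rfl
    | succ i ih =>
      intro k
      rw [Function.iterate_succ_apply]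
      have := ih (k + 1)
      rw [pow_succ, List.replicate_succ] at this
      rw [Nat.add_comm i 1, ← Nat.add_assoc]
      exact this
  have key0 : ∀ (z : ℤ) (i : ℕ),
      (fun p : ℤ × ℤ × List ℤ => (p.1, p.2.1 * 2, 0 :: p.2.2))^[i] (z, 1, []) =
        (z, 2 ^ i, List.replicate i 0) := fun z i => by
    have := key z i 0
    simpa using this
  have hlt : ∀ (z : ℤ) (i : ℕ), (2 : ℤ) ^ i ≤ (z.natAbs : ℤ) ↔ i < Nat.size z.natAbs :=
    fun z i => by rw [Nat.lt_size]; exact_mod_cast Iff.rfl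
  have := PT.while_iterate (σ := ℤ × ℤ × List ℤ) (α := ℤ)
    (c := fun p => decide (p.2.1 ≤ (p.1.natAbs : ℤ)))
    (g := fun p => (p.1, p.2.1 * 2, 0 :: p.2.2)) (init := fun z => (z, 1, [])) (by fun_prop)
    -- `sz z - 1` is the number of binary digits of `z`.
    (by fun_prop) (by fun_prop) (fun z => sz z - 1) (PB.self.of_le fun z => Nat.sub_le _ _)
    (fun z => 3 + sz z + (2 + sz z) + sz z * 2) ((((PB.const 3).add PB.self).add
      ((PB.const 2).add PB.self)).add (PB.self.mul (PB.const 2)))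
    (fun z i hi => by
      rw [key0]
      rw [sz_int, Nat.add_sub_cancel_left] at hi
      simpa using (hlt z i).2 hi)
    (fun z => by
      rw [key0, sz_int, Nat.add_sub_cancel_left]
      have := (hlt z (Nat.size z.natAbs)).not.2 (lt_irrefl _)
      simpa using this)
    (fun z i hi => by
      rw [key0, sz_pair, sz_pair]
      have h1 := sz_int_le_of_lt (x := 2 ^ i) (k := i + 1) (by
        rw [Int.natAbs_pow]; exact Nat.pow_lt_pow_right (by norm_num) (by simp))
      have h2 : ∀ i, sz (List.replicate i (0 : ℤ)) = 1 + i * 2 := fun i => by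
        induction i with
        | zero => rfl
        | succ i ih =>
          rw [List.replicate_succ, sz_cons, ih, sz_int]
          simp; omega
      rw [h2]
      omega)
  refine this.snd.snd.congr fun z => ?_
  rw [key0, sz_int, Nat.add_sub_cancel_left]; rfl

theorem length_fuel (z : ℤ) : (fuel z).length = Nat.size z.natAbs := List.length_replicate

end Lists

/-! ## The algorithm -/

/-- Reduction modulo a positive integer, and zero for other moduli. -/
def md (e z : ℤ) : ℤ := if 0 < e then z % e else 0

/-- One step of the extended Euclidean algorithm with least absolute remainders; cofactors are
reduced modulo `m`. -/
def euclidStep (m : ℤ) (s : (ℤ × ℤ) × (ℤ × ℤ)) : (ℤ × ℤ) × (ℤ × ℤ) :=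
  if s.2.1 = 0 then s
  else if 2 * (s.1.1 % s.2.1) ≤ s.2.1 then
    (s.2, (s.1.1 % s.2.1, md m (s.1.2 - s.1.1 / s.2.1 * s.2.2)))
  else
    (s.2, (s.2.1 - s.1.1 % s.2.1, md m ((s.1.1 / s.2.1 + 1) * s.2.2 - s.1.2)))

/-- The greatest common divisor of `a` and `b`, and its cofactor of `a` modulo `m`. -/
def xgcd (m a b : ℤ) : ℤ × ℤ :=
  ((fuel b).foldl (fun s _ => euclidStep m s) ((a, 1), ((b.natAbs : ℤ), 0))).1

/-- The greatest common divisor. -/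
def gcdZ (a b : ℤ) : ℤ := (xgcd 1 (a.natAbs : ℤ) b).1

/-- An integer `t` such that `a + t * b` generates the ideal `(a, b)` modulo `e`. -/
def stab (e a b : ℤ) : ℤ := (fuel e).foldl (fun c _ => c / gcdZ c (a / gcdZ a b)) e

/-- The greatest common divisor of a list. -/
def content (r : List ℤ) : ℤ := r.foldl gcdZ 0

/-- `w + t * r` modulo `e`. -/
def addMul (e : ℤ) (is : List ℕ) (w : List ℤ) (t : ℤ) (r : List ℤ) : List ℤ :=
  is.map fun i => md e (w.getD i 0 + t * r.getD i 0)

/-- Add `s` times the entry `j` to the entry `k`, modulo `e`. -/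
def colAdd (e : ℤ) (is : List ℕ) (k j : ℕ) (s : ℤ) (r : List ℤ) : List ℤ :=
  is.map fun i => md e (r.getD i 0 + if i = k then s * r.getD j 0 else 0)

/-- A linear combination of rows whose content generates the ideal of all entries. -/
def rowComb (e : ℤ) (is : List ℕ) (M : List (List ℤ)) : List ℤ :=
  M.foldl (fun w r => addMul e is w (stab e (content w) (content r)) r) (is.map fun _ => 0)

/-- Column operation that improves the pivot in the first row. -/
def gather (e : ℤ) (is : List ℕ) (k : ℕ)
    (s : List (List ℤ) × List (List ℤ) × List (List ℤ)) (j : ℕ) :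
    List (List ℤ) × List (List ℤ) × List (List ℤ) :=
  (s.1.map (colAdd e is k j (stab e ((s.1.headD []).getD k 0) ((s.1.headD []).getD j 0))),
    s.2.1.map (colAdd e is k j (stab e ((s.1.headD []).getD k 0) ((s.1.headD []).getD j 0))),
    s.2.2.map (colAdd e is j k (-stab e ((s.1.headD []).getD k 0) ((s.1.headD []).getD j 0))))

/-- Column operation that clears the entry `j` of the row `w` with pivot `g`. -/
def clear (e : ℤ) (is : List ℕ) (k : ℕ) (w : List ℤ) (g : ℤ)
    (s : List (List ℤ) × List (List ℤ)) (j : ℕ) : List (List ℤ) × List (List ℤ) :=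
  (s.1.map (colAdd e is j k (-(w.getD j 0 / g))), s.2.map (colAdd e is k j (w.getD j 0 / g)))

/-- The states of the Smith algorithm: the remaining relations, the coordinate transformation, the
transpose of its inverse, and the list of invariants. -/
abbrev SmithState : Type :=
  (List (List ℤ) × List (List ℤ) × List (List ℤ)) × List ℤ

/-- The state after the pivot has been made a generator of the ideal of all entries. -/
def gathered (e : ℤ) (is : List ℕ) (k : ℕ) (s : SmithState) :
    List (List ℤ) × List (List ℤ) × List (List ℤ) :=
  (is.filter fun j => decide (k < j)).foldl (gather e is k)
    (rowComb e is s.1.1 :: s.1.1, s.1.2.1, s.1.2.2)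

/-- Second half of a step: normalize the pivot, reduce the rows, and clear the pivot row. -/
def reduceStep (e : ℤ) (is : List ℕ) (k : ℕ)
    (s : List (List ℤ) × List (List ℤ) × List (List ℤ)) (ds : List ℤ) (gu : ℤ × ℤ)
    (w : List ℤ) : SmithState :=
  ((s.1.map fun r => addMul e is r (-(r.getD k 0 / gu.1)) w,
    (is.filter fun j => decide (k < j)).foldl (clear e is k w gu.1) s.2), ds ++ [gu.1])

/-- One step of the Smith algorithm. -/
def smithStep (e : ℤ) (is : List ℕ) (s : SmithState) (k : ℕ) : SmithState :=
  reduceStep e is k (gathered e is k s) s.2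
    (xgcd e (((gathered e is k s).1.headD []).getD k 0) e)
    (addMul e is [] (xgcd e (((gathered e is k s).1.headD []).getD k 0) e).2
      ((gathered e is k s).1.headD []))

/-- The identity matrix modulo `e`. -/
def idMat (e : ℤ) (is : List ℕ) : List (List ℤ) :=
  is.map fun i => is.map fun j => md e (if i = j then 1 else 0)

/-- The Smith algorithm modulo `e`. -/
def smith (e : ℤ) (is : List ℕ) (M : List (List ℤ)) : SmithState :=
  is.foldl (smithStep e is)
    ((M.map fun r => addMul e is [] 1 r, idMat e is, idMat e is), [])

/-! ### Running time of the Smith algorithm. -/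

section PT

variable {α : Type} [Enc α]

/-- The value zero at nonpositive moduli makes this unconditional; `PT` demands time bounds on all
inputs, also on those for which the algorithm has no meaning. -/
theorem sz_md_le (e z : ℤ) : sz (md e z) ≤ sz e := by
  unfold md
  split_ifs with h
  · exact sz_int_le_of_natAbs_le (by
      have := Int.emod_lt_of_pos z h; have := Int.emod_nonneg z h.ne'; omega)
  · exact sz_int_le_of_natAbs_le (by simp)

@[fun_prop]
theorem PT.md {e z : α → ℤ} (he : PT e) (hz : PT z) : PT fun a => md (e a) (z a) := by
  unfold UnitAb.md; fun_prop

@[fun_prop]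
theorem PT.euclidStep {m : α → ℤ} {s : α → (ℤ × ℤ) × (ℤ × ℤ)} (hm : PT m) (hs : PT s) :
    PT fun a => euclidStep (m a) (s a) := by
  unfold UnitAb.euclidStep; fun_prop

/-- An invariant of the Euclidean algorithm that bounds the lengths. -/
def EuclidBound (B : ℕ) (s : (ℤ × ℤ) × (ℤ × ℤ)) : Prop :=
  0 ≤ s.2.1 ∧ sz s.1.1 ≤ B ∧ sz s.2.1 ≤ B ∧ sz s.1.2 ≤ B ∧ sz s.2.2 ≤ B

theorem EuclidBound.step {B : ℕ} {m : ℤ} (hm : sz m ≤ B) {s : (ℤ × ℤ) × (ℤ × ℤ)}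
    (h : EuclidBound B s) : EuclidBound B (euclidStep m s) := by
  obtain ⟨h1, h2, h3, h4, h5⟩ := h
  unfold euclidStep
  split_ifs with h6 h7
  · exact ⟨h1, h2, h3, h4, h5⟩
  all_goals
    have h8 := Int.emod_lt_of_pos s.1.1 (lt_of_le_of_ne h1 (Ne.symm h6))
    have h9 := Int.emod_nonneg s.1.1 h6
    refine ⟨by dsimp only; omega, h3, (sz_int_le_of_natAbs_le ?_).trans h3, h5,
      (sz_md_le _ _).trans hm⟩
    dsimp only; omega

theorem EuclidBound.foldl {B : ℕ} {m : ℤ} (hm : sz m ≤ B) (l : List ℤ)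
    (s : (ℤ × ℤ) × (ℤ × ℤ)) (h : EuclidBound B s) :
    EuclidBound B (l.foldl (fun s _ => euclidStep m s) s) := by
  induction l generalizing s with
  | nil => exact h
  | cons a l ih => exact ih _ (h.step hm)

theorem euclidBound_init (m a b : ℤ) :
    EuclidBound (sz m + sz a + sz b) ((a, 1), ((b.natAbs : ℤ), 0)) := by
  have h1 := one_le_sz m
  have h2 := one_le_sz a
  have h3 := one_le_sz b
  have h4 : sz (b.natAbs : ℤ) = sz b := by simp only [sz_int, Int.natAbs_natCast]
  have h5 : sz (1 : ℤ) = 2 := rfl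
  have h6 : sz (0 : ℤ) = 1 := rfl
  refine ⟨by simp, ?_, ?_, ?_, ?_⟩ <;> dsimp only <;> omega

@[fun_prop]
theorem PT.xgcd {m a b : α → ℤ} (hm : PT m) (ha : PT a) (hb : PT b) :
    PT fun x => xgcd (m x) (a x) (b x) := by
  unfold UnitAb.xgcd
  refine PT.fst (PT.foldl_of_inv (g := fun x s _ => UnitAb.euclidStep (m x) s)
    (by fun_prop) (by fun_prop) (by fun_prop)
    (fun x _ s => EuclidBound (sz (m x) + sz (a x) + sz (b x)) s)
    (fun x => euclidBound_init _ _ _) (fun x _ s _ h => h.step (by omega))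
    (fun x => 3 + 4 * (sz (m x) + sz (a x) + sz (b x)))
    ((PB.const _).add ((PB.const 4).mul ((hm.pb_sz.add ha.pb_sz).add hb.pb_sz)))
    fun x s _ _ h => ?_)
  obtain ⟨-, h1, h2, h3, h4⟩ := h
  change 1 + (1 + sz s.1.1 + sz s.1.2) + (1 + sz s.2.1 + sz s.2.2) ≤ _
  omega

@[fun_prop]
theorem PT.gcdZ {a b : α → ℤ} (ha : PT a) (hb : PT b) : PT fun x => gcdZ (a x) (b x) := by
  unfold UnitAb.gcdZ; fun_prop

theorem sz_xgcd_fst_le (m a b : ℤ) : sz (xgcd m a b).1 ≤ sz m + sz a + sz b :=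
  (EuclidBound.foldl (by omega) (fuel b) _ (euclidBound_init m a b)).2.1

@[fun_prop]
theorem PT.stab {e a b : α → ℤ} (he : PT e) (ha : PT a) (hb : PT b) :
    PT fun x => stab (e x) (a x) (b x) := by
  unfold UnitAb.stab
  exact PT.foldl_of_inv (g := fun x c _ => c / UnitAb.gcdZ c (a x / UnitAb.gcdZ (a x) (b x)))
    (by fun_prop) he (by fun_prop) (fun x _ c => sz c ≤ sz (e x)) (fun x => le_rfl)
    (fun x _ c _ h => (sz_ediv_le _ _).trans h) (fun x => sz (e x)) he.pb_sz
    (fun x s _ _ h => h)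

@[fun_prop]
theorem PT.content {r : α → List ℤ} (hr : PT r) : PT fun x => content (r x) := by
  -- One gcd has length at most `2 + sz g + sz z ≤ sz g + 3 * sz z`, hence the factor 3.
  have key : ∀ (l : List ℤ) (g : ℤ), sz (l.foldl UnitAb.gcdZ g) ≤ sz g + 3 * sz l := by
    intro l
    induction l with
    | nil => intro g; simp
    | cons z l ih =>
      intro g
      have h1 := ih (UnitAb.gcdZ g z)
      have h2 : sz (UnitAb.gcdZ g z) ≤ sz (1 : ℤ) + sz (g.natAbs : ℤ) + sz z :=
        sz_xgcd_fst_le _ _ _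
      have h3 : sz (g.natAbs : ℤ) = sz g := by simp only [sz_int, Int.natAbs_natCast]
      have h5 : sz (1 : ℤ) = 2 := rfl
      have h6 := one_le_sz z
      rw [List.foldl_cons, sz_cons]
      omega
  unfold UnitAb.content
  exact PT.foldl (g := fun _ g z => UnitAb.gcdZ g z) hr (by fun_prop) (by fun_prop)
    (fun x => sz (0 : ℤ) + 3 * sz (r x)) ((PB.const _).add ((PB.const 3).mul hr.pb_sz))
    (fun x i _ => (key _ _).trans (Nat.add_le_add_left (Nat.mul_le_mul_left _ (sz_take_le _ _)) _))

@[fun_prop]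
theorem PT.addMul {e t : α → ℤ} {is : α → List ℕ} {w r : α → List ℤ} (he : PT e) (his : PT is)
    (hw : PT w) (ht : PT t) (hr : PT r) :
    PT fun x => addMul (e x) (is x) (w x) (t x) (r x) := by
  unfold UnitAb.addMul; fun_prop

@[fun_prop]
theorem PT.colAdd {e s : α → ℤ} {is : α → List ℕ} {k j : α → ℕ} {r : α → List ℤ} (he : PT e)
    (his : PT is) (hk : PT k) (hj : PT j) (hs : PT s) (hr : PT r) :
    PT fun x => colAdd (e x) (is x) (k x) (j x) (s x) (r x) := by
  unfold UnitAb.colAdd; fun_prop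

/-- A row of bounded length with entries of bounded length. -/
def RowBd (B n : ℕ) (r : List ℤ) : Prop := r.length ≤ n ∧ ∀ z ∈ r, sz z ≤ B

/-- A list of at most `c` rows of bounded length with entries of bounded length. -/
def MatBd (B n c : ℕ) (M : List (List ℤ)) : Prop := M.length ≤ c ∧ ∀ r ∈ M, RowBd B n r

theorem RowBd.sz_le {B n : ℕ} {r : List ℤ} (h : RowBd B n r) : sz r ≤ 1 + n * (1 + B) :=
  (sz_list_le h.2).trans (Nat.add_le_add_left (Nat.mul_le_mul_right _ h.1) 1)

theorem MatBd.sz_le {B n c : ℕ} {M : List (List ℤ)} (h : MatBd B n c M) :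
    sz M ≤ 1 + c * (1 + (1 + n * (1 + B))) :=
  (sz_list_le fun r hr => (h.2 r hr).sz_le).trans
    (Nat.add_le_add_left (Nat.mul_le_mul_right _ h.1) 1)

theorem rowBd_self (r : List ℤ) : RowBd (sz r) (sz r) r :=
  ⟨(length_lt_sz r).le, fun _ hz => (sz_le_of_mem hz).le⟩

theorem RowBd.mono {B B' n n' : ℕ} (hB : B ≤ B') (hn : n ≤ n') {r : List ℤ} (h : RowBd B n r) :
    RowBd B' n' r :=
  ⟨h.1.trans hn, fun z hz => (h.2 z hz).trans hB⟩

theorem MatBd.mono {B B' n n' c c' : ℕ} (hB : B ≤ B') (hn : n ≤ n') (hc : c ≤ c')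
    {M : List (List ℤ)} (h : MatBd B n c M) : MatBd B' n' c' M :=
  ⟨h.1.trans hc, fun r hr => (h.2 r hr).mono hB hn⟩

theorem matBd_self (M : List (List ℤ)) : MatBd (sz M) (sz M) (sz M) M :=
  ⟨(length_lt_sz M).le, fun r hr =>
    (rowBd_self r).mono (sz_le_of_mem hr).le (sz_le_of_mem hr).le⟩

theorem rowBd_map_md {B n : ℕ} {e : ℤ} (he : sz e ≤ B) {is : List ℕ} (hn : is.length ≤ n)
    (f : ℕ → ℤ) : RowBd B n (is.map fun i => md e (f i)) :=
  ⟨by rwa [List.length_map], fun z hz => by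
    obtain ⟨i, -, rfl⟩ := List.mem_map.1 hz
    exact (sz_md_le _ _).trans he⟩

theorem MatBd.map {B n c : ℕ} {M : List (List ℤ)} (h : M.length ≤ c) {f : List ℤ → List ℤ}
    (hf : ∀ r, RowBd B n (f r)) : MatBd B n c (M.map f) :=
  ⟨by rwa [List.length_map], fun r hr => by
    obtain ⟨s, -, rfl⟩ := List.mem_map.1 hr
    exact hf s⟩

theorem rowBd_rowComb {B n : ℕ} {e : ℤ} (he : sz e ≤ B) {is : List ℕ} (hn : is.length ≤ n)
    (M : List (List ℤ)) : RowBd B n (rowComb e is M) := by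
  unfold rowComb
  have key : ∀ (M : List (List ℤ)) (w : List ℤ), RowBd B n w →
      RowBd B n (M.foldl (fun w r => addMul e is w (stab e (content w) (content r)) r) w) := by
    intro M
    induction M with
    | nil => intro w h; exact h
    | cons r M ih => intro w _; exact ih _ (rowBd_map_md he hn _)
  exact key _ _ ⟨by rwa [List.length_map], fun z hz => by
    obtain ⟨i, -, rfl⟩ := List.mem_map.1 hz
    exact (one_le_sz e).trans he⟩

@[fun_prop]
theorem PT.rowComb {e : α → ℤ} {is : α → List ℕ} {M : α → List (List ℤ)} (he : PT e)
    (his : PT is) (hM : PT M) : PT fun x => rowComb (e x) (is x) (M x) := by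
  refine PT.foldl (g := fun x w r => UnitAb.addMul (e x) (is x) w
      (UnitAb.stab (e x) (UnitAb.content w) (UnitAb.content r)) r) hM (by fun_prop)
    (by fun_prop) (fun x => 1 + sz (is x) * (1 + sz (e x)))
    ((PB.const 1).add (his.pb_sz.mul ((PB.const 1).add he.pb_sz)))
    (fun x i _ => (rowBd_rowComb le_rfl (length_lt_sz (is x)).le ((M x).take i)).sz_le)

theorem gather_bd {B n c c' : ℕ} {e : ℤ} (he : sz e ≤ B) {is : List ℕ} (hn : is.length ≤ n)
    (k : ℕ) {s : List (List ℤ) × List (List ℤ) × List (List ℤ)}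
    (h : MatBd B n c s.1 ∧ MatBd B n c' s.2.1 ∧ MatBd B n c' s.2.2) (j : ℕ) :
    MatBd B n c (gather e is k s j).1 ∧ MatBd B n c' (gather e is k s j).2.1 ∧
      MatBd B n c' (gather e is k s j).2.2 :=
  ⟨MatBd.map h.1.1 fun _ => rowBd_map_md he hn _, MatBd.map h.2.1.1 fun _ => rowBd_map_md he hn _,
    MatBd.map h.2.2.1 fun _ => rowBd_map_md he hn _⟩

theorem foldl_gather_bd {B n c c' : ℕ} {e : ℤ} (he : sz e ≤ B) {is : List ℕ}
    (hn : is.length ≤ n) (k : ℕ) (js : List ℕ)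
    {s : List (List ℤ) × List (List ℤ) × List (List ℤ)}
    (h : MatBd B n c s.1 ∧ MatBd B n c' s.2.1 ∧ MatBd B n c' s.2.2) :
    MatBd B n c (js.foldl (gather e is k) s).1 ∧
      MatBd B n c' (js.foldl (gather e is k) s).2.1 ∧
      MatBd B n c' (js.foldl (gather e is k) s).2.2 := by
  induction js generalizing s with
  | nil => exact h
  | cons j js ih => exact ih (gather_bd he hn k h j)

theorem clear_bd {B n c : ℕ} {e : ℤ} (he : sz e ≤ B) {is : List ℕ} (hn : is.length ≤ n)
    (k : ℕ) (w : List ℤ) (g : ℤ) {s : List (List ℤ) × List (List ℤ)}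
    (h : MatBd B n c s.1 ∧ MatBd B n c s.2) (j : ℕ) :
    MatBd B n c (clear e is k w g s j).1 ∧ MatBd B n c (clear e is k w g s j).2 :=
  ⟨MatBd.map h.1.1 fun _ => rowBd_map_md he hn _, MatBd.map h.2.1 fun _ => rowBd_map_md he hn _⟩

theorem foldl_clear_bd {B n c : ℕ} {e : ℤ} (he : sz e ≤ B) {is : List ℕ} (hn : is.length ≤ n)
    (k : ℕ) (w : List ℤ) (g : ℤ) (js : List ℕ) {s : List (List ℤ) × List (List ℤ)}
    (h : MatBd B n c s.1 ∧ MatBd B n c s.2) :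
    MatBd B n c (js.foldl (clear e is k w g) s).1 ∧
      MatBd B n c (js.foldl (clear e is k w g) s).2 := by
  induction js generalizing s with
  | nil => exact h
  | cons j js ih => exact ih (clear_bd he hn k w g h j)

@[fun_prop]
theorem PT.gather {e : α → ℤ} {is : α → List ℕ} {k j : α → ℕ}
    {s : α → List (List ℤ) × List (List ℤ) × List (List ℤ)} (he : PT e) (his : PT is)
    (hk : PT k) (hs : PT s) (hj : PT j) :
    PT fun x => gather (e x) (is x) (k x) (s x) (j x) := by
  unfold UnitAb.gather; fun_prop

@[fun_prop]
theorem PT.clear {e g : α → ℤ} {is : α → List ℕ} {k j : α → ℕ} {w : α → List ℤ}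
    {s : α → List (List ℤ) × List (List ℤ)} (he : PT e) (his : PT is)
    (hk : PT k) (hw : PT w) (hg : PT g) (hs : PT s) (hj : PT j) :
    PT fun x => clear (e x) (is x) (k x) (w x) (g x) (s x) (j x) := by
  unfold UnitAb.clear; fun_prop

theorem PB.mat {B n c : α → ℕ} (hB : PB B) (hn : PB n) (hc : PB c) :
    PB fun x => 1 + c x * (1 + (1 + n x * (1 + B x))) :=
  (PB.const 1).add (hc.mul ((PB.const 1).add ((PB.const 1).add (hn.mul ((PB.const 1).add hB)))))

@[fun_prop]
theorem PT.gathered {e : α → ℤ} {is : α → List ℕ} {k : α → ℕ} {s : α → SmithState} (he : PT e)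
    (his : PT is) (hk : PT k) (hs : PT s) : PT fun x => gathered (e x) (is x) (k x) (s x) := by
  have hB : PB fun x => sz (e x) + sz (is x) + sz (s x) + 1 :=
    ((he.pb_sz.add his.pb_sz).add hs.pb_sz).add (PB.const 1)
  have hm := hB.mat hB hB
  refine PT.foldl (g := fun x t j => UnitAb.gather (e x) (is x) (k x) t j) (by fun_prop)
    (by fun_prop) (by fun_prop) _ (((PB.const 2).add hm).add (hm.add hm)) fun x i _ => ?_
  have hsz : sz (s x) = 1 + (1 + sz (s x).1.1 + (1 + sz (s x).1.2.1 + sz (s x).1.2.2)) +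
    sz (s x).2 := rfl
  have hl := length_lt_sz (is x)
  obtain ⟨h1, h2, h3⟩ := foldl_gather_bd (B := sz (e x) + sz (is x) + sz (s x) + 1)
    (n := sz (e x) + sz (is x) + sz (s x) + 1) (c := sz (e x) + sz (is x) + sz (s x) + 1)
    (c' := sz (e x) + sz (is x) + sz (s x) + 1) (e := e x) (is := is x) (by omega) (by omega)
    (k x) (((is x).filter fun j => decide (k x < j)).take i)
    (s := (UnitAb.rowComb (e x) (is x) (s x).1.1 :: (s x).1.1, (s x).1.2.1, (s x).1.2.2))
    ⟨⟨by have := length_lt_sz (s x).1.1; simp; omega, fun r hr => by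
      rcases List.mem_cons.1 hr with rfl | hr
      · exact rowBd_rowComb (by omega) (by omega) _
      · exact ((matBd_self (s x).1.1).2 r hr).mono (by omega) (by omega)⟩,
      (matBd_self (s x).1.2.1).mono (by omega) (by omega) (by omega),
      (matBd_self (s x).1.2.2).mono (by omega) (by omega) (by omega)⟩
  have h1 := h1.sz_le
  have h2 := h2.sz_le
  have h3 := h3.sz_le
  rw [sz_prod, sz_prod (Prod.snd _)]
  eta_reduce
  omega

@[fun_prop]
theorem PT.reduceStep {e : α → ℤ} {is : α → List ℕ} {k : α → ℕ}
    {s : α → List (List ℤ) × List (List ℤ) × List (List ℤ)} {ds : α → List ℤ} {gu : α → ℤ × ℤ}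
    {w : α → List ℤ} (he : PT e) (his : PT is) (hk : PT k) (hs : PT s) (hds : PT ds)
    (hgu : PT gu) (hw : PT w) :
    PT fun x => reduceStep (e x) (is x) (k x) (s x) (ds x) (gu x) (w x) := by
  unfold UnitAb.reduceStep
  refine PT.prodMk (PT.prodMk (by fun_prop) ?_) (by fun_prop)
  have hB : PB fun x => sz (e x) + sz (is x) + sz (s x) :=
    (he.pb_sz.add his.pb_sz).add hs.pb_sz
  have hm := hB.mat hB hB
  refine PT.foldl (g := fun x t j => UnitAb.clear (e x) (is x) (k x) (w x) (gu x).1 t j)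
    (by fun_prop) (by fun_prop) (by fun_prop) _ (((PB.const 1).add hm).add hm) fun x i _ => ?_
  have hsz : sz (s x) = 1 + sz (s x).1 + (1 + sz (s x).2.1 + sz (s x).2.2) := rfl
  have hl := length_lt_sz (is x)
  obtain ⟨h1, h2⟩ := foldl_clear_bd (B := sz (e x) + sz (is x) + sz (s x))
    (n := sz (e x) + sz (is x) + sz (s x)) (c := sz (e x) + sz (is x) + sz (s x))
    (e := e x) (is := is x) (by omega) (by omega) (k x) (w x) (gu x).1
    (((is x).filter fun j => decide (k x < j)).take i) (s := (s x).2)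
    ⟨(matBd_self _).mono (by omega) (by omega) (by omega),
      (matBd_self _).mono (by omega) (by omega) (by omega)⟩
  have h1 := h1.sz_le
  have h2 := h2.sz_le
  rw [sz_prod]
  eta_reduce
  omega

@[fun_prop]
theorem PT.smithStep {e : α → ℤ} {is : α → List ℕ} {k : α → ℕ} {s : α → SmithState} (he : PT e)
    (his : PT is) (hs : PT s) (hk : PT k) : PT fun x => smithStep (e x) (is x) (s x) (k x) := by
  unfold UnitAb.smithStep; fun_prop

theorem headD_getD_sz_le {B n c : ℕ} (hB : 1 ≤ B) {M : List (List ℤ)} (h : MatBd B n c M)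
    (k : ℕ) : sz ((M.headD []).getD k 0) ≤ B := by
  cases M with
  | nil => simpa [sz_int] using hB
  | cons r M =>
    rw [List.headD_cons, List.getD_eq_getElem?_getD]
    rcases lt_or_ge k r.length with hk | hk
    · rw [List.getElem?_eq_getElem hk]; exact (h.2 r (by simp)).2 _ (List.getElem_mem hk)
    · rw [List.getElem?_eq_none hk]; exact (by simpa [sz_int] using hB)

/-- An invariant of the Smith algorithm that bounds the lengths. -/
def SmithBd (B n c c' i : ℕ) (s : SmithState) : Prop :=
  MatBd B n (c + i) s.1.1 ∧ MatBd B n c' s.1.2.1 ∧ MatBd B n c' s.1.2.2 ∧ RowBd (3 * B) i s.2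

/-- All matrix entries are reduced modulo `e` after each operation, so they never outgrow `e`; the
list of relations gains only the row `rowComb`. -/
theorem SmithBd.step {B n c c' i : ℕ} {e : ℤ} (he : sz e ≤ B) {is : List ℕ}
    (hn : is.length ≤ n) {s : SmithState} (h : SmithBd B n c c' i s) (k : ℕ) :
    SmithBd B n c c' (i + 1) (smithStep e is s k) := by
  obtain ⟨h1, h2, h3, h4⟩ := h
  obtain ⟨g1, g2, g3⟩ : MatBd B n (c + (i + 1)) (gathered e is k s).1 ∧
      MatBd B n c' (gathered e is k s).2.1 ∧ MatBd B n c' (gathered e is k s).2.2 :=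
    foldl_gather_bd he hn k _ ⟨⟨by rw [List.length_cons]; have := h1.1; omega, fun r hr => by
      rcases List.mem_cons.1 hr with rfl | hr
      · exact rowBd_rowComb he hn _
      · exact h1.2 r hr⟩, h2, h3⟩
  obtain ⟨c1, c2⟩ := foldl_clear_bd (s := (gathered e is k s).2) he hn k
    (addMul e is [] (xgcd e (((gathered e is k s).1.headD []).getD k 0) e).2
      ((gathered e is k s).1.headD [])) (xgcd e (((gathered e is k s).1.headD []).getD k 0) e).1
    (is.filter fun j => decide (k < j)) ⟨g2, g3⟩
  refine ⟨MatBd.map g1.1 fun _ => rowBd_map_md he hn _, c1, c2, ?_, fun z hz => ?_⟩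
  · change (s.2 ++ [_]).length ≤ _
    rw [List.length_append]; exact Nat.add_le_add_right h4.1 1
  · change z ∈ s.2 ++ [_] at hz
    rcases List.mem_append.1 hz with hz | hz
    · exact h4.2 z hz
    · rw [List.mem_singleton.1 hz]
      -- The modulus and both arguments of this gcd have length at most `B`, hence `3 * B` in
      -- `SmithBd`.
      have h5 := sz_xgcd_fst_le e (((gathered e is k s).1.headD []).getD k 0) e
      have h6 := headD_getD_sz_le ((one_le_sz e).trans he) g1 k
      omega

@[fun_prop]
theorem PT.idMat {e : α → ℤ} {is : α → List ℕ} (he : PT e) (his : PT is) :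
    PT fun x => idMat (e x) (is x) := by
  unfold UnitAb.idMat; fun_prop

@[fun_prop]
theorem PT.smith {e : α → ℤ} {is : α → List ℕ} {M : α → List (List ℤ)} (he : PT e)
    (his : PT is) (hM : PT M) : PT fun x => smith (e x) (is x) (M x) := by
  have hr : PB fun x => 1 + sz (is x) * (1 + 3 * sz (e x)) :=
    (PB.const 1).add (his.pb_sz.mul ((PB.const 1).add ((PB.const 3).mul he.pb_sz)))
  have hm1 := he.pb_sz.mat his.pb_sz (hM.pb_sz.add his.pb_sz)
  have hm2 := he.pb_sz.mat his.pb_sz his.pb_sz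
  refine PT.foldl_of_inv (g := fun x s k => UnitAb.smithStep (e x) (is x) s k) his (by fun_prop)
    (by fun_prop) (fun x i s => SmithBd (sz (e x)) (is x).length (M x).length (is x).length i s)
    (fun x => ⟨MatBd.map le_rfl fun _ => rowBd_map_md le_rfl le_rfl _, ?_, ?_, by simp, by simp⟩)
    (fun x i s k h => h.step le_rfl le_rfl k) _
    ((((PB.const 3).add hm1).add hm2).add (hm2.add hr)) fun x s i hi h => ?_
  · exact ⟨by simp [UnitAb.idMat], fun r hr => by
      obtain ⟨i, -, rfl⟩ := List.mem_map.1 hr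
      exact rowBd_map_md le_rfl le_rfl _⟩
  · exact ⟨by simp [UnitAb.idMat], fun r hr => by
      obtain ⟨i, -, rfl⟩ := List.mem_map.1 hr
      exact rowBd_map_md le_rfl le_rfl _⟩
  · obtain ⟨h1, h2, h3, h4⟩ := h
    have hl := length_lt_sz (is x)
    have hl' := length_lt_sz (M x)
    have h1 := (h1.mono le_rfl hl.le (c' := sz (M x) + sz (is x)) (by omega)).sz_le
    have h2 := (h2.mono le_rfl hl.le hl.le).sz_le
    have h3 := (h3.mono le_rfl hl.le hl.le).sz_le
    have h4 := (h4.mono le_rfl (n' := sz (is x)) (by omega)).sz_le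
    change 1 + (1 + sz s.1.1 + (1 + sz s.1.2.1 + sz s.1.2.2)) + sz s.2 ≤ _
    omega

end PT

/-! ## A nonzero minor of the matrix of relations -/

/-- The entry of a matrix that is given by its rows. -/
def entry (C : List (List ℤ)) (i k : ℕ) : ℤ := (C.getD i []).getD k 0

/-- The product of the row `r` and the column `k` of `C`. -/
def rowCol (is : List ℕ) (C : List (List ℤ)) (r : List ℤ) (k : ℕ) : ℤ :=
  (is.map fun i => r.getD i 0 * entry C i k).sum

/-- Update the determinant and the adjugate of a matrix when its row `j` is replaced by `r`. -/
def exchange (is : List ℕ) (s : ℤ × List (List ℤ)) (j : ℕ) (r : List ℤ) : ℤ × List (List ℤ) :=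
  if rowCol is s.2 r j = 0 then s
  else (rowCol is s.2 r j, is.map fun i => is.map fun k =>
    if k = j then entry s.2 i k
    else (rowCol is s.2 r j * entry s.2 i k - entry s.2 i j * rowCol is s.2 r k) / s.1)

/-- Replace the row `j` by a row from the list `M` if this does not make the matrix singular. -/
def exchangeStep (is : List ℕ) (M : List (List ℤ)) (s : ℤ × List (List ℤ)) (j : ℕ) :
    ℤ × List (List ℤ) :=
  exchange is s j ((M.filter fun r => decide (¬ rowCol is s.2 r j = 0)).headD [])

/-- The indices `0, …, min n m - 1`, where `m` is the length of `M`. -/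
def indices {β : Type} (n : ℕ) (M : List β) : List ℕ :=
  (List.range M.length).filter fun i => decide (i < n)

/-- The determinant and the adjugate of a matrix that consists of rows from the list `M`. -/
def minor (n : ℕ) (M : List (List ℤ)) : ℤ × List (List ℤ) :=
  (indices n M).foldl (exchangeStep (indices n M) M)
    (1, (indices n M).map fun i => (indices n M).map fun j => if i = j then 1 else 0)

/-- The number `n` of generators is given in binary, so the range below `n` may be exponentially
long. The cut at the number of relators repairs this and loses nothing for finite groups, by
`Presentation.le_length_of_finite`. -/
theorem indices_eq {β : Type} (n : ℕ) (M : List β) :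
    indices n M = List.range (min n M.length) := by
  unfold indices
  induction M.length with
  | zero => simp
  | succ m ih =>
    rw [List.range_succ, List.filter_append, ih]
    rcases lt_or_ge m n with h | h
    · rw [show min n (m + 1) = min n m + 1 by omega, List.range_succ,
        show min n m = m by omega]
      simp [h]
    · rw [show min n (m + 1) = min n m by omega]
      simp [h]

/-- A row as a vector. -/
def toVec (N : ℕ) (r : List ℤ) : Fin N → ℤ := fun i => r.getD i 0

theorem getD_map_range {β : Type} (N : ℕ) (f : ℕ → β) (i : Fin N) (d : β) :
    ((List.range N).map f).getD i d = f i := by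
  rw [List.getD_eq_getElem?_getD]; simp

theorem sum_map_range (N : ℕ) (f : ℕ → ℤ) :
    ((List.range N).map f).sum = ∑ i : Fin N, f i :=
  (Fin.sum_univ_eq_sum_range f N).symm ▸ rfl

theorem map_range_eq_ofFn {β : Type} (N : ℕ) (f : ℕ → β) :
    (List.range N).map f = List.ofFn fun i : Fin N => f i := by
  apply List.ext_getElem <;> simp

/-- A matrix as a list of rows. -/
def rowsOf {N : ℕ} (A : Matrix (Fin N) (Fin N) ℤ) : List (List ℤ) :=
  List.ofFn fun i => List.ofFn fun k => A i k

theorem entry_rowsOf {N : ℕ} (A : Matrix (Fin N) (Fin N) ℤ) (i k : Fin N) :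
    entry (rowsOf A) i k = A i k := by
  simp [entry, rowsOf, List.getD_eq_getElem?_getD]

theorem rowCol_rowsOf {N : ℕ} (A : Matrix (Fin N) (Fin N) ℤ) (r : List ℤ) (k : Fin N) :
    rowCol (List.range N) (rowsOf A) r k = Matrix.vecMul (toVec N r) A k := by
  rw [rowCol, sum_map_range]
  simp only [entry_rowsOf, Matrix.vecMul, dotProduct, toVec]

open Matrix in
-- Cramer's rule: the determinant after an exchange can be read off before it, which is what
-- `rowCol` tests.
theorem det_updateRow_eq_vecMul_adjugate {N : ℕ} (B : Matrix (Fin N) (Fin N) ℤ) (j : Fin N)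
    (v : Fin N → ℤ) : (B.updateRow j v).det = (v ᵥ* B.adjugate) j := by
  rw [← cramer_transpose_apply, cramer_eq_adjugate_mulVec, ← adjugate_transpose,
    mulVec_transpose]

open Matrix in
-- Column `j` of the adjugate consists of cofactors that omit row `j`.
theorem adjugate_updateRow_self {N : ℕ} (B : Matrix (Fin N) (Fin N) ℤ) (j : Fin N)
    (v : Fin N → ℤ) (i : Fin N) : (B.updateRow j v).adjugate i j = B.adjugate i j := by
  rw [adjugate_apply, adjugate_apply, updateRow_idem]

open Matrix in
/-- The adjugate after the exchange of a row. -/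
theorem det_mul_adjugate_updateRow {N : ℕ} (B : Matrix (Fin N) (Fin N) ℤ) (j : Fin N)
    (v : Fin N → ℤ) (hv : (v ᵥ* B.adjugate) j ≠ 0) (i k : Fin N) (hk : k ≠ j) :
    B.det * (B.updateRow j v).adjugate i k =
      (v ᵥ* B.adjugate) j * B.adjugate i k - B.adjugate i j * (v ᵥ* B.adjugate) k := by
  set C := B.adjugate with hC
  set u := v ᵥ* C with hu
  -- `X` is a rank-one update of the adjugate (Sherman–Morrison without denominators) and will equal
  -- `B.det` times the new adjugate. The last summand corrects only column `j`, so it disappears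
  -- from the final formula.
  let X : Matrix (Fin N) (Fin N) ℤ := u j • C - vecMulVec (fun i => C i j) u +
    B.det • vecMulVec (fun i => C i j) (Pi.single j 1)
  have hBC : ∀ a b, (B * C) a b = B.det * (1 : Matrix (Fin N) (Fin N) ℤ) a b := fun a b => by
    rw [hC, mul_adjugate]; rfl
  have hBX : B.updateRow j v * X = (B.det * u j) • 1 := by
    ext a b
    have e : ∀ w : Fin N → ℤ, (w ᵥ* X) b =
        u j * (w ᵥ* C) b - (w ᵥ* C) j * u b + B.det * ((w ᵥ* C) j * (Pi.single j 1 : Fin N → ℤ) b) := by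
      intro w
      have hX : ∀ i, X i b =
          u j * C i b - C i j * u b + B.det * (C i j * (Pi.single j 1 : Fin N → ℤ) b) := fun i => by
        simp only [X, Matrix.add_apply, Matrix.sub_apply, Matrix.smul_apply, vecMulVec_apply,
          smul_eq_mul]
      change ∑ i, w i * X i b = u j * (∑ i, w i * C i b) - (∑ i, w i * C i j) * u b +
        B.det * ((∑ i, w i * C i j) * (Pi.single j 1 : Fin N → ℤ) b)
      simp only [hX, Finset.mul_sum, Finset.sum_mul, ← Finset.sum_sub_distrib,
        ← Finset.sum_add_distrib]
      exact Finset.sum_congr rfl fun _ _ => by ring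
    change ((B.updateRow j v) a ᵥ* X) b = _
    rw [e]
    rcases eq_or_ne a j with rfl | ha
    · rw [updateRow_self]
      change u a * u b - u a * u b + B.det * (u a * _) = _
      rw [Matrix.smul_apply, one_apply, Pi.single_apply]
      rcases eq_or_ne b a with rfl | hb
      · simp
      · simp [hb, hb.symm]
    · rw [updateRow_ne ha]
      have h1 := hBC a b
      have h2 := hBC a j
      rw [one_apply_ne ha] at h2
      change u j * (B * C) a b - (B * C) a j * u b + B.det * ((B * C) a j * _) = _
      rw [h1, h2, Matrix.smul_apply, smul_eq_mul]; ring
  have hdet : (B.updateRow j v).det = u j := det_updateRow_eq_vecMul_adjugate B j v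
  -- Multiplying `hBX` by the new adjugate turns its left factor into the new determinant `u j`,
  -- which is nonzero and can be cancelled.
  have h := congrArg (fun Y => (B.updateRow j v).adjugate * Y) hBX
  simp only [← Matrix.mul_assoc, adjugate_mul, hdet, Matrix.smul_mul, Matrix.one_mul,
    Matrix.mul_smul, Matrix.mul_one] at h
  have h' := congrFun (congrFun h i) k
  simp only [Matrix.smul_apply, smul_eq_mul] at h'
  have h3 : B.det * (B.updateRow j v).adjugate i k = X i k :=
    mul_left_cancel₀ hv (by rw [h']; ring)
  rw [h3]
  simp only [X, Matrix.add_apply, Matrix.sub_apply, Matrix.smul_apply, vecMulVec_apply,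
    smul_eq_mul, Pi.single_eq_of_ne hk, mul_zero, add_zero]

/-- `s` holds the determinant and the adjugate of the nonsingular matrix `B`, whose entries are
bounded by `x`. -/
structure MinorInv {N : ℕ} (x : ℤ) (s : ℤ × List (List ℤ)) (B : Matrix (Fin N) (Fin N) ℤ) :
    Prop where
  det : B.det = s.1
  ne : s.1 ≠ 0
  adj : s.2 = rowsOf B.adjugate
  bd : ∀ i k, |B i k| ≤ x

/-- The division in `exchange` is exact, because `det_mul_adjugate_updateRow` exhibits the numerator
as a multiple of the old determinant. -/
theorem MinorInv.exchange {N : ℕ} {x : ℤ} {s : ℤ × List (List ℤ)}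
    {B : Matrix (Fin N) (Fin N) ℤ} (h : MinorInv x s B) (j : Fin N) {r : List ℤ}
    (hr : ∀ i, |toVec N r i| ≤ x) (hj : rowCol (List.range N) s.2 r j ≠ 0) :
    MinorInv x (exchange (List.range N) s j r) (B.updateRow j (toVec N r)) := by
  have e : ∀ k : Fin N, rowCol (List.range N) s.2 r k =
      Matrix.vecMul (toVec N r) B.adjugate k := fun k => by rw [h.adj, rowCol_rowsOf]
  unfold UnitAb.exchange
  rw [if_neg hj]
  refine ⟨?_, hj, ?_, fun i k => ?_⟩
  · rw [det_updateRow_eq_vecMul_adjugate, ← e]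
  · simp only [map_range_eq_ofFn, rowsOf]
    refine congrArg List.ofFn (funext fun i => congrArg List.ofFn (funext fun k => ?_))
    rw [e, e, ← h.det, h.adj, entry_rowsOf, entry_rowsOf]
    split_ifs with hk
    · rw [Fin.ext hk, adjugate_updateRow_self]
    · rw [← det_mul_adjugate_updateRow B j _ (e j ▸ hj) i k
        (fun hh => hk (congrArg Fin.val hh)), Int.mul_ediv_cancel_left _ (h.det ▸ h.ne)]
  · rw [Matrix.updateRow_apply]
    split_ifs
    · exact hr k
    · exact h.bd i k

/-- Column `j` of the adjugate of a nonsingular matrix is nonzero. If the rows of `M` have full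
rank, one of them is not orthogonal to it, and this row can replace row `j`. Without full rank the
matrix may stay as it is; it remains nonsingular, which is all that the running time needs. -/
theorem MinorInv.step {N : ℕ} {x : ℤ} {s : ℤ × List (List ℤ)} {M : List (List ℤ)}
    (hM : ∀ r ∈ M, ∀ i, |toVec N r i| ≤ x) {B : Matrix (Fin N) (Fin N) ℤ} (h : MinorInv x s B)
    (j : Fin N) : ∃ B' : Matrix (Fin N) (Fin N) ℤ,
      MinorInv x (exchangeStep (List.range N) M s j) B' ∧ (∀ i, i ≠ j → B' i = B i) ∧
      ((∀ c : Fin N → ℤ, c ≠ 0 → ∃ r ∈ M, toVec N r ⬝ᵥ c ≠ 0) → ∃ r ∈ M, B' j = toVec N r) := by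
  unfold exchangeStep
  set l := M.filter fun r => decide (¬ rowCol (List.range N) s.2 r j = 0) with hl
  cases hc : l with
  | nil =>
    refine ⟨B, ?_, fun _ _ => rfl, fun hM' => ?_⟩
    -- If no row qualifies, the default row `[]` has product zero, and `exchange` then returns its
    -- argument.
    · have : rowCol (List.range N) s.2 [] j = 0 := by simp [rowCol]
      rw [List.headD_nil, UnitAb.exchange, if_pos this]; exact h
    · exfalso
      obtain ⟨r, hr, h1⟩ := hM' (fun i => B.adjugate i j) fun h0 => by
        have h2 : B * B.adjugate = B.det • (1 : Matrix (Fin N) (Fin N) ℤ) := B.mul_adjugate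
        have h3 := congrFun (congrFun h2 j) j
        rw [Matrix.mul_apply, Finset.sum_eq_zero fun i _ => by
          rw [show B.adjugate i j = 0 from congrFun h0 i, mul_zero]] at h3
        simp only [Matrix.smul_apply, Matrix.one_apply_eq, smul_eq_mul, mul_one] at h3
        exact h.ne (h.det ▸ h3.symm)
      have h2 : r ∈ l := List.mem_filter.2 ⟨hr, by
        rw [h.adj, rowCol_rowsOf]; exact decide_eq_true h1⟩
      rw [hc] at h2; simp at h2
  | cons r l' =>
    have h2 : r ∈ l := by rw [hc]; simp
    obtain ⟨hr, h3⟩ := List.mem_filter.1 h2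
    rw [List.headD_cons]
    refine ⟨_, h.exchange j (hM r hr) (by simpa using h3), fun i hi => Matrix.updateRow_ne hi,
      fun _ => ⟨r, hr, Matrix.updateRow_self⟩⟩

theorem minorInv_one (N : ℕ) {x : ℤ} (hx : 1 ≤ x) : MinorInv x
    (1, (List.range N).map fun i => (List.range N).map fun j => if i = j then (1 : ℤ) else 0)
    (1 : Matrix (Fin N) (Fin N) ℤ) := by
  refine ⟨Matrix.det_one, one_ne_zero, ?_, fun i k => ?_⟩
  · rw [Matrix.adjugate_one]
    simp only [map_range_eq_ofFn, rowsOf, Matrix.one_apply, Fin.ext_iff]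
  · rw [Matrix.one_apply]
    split_ifs <;> simp <;> omega

/-- Step `j` touches only row `j`, so rows exchanged earlier stay rows of `M`. Invariant and length
bound hold without the rank condition, on which only the second half depends. -/
theorem exists_minorInv_foldl {N : ℕ} {x : ℤ} (hx : 1 ≤ x) {M : List (List ℤ)}
    (hM : ∀ r ∈ M, ∀ i, |toVec N r i| ≤ x) (m : ℕ) (hm : m ≤ N) :
    ∃ B : Matrix (Fin N) (Fin N) ℤ, MinorInv x
      ((List.range m).foldl (exchangeStep (List.range N) M)
        (1, (List.range N).map fun i => (List.range N).map fun j => if i = j then 1 else 0)) B ∧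
      ((∀ c : Fin N → ℤ, c ≠ 0 → ∃ r ∈ M, toVec N r ⬝ᵥ c ≠ 0) →
        ∀ i : Fin N, i < m → ∃ r ∈ M, B i = toVec N r) := by
  induction m with
  | zero => exact ⟨1, minorInv_one N hx, fun _ i hi => absurd hi (Nat.not_lt_zero _)⟩
  | succ m ih =>
    obtain ⟨B, hB, h⟩ := ih (by omega)
    obtain ⟨B', hB', h1, h2⟩ := hB.step hM ⟨m, hm⟩
    rw [List.range_succ, List.foldl_append]
    refine ⟨B', hB', fun hc i hi => ?_⟩
    rcases eq_or_ne i ⟨m, hm⟩ with rfl | hne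
    · exact h2 hc
    · rw [h1 i hne]
      exact h hc i (by have : (i : ℕ) ≠ m := fun hh => hne (Fin.ext hh); omega)

/-- The Leibniz expansion has `N!` terms, and `N! ≤ N ^ N ≤ 2 ^ (N * N)`. -/
theorem abs_det_lt {N s : ℕ} {B : Matrix (Fin N) (Fin N) ℤ} (h : ∀ i k, |B i k| ≤ 2 ^ s) :
    B.det.natAbs < 2 ^ (N * N + s * N + 1) := by
  have h1 := Matrix.det_le (abv := AbsoluteValue.abs) (x := (2 : ℤ) ^ s) h
  rw [Fintype.card_fin, AbsoluteValue.abs_apply, nsmul_eq_mul, Int.abs_eq_natAbs, ← pow_mul] at h1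
  have h2 : B.det.natAbs ≤ N.factorial * 2 ^ (s * N) := by exact_mod_cast h1
  have h3 : N.factorial ≤ 2 ^ (N * N) := (Nat.factorial_le_pow N).trans (by
    rw [pow_mul]; exact Nat.pow_le_pow_left Nat.lt_two_pow_self.le N)
  calc B.det.natAbs ≤ 2 ^ (N * N) * 2 ^ (s * N) := h2.trans (Nat.mul_le_mul_right _ h3)
    _ = 2 ^ (N * N + s * N) := (pow_add _ _ _).symm
    _ < 2 ^ (N * N + s * N + 1) := Nat.pow_lt_pow_right (by norm_num) (by omega)

theorem MinorInv.sz_le {N s : ℕ} {t : ℤ × List (List ℤ)} {B : Matrix (Fin N) (Fin N) ℤ}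
    (h : MinorInv (2 ^ s) t B) : sz t ≤ 1 + (2 + (N * N + s * N)) +
      (1 + N * (1 + (1 + N * (1 + (2 + (N * N + s * N)))))) := by
  have key : ∀ {A : Matrix (Fin N) (Fin N) ℤ}, (∀ i k, |A i k| ≤ 2 ^ s) →
      sz A.det ≤ 2 + (N * N + s * N) := fun hA => by
    have := sz_int_le_of_lt (abs_det_lt hA); omega
  have h1 := key h.bd
  have h2 : MatBd (2 + (N * N + s * N)) N N t.2 := by
    rw [h.adj]
    refine ⟨by simp [rowsOf], fun r hr => ?_⟩
    obtain ⟨i, rfl⟩ := (List.mem_ofFn' _ _).1 hr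
    refine ⟨by simp, fun z hz => ?_⟩
    obtain ⟨k, rfl⟩ := (List.mem_ofFn' _ _).1 hz
    beta_reduce
    -- An adjugate entry is the determinant of the matrix with one row replaced by a unit vector, so
    -- the same bound applies.
    rw [Matrix.adjugate_apply]
    refine key fun a b => ?_
    rw [Matrix.updateRow_apply]
    split_ifs
    · rw [Pi.single_apply]; split_ifs <;> simp; exact one_le_pow₀ (by norm_num)
    · exact h.bd a b
  have h3 := h2.sz_le
  rw [sz_prod, ← h.det]; omega

theorem abs_toVec_le (N : ℕ) {M : List (List ℤ)} {r : List ℤ} (hr : r ∈ M) (i : Fin N) :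
    |toVec N r i| ≤ 2 ^ sz M := by
  have h : (toVec N r i).natAbs < 2 ^ sz M := by
    rw [toVec, List.getD_eq_getElem?_getD]
    rcases lt_or_ge (i : ℕ) r.length with hk | hk
    · rw [List.getElem?_eq_getElem hk]
      have h1 := natAbs_lt_two_pow_sz r[(i : ℕ)]
      have h2 := sz_le_of_mem (List.getElem_mem hk)
      have h3 := sz_le_of_mem hr
      exact h1.trans_le (Nat.pow_le_pow_right (by norm_num) (by omega))
    · rw [List.getElem?_eq_none hk]; simp
  rw [Int.abs_eq_natAbs]; exact_mod_cast h.le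

/-! ### Running time of the computation of the minor. -/

section PT

variable {α : Type} [Enc α]

@[fun_prop]
theorem PT.entry {C : α → List (List ℤ)} {i k : α → ℕ} (hC : PT C) (hi : PT i) (hk : PT k) :
    PT fun x => entry (C x) (i x) (k x) := by
  unfold UnitAb.entry; fun_prop

@[fun_prop]
theorem PT.rowCol {is : α → List ℕ} {C : α → List (List ℤ)} {r : α → List ℤ} {k : α → ℕ}
    (his : PT is) (hC : PT C) (hr : PT r) (hk : PT k) :
    PT fun x => rowCol (is x) (C x) (r x) (k x) := by
  unfold UnitAb.rowCol; fun_prop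

@[fun_prop]
theorem PT.exchange {is : α → List ℕ} {s : α → ℤ × List (List ℤ)} {r : α → List ℤ} {j : α → ℕ}
    (his : PT is) (hs : PT s) (hj : PT j) (hr : PT r) :
    PT fun x => exchange (is x) (s x) (j x) (r x) := by
  unfold UnitAb.exchange; fun_prop

@[fun_prop]
theorem PT.exchangeStep {is : α → List ℕ} {M : α → List (List ℤ)} {s : α → ℤ × List (List ℤ)}
    {j : α → ℕ} (his : PT is) (hM : PT M) (hs : PT s) (hj : PT j) :
    PT fun x => exchangeStep (is x) (M x) (s x) (j x) := by
  unfold UnitAb.exchangeStep; fun_prop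

@[fun_prop]
theorem PT.indices {β : Type} [Enc β] {n : α → ℕ} {M : α → List β} (hn : PT n) (hM : PT M) :
    PT fun x => indices (n x) (M x) := by
  have := PT.range_length hM
  unfold UnitAb.indices; fun_prop

@[fun_prop]
theorem PT.minor {n : α → ℕ} {M : α → List (List ℤ)} (hn : PT n) (hM : PT M) :
    PT fun x => minor (n x) (M x) := by
  unfold UnitAb.minor
  have hL := hM.pb_sz
  have hD : PB fun x => 2 + (sz (M x) * sz (M x) + sz (M x) * sz (M x)) :=
    (PB.const 2).add ((hL.mul hL).add (hL.mul hL))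
  refine PT.foldl (g := fun x s j => UnitAb.exchangeStep (UnitAb.indices (n x) (M x)) (M x) s j)
    (by fun_prop) (by fun_prop) (by fun_prop) _ (((PB.const 1).add hD).add (hD.mat hL hL))
    fun x i hi => ?_
  rw [indices_eq] at hi ⊢
  rw [List.length_range] at hi
  obtain ⟨B, hB, -⟩ := exists_minorInv_foldl (M := M x) (x := 2 ^ sz (M x))
    (N := min (n x) (M x).length) (one_le_pow₀ (by norm_num))
    (fun r hr => abs_toVec_le _ hr) i hi
  have hN : min (n x) (M x).length ≤ sz (M x) := by have := length_lt_sz (M x); omega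
  rw [List.take_range, min_eq_left hi]
  refine hB.sz_le.trans ?_
  gcongr

end PT

/-! ## Correctness of the arithmetic -/

theorem md_cast {E : ℕ} (hE : 0 < E) (z : ℤ) : ((md E z : ℤ) : ZMod E) = z := by
  rw [md, if_pos (by exact_mod_cast hE)]; simp

theorem dvd_md_iff {e d : ℤ} (he : 0 < e) (hd : d ∣ e) (z : ℤ) : d ∣ md e z ↔ d ∣ z := by
  rw [md, if_pos he]; exact (EuclideanDomain.dvd_mod_iff hd)

/-- The invariant of the extended Euclidean algorithm. -/
structure EuclidInv (m a : ℤ) (C : ℤ → Prop) (s : (ℤ × ℤ) × (ℤ × ℤ)) : Prop where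
  nonneg : 0 ≤ s.2.1
  -- Makes the final gcd nonnegative: if `a` is negative, then the second entry is positive at the
  -- start and takes its place after one step.
  pos : 0 ≤ s.1.1 ∨ 0 < s.2.1
  dvd : ∀ d, d ∣ s.1.1 ∧ d ∣ s.2.1 ↔ C d
  cof₁ : m ∣ s.1.1 - s.1.2 * a
  cof₂ : m ∣ s.2.1 - s.2.2 * a

theorem dvd_sub_md {m : ℤ} (hm : 0 < m) (z : ℤ) : m ∣ z - md m z := by
  rw [md, if_pos hm]; exact Int.dvd_self_sub_emod

/-- Either `r % q` or `q - r % q` is at most `q / 2`, so as many steps as `b` has binary digits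
suffice. Changing the sign of a remainder affects neither common divisors nor, after the same change
in the cofactor, the congruence. -/
theorem EuclidInv.step {m a : ℤ} (hm : 0 < m) {C : ℤ → Prop} {s : (ℤ × ℤ) × (ℤ × ℤ)}
    (h : EuclidInv m a C s) :
    EuclidInv m a C (euclidStep m s) ∧ 2 * (euclidStep m s).2.1 ≤ s.2.1 := by
  obtain ⟨⟨r, x⟩, q, y⟩ := s
  obtain ⟨h1, h2, h3, h4, h5⟩ := h
  dsimp only at *
  unfold euclidStep
  dsimp only
  split_ifs with h6 h7
  · exact ⟨⟨h1, h2, h3, h4, h5⟩, by dsimp only; omega⟩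
  all_goals
    have h8 := Int.emod_lt_of_pos r (lt_of_le_of_ne h1 (Ne.symm h6))
    have h9 := Int.emod_nonneg r h6
    have h10 := Int.emod_add_mul_ediv r q
    refine ⟨⟨by dsimp only; omega, Or.inl h1, fun d => ?_, h5, ?_⟩, by dsimp only; omega⟩
  · rw [← h3 d]; dsimp only
    constructor
    · rintro ⟨ha, hb⟩
      exact ⟨h10 ▸ hb.add (ha.mul_right _), ha⟩
    · rintro ⟨ha, hb⟩
      exact ⟨hb, by rw [← h10] at ha; exact (dvd_add_left (hb.mul_right _)).1 ha⟩
  · dsimp only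
    have e : r % q - md m (x - r / q * y) * a = (r - x * a) - (r / q) * (q - y * a) +
        (x - r / q * y - md m (x - r / q * y)) * a := by
      have : r % q = r - q * (r / q) := by linarith
      rw [this]; ring
    rw [e]
    exact (h4.sub (h5.mul_left _)).add ((dvd_sub_md hm _).mul_right _)
  · rw [← h3 d]; dsimp only
    constructor
    · rintro ⟨ha, hb⟩
      have hb' : d ∣ r % q := (dvd_sub_right ha).1 hb
      exact ⟨h10 ▸ hb'.add (ha.mul_right _), ha⟩
    · rintro ⟨ha, hb⟩
      exact ⟨hb, hb.sub (by rw [← h10] at ha; exact (dvd_add_left (hb.mul_right _)).1 ha)⟩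
  · dsimp only
    have e : q - r % q - md m ((r / q + 1) * y - x) * a = (r / q + 1) * (q - y * a) - (r - x * a) +
        ((r / q + 1) * y - x - md m ((r / q + 1) * y - x)) * a := by
      have : r % q = r - q * (r / q) := by linarith
      rw [this]; ring
    rw [e]
    exact ((h5.mul_left _).sub h4).add ((dvd_sub_md hm _).mul_right _)

theorem EuclidInv.foldl {m a : ℤ} (hm : 0 < m) {C : ℤ → Prop} (l : List ℤ)
    {s : (ℤ × ℤ) × (ℤ × ℤ)} (h : EuclidInv m a C s) (hs : s.2.1 < 2 ^ l.length) :
    EuclidInv m a C (l.foldl (fun s _ => euclidStep m s) s) ∧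
      (l.foldl (fun s _ => euclidStep m s) s).2.1 = 0 := by
  induction l generalizing s with
  | nil =>
    refine ⟨h, ?_⟩
    have := h.nonneg
    simp only [List.length_nil, pow_zero] at hs
    simp only [List.foldl_nil]; omega
  | cons b l ih =>
    obtain ⟨h1, h2⟩ := h.step hm
    refine ih h1 ?_
    rw [List.length_cons, pow_succ] at hs
    beta_reduce
    omega

/-- Only the cofactor of `a` is tracked, and it is `0` for the entry `|b|`; this is correct modulo
`m` because `m` divides `b`. -/
theorem xgcd_spec {m a b : ℤ} (hm : 0 < m) (hmb : m ∣ b) (hab : 0 ≤ a ∨ b ≠ 0) :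
    (xgcd m a b).1 = Int.gcd a b ∧ m ∣ (xgcd m a b).1 - (xgcd m a b).2 * a := by
  have h0 : EuclidInv m a (fun d => d ∣ a ∧ d ∣ b) ((a, 1), ((b.natAbs : ℤ), 0)) :=
    ⟨by simp, hab.imp_right fun h => by simpa using h, fun d => by simp,
      by simp, by simpa using hmb⟩
  obtain ⟨h, h1⟩ := h0.foldl hm (fuel b) (by
    rw [length_fuel]
    have h1 : b.natAbs < 2 ^ Nat.size b.natAbs := Nat.lt_size_self _
    dsimp only; exact_mod_cast h1)
  refine ⟨?_, h.cof₁⟩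
  have hd := h.dvd
  have hp := h.pos
  rw [h1] at hd hp
  change ((fuel b).foldl (fun s _ => euclidStep m s) ((a, 1), ((b.natAbs : ℤ), 0))).1.1 = _
  refine Int.dvd_antisymm (by simpa using hp) (by simp) ?_ ?_
  · have := (hd _).1 ⟨dvd_rfl, dvd_zero _⟩
    exact Int.dvd_coe_gcd this.1 this.2
  · exact ((hd _).2 ⟨Int.gcd_dvd_left .., Int.gcd_dvd_right ..⟩).1

theorem gcdZ_eq (a b : ℤ) : gcdZ a b = Int.gcd a b := by
  rw [gcdZ, (xgcd_spec one_pos (one_dvd _) (.inl (by simp))).1]; simp only [Int.gcd, Int.natAbs_natCast]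

theorem foldl_div_gcdZ_of_coprime {c x : ℤ} (h : Int.gcd c x = 1) (l : List ℤ) :
    l.foldl (fun c _ => c / gcdZ c x) c = c := by
  induction l with
  | nil => rfl
  | cons b l ih => rw [List.foldl_cons, gcdZ_eq, h]; simpa using ih

/-- Repeated division by the gcd with `x` leaves a divisor of `c` prime to `x`. A nontrivial
division at least halves `c`, which bounds the number of rounds; primes not dividing `x` are never
removed. -/
theorem foldl_div_gcdZ_spec (x : ℤ) (l : List ℤ) {c : ℤ} (hc : 0 < c) (hl : c < 2 ^ l.length) :
    Int.gcd (l.foldl (fun c _ => c / gcdZ c x) c) x = 1 ∧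
      ∀ p : ℤ, Prime p → ¬ p ∣ x → p ∣ c → p ∣ l.foldl (fun c _ => c / gcdZ c x) c := by
  induction l generalizing c with
  | nil => simp at hl; omega
  | cons b l ih =>
    rcases eq_or_ne (Int.gcd c x) 1 with h | h
    · rw [foldl_div_gcdZ_of_coprime h]; exact ⟨h, fun p _ _ h => h⟩
    · have hg : (0 : ℤ) < Int.gcd c x := by
        have := Int.gcd_pos_of_ne_zero_left x hc.ne'; exact_mod_cast this
      obtain ⟨k, hk⟩ := Int.gcd_dvd_left c x
      have hdiv : c / gcdZ c x = k := by
        rw [gcdZ_eq]; conv_lhs => rw [hk]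
        rw [← hk]; exact Int.ediv_eq_of_eq_mul_right hg.ne' hk
      have hk0 : 0 < k := pos_of_mul_pos_right (hk ▸ hc) hg.le
      have h2 : (2 : ℤ) ≤ Int.gcd c x := by omega
      rw [List.foldl_cons, hdiv]
      obtain ⟨i1, i2⟩ := ih hk0 (by rw [List.length_cons, pow_succ] at hl; nlinarith)
      refine ⟨i1, fun p hp hpx hpc => i2 p hp hpx ?_⟩
      rw [hk] at hpc
      exact (hp.dvd_or_dvd hpc).resolve_left fun h => hpx (h.trans (Int.gcd_dvd_right ..))

/-- The combination with the coefficient `stab e a b` has the common divisors with `e` of both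
vectors. -/
theorem dvd_of_dvd_add_stab {ι : Type} {e a b d : ℤ} (he : 0 < e) {w r : ι → ℤ}
    (ha : ∀ d, d ∣ a ↔ ∀ i, d ∣ w i) (hb : ∀ d, d ∣ b ↔ ∀ i, d ∣ r i) (hd : d ∣ e)
    (h : ∀ i, d ∣ w i + stab e a b * r i) : (∀ i, d ∣ w i) ∧ ∀ i, d ∣ r i := by
  rw [← ha, ← hb]
  rcases Nat.eq_zero_or_pos (Int.gcd a b) with h0 | h0
  · obtain ⟨rfl, rfl⟩ := Int.gcd_eq_zero_iff.1 h0
    exact ⟨dvd_zero _, dvd_zero _⟩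
  suffices hs : d ∣ (Int.gcd a b : ℤ) from
    ⟨hs.trans (Int.gcd_dvd_left ..), hs.trans (Int.gcd_dvd_right ..)⟩
  -- Write `a = k a'` and `b = k b'` with `a'`, `b'` coprime. Then `t = stab e a b` is prime to `a'`
  -- and divisible by every prime divisor of `e` that does not divide `a'`.
  obtain ⟨a', b', hab, ha', hb'⟩ := Int.exists_gcd_one h0
  set k : ℤ := (Int.gcd a b : ℤ) with hk
  have hk0 : k ≠ 0 := by rw [hk]; exact_mod_cast h0.ne'
  have hdiv : a / gcdZ a b = a' := by
    rw [gcdZ_eq, ← hk]; exact Int.ediv_eq_of_eq_mul_left hk0 ha'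
  obtain ⟨t1, t2⟩ := foldl_div_gcdZ_spec a' (fuel e) he (by
    rw [length_fuel]
    have h1 : e.natAbs < 2 ^ Nat.size e.natAbs := Nat.lt_size_self _
    have h2 : (e.natAbs : ℤ) < 2 ^ Nat.size e.natAbs := by exact_mod_cast h1
    rwa [Int.natAbs_of_nonneg he.le] at h2)
  have ht : stab e a b = (fuel e).foldl (fun c _ => c / gcdZ c a') e := by rw [stab, hdiv]
  rw [← ht] at t1 t2
  set t := stab e a b
  have hd0 : 0 < Int.gcd d k := Int.gcd_pos_of_ne_zero_right d hk0
  obtain ⟨D, k', hDk, hD, hk'⟩ := Int.exists_gcd_one hd0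
  -- With `D = d / gcd(d, k)`, the claim `d ∣ k` means that no prime `p` divides `D`. Such a `p`
  -- would divide `e` and all `x i + t * y i`, where `w = k x` and `r = k y`.
  have hu : D.natAbs = 1 := by
    by_contra hne
    obtain ⟨p, hp, hpD⟩ := Int.exists_prime_and_dvd hne
    have hpe : p ∣ e := (hpD.trans ⟨_, hD⟩).trans hd
    have g0 : (Int.gcd d k : ℤ) ≠ 0 := by exact_mod_cast hd0.ne'
    have hcop : ∀ x y : ℤ, Int.gcd x y = 1 → p ∣ x → p ∣ y → False := fun x y hxy hx hy => by
      have := Int.dvd_coe_gcd hx hy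
      rw [hxy] at this
      exact hp.not_isUnit (isUnit_of_dvd_one (by simpa using this))
    have cancel : ∀ z, d ∣ k * z → p ∣ z := fun z hz => by
      have h1 : (Int.gcd d k : ℤ) * D ∣ (Int.gcd d k : ℤ) * (k' * z) := by
        have e1 : (Int.gcd d k : ℤ) * D = d := by rw [mul_comm]; exact hD.symm
        have e2 : (Int.gcd d k : ℤ) * (k' * z) = k * z := by
          rw [← mul_assoc, mul_comm _ k', ← hk']
        rwa [e1, e2]
      have h2 := hpD.trans ((mul_dvd_mul_iff_left g0).1 h1)
      exact (hp.dvd_or_dvd h2).resolve_left (hcop D k' hDk hpD)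
    have hwk : ∀ i, k ∣ w i := (ha k).1 (Int.gcd_dvd_left ..)
    have hrk : ∀ i, k ∣ r i := (hb k).1 (Int.gcd_dvd_right ..)
    choose x hx using hwk
    choose y hy using hrk
    have hxa : ∀ i, a' ∣ x i := fun i => by
      have := (ha a).1 dvd_rfl i
      rw [hx i, ha', mul_comm a'] at this
      exact (mul_dvd_mul_iff_left hk0).1 this
    have key : ∀ i, p ∣ x i + t * y i := fun i => cancel _ (by
      have := h i
      rw [hx i, hy i] at this
      convert this using 1; ring)
    -- If `p ∣ a'`, then `p ∤ t` and `p` divides all `y i`, hence also `b'`. Otherwise `p ∣ t` and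
    -- `p` divides all `x i`, hence `a'`. Both are contradictions.
    by_cases hpa : p ∣ a'
    · have hpt : ¬ p ∣ t := fun hpt => hcop t a' t1 hpt hpa
      have hpy : ∀ i, p ∣ y i := fun i =>
        (hp.dvd_or_dvd ((dvd_add_right (hpa.trans (hxa i))).1 (key i))).resolve_left hpt
      have : k * p ∣ b := (hb _).2 fun i => by rw [hy i]; exact mul_dvd_mul_left k (hpy i)
      rw [hb', mul_comm b'] at this
      exact hcop a' b' hab hpa ((mul_dvd_mul_iff_left hk0).1 this)
    · have hpt : p ∣ t := t2 p hp hpa hpe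
      have hpx : ∀ i, p ∣ x i := fun i => (dvd_add_left (hpt.mul_right _)).1 (key i)
      have : k * p ∣ a := (ha _).2 fun i => by rw [hx i]; exact mul_dvd_mul_left k (hpx i)
      rw [ha', mul_comm a'] at this
      exact hpa ((mul_dvd_mul_iff_left hk0).1 this)
  rw [hD]
  have h1 : D ∣ 1 := by rw [← Int.natAbs_dvd, hu]; simp
  have h2 := mul_dvd_mul h1 (Int.gcd_dvd_right d k)
  rwa [one_mul] at h2

theorem dvd_foldl_gcdZ (d : ℤ) (r : List ℤ) (g : ℤ) :
    d ∣ r.foldl gcdZ g ↔ d ∣ g ∧ ∀ z ∈ r, d ∣ z := by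
  induction r generalizing g with
  | nil => simp
  | cons z r ih => rw [List.foldl_cons, ih, gcdZ_eq, Int.dvd_coe_gcd_iff]; simp [and_assoc]

theorem dvd_content_iff (d : ℤ) (r : List ℤ) : d ∣ content r ↔ ∀ z ∈ r, d ∣ z := by
  rw [content, dvd_foldl_gcdZ]; simp

/-! ## Correctness of the Smith algorithm -/

section Smith

variable {E N : ℕ}

/-- A row as a vector modulo `E`. -/
def vec (E N : ℕ) (r : List ℤ) : Fin N → ZMod E := fun i => ((r.getD i 0 : ℤ) : ZMod E)

/-- The column operation that adds `s` times the coordinate `j` to the coordinate `k`. -/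
def shear (k j : Fin N) (s : ZMod E) : (Fin N → ZMod E) →ₗ[ZMod E] Fin N → ZMod E :=
  LinearMap.id + (LinearMap.single (ZMod E) (fun _ => ZMod E) k) ∘ₗ (s • LinearMap.proj j)

theorem shear_apply (k j : Fin N) (s : ZMod E) (v : Fin N → ZMod E) :
    shear k j s v = v + Pi.single k (s * v j) := rfl

theorem shear_apply_same (k j : Fin N) (s : ZMod E) (v : Fin N → ZMod E) :
    shear k j s v k = v k + s * v j := by simp [shear_apply]

theorem shear_apply_ne {k j i : Fin N} (h : i ≠ k) (s : ZMod E) (v : Fin N → ZMod E) :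
    shear k j s v i = v i := by simp [shear_apply, h]

theorem shear_eq_self (k j : Fin N) (s : ZMod E) {v : Fin N → ZMod E} (h : v j = 0) :
    shear k j s v = v := by simp [shear_apply, h]

theorem shear_injective {k j : Fin N} (h : k ≠ j) (s : ZMod E) :
    Function.Injective (shear k j s) := by
  refine Function.LeftInverse.injective (g := shear k j (-s)) fun v => ?_
  rw [shear_apply k j (-s), shear_apply_ne h.symm, shear_apply, add_assoc, ← Pi.single_add]
  simp

/-- The two shears are inverse transposes of each other; applied to the rows of `U` and of `V`, they
preserve duality. -/
theorem shear_dotProduct_shear {k j : Fin N} (h : k ≠ j) (s : ZMod E) (u v : Fin N → ZMod E) :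
    shear k j s u ⬝ᵥ shear j k (-s) v = u ⬝ᵥ v := by
  simp only [shear_apply, add_dotProduct, dotProduct_add, single_dotProduct, dotProduct_single,
    Pi.add_apply, Pi.single_eq_of_ne h.symm]
  ring

/-- Lifts from `ZMod E` differ by multiples of `E`, hence of `d`. -/
theorem dvd_cast_iff {d : ℤ} (hd : d ∣ E) (z : ℤ) : (d : ZMod E) ∣ (z : ZMod E) ↔ d ∣ z := by
  refine ⟨fun ⟨c, hc⟩ => ?_, fun ⟨c, hc⟩ => ⟨c, by rw [hc]; push_cast; rfl⟩⟩
  obtain ⟨c, rfl⟩ := ZMod.intCast_surjective c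
  rw [← Int.cast_mul, ZMod.intCast_eq_intCast_iff_dvd_sub] at hc
  have h := hd.trans hc
  exact (dvd_sub_right (dvd_mul_right d c)).1 h

theorem cast_eq_zero_iff (z : ℤ) : (z : ZMod E) = 0 ↔ (E : ℤ) ∣ z :=
  ZMod.intCast_zmod_eq_zero_iff_dvd z E

theorem getD_addMul (e : ℤ) (w : List ℤ) (t : ℤ) (r : List ℤ) (i : Fin N) :
    (addMul e (List.range N) w t r).getD i 0 = md e (w.getD i 0 + t * r.getD i 0) :=
  getD_map_range _ _ _ _

theorem getD_colAdd (e : ℤ) (k j : ℕ) (s : ℤ) (r : List ℤ) (i : Fin N) :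
    (colAdd e (List.range N) k j s r).getD i 0 =
      md e (r.getD i 0 + if (i : ℕ) = k then s * r.getD j 0 else 0) :=
  getD_map_range _ _ _ _

theorem length_addMul (e : ℤ) (w : List ℤ) (t : ℤ) (r : List ℤ) :
    (addMul e (List.range N) w t r).length = N := by simp [addMul]

theorem vec_addMul (hE : 0 < E) (w : List ℤ) (t : ℤ) (r : List ℤ) :
    vec E N (addMul E (List.range N) w t r) = vec E N w + (t : ZMod E) • vec E N r := by
  ext i
  simp only [vec, getD_addMul, md_cast hE, Pi.add_apply, Pi.smul_apply, smul_eq_mul]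
  push_cast; rfl

theorem vec_colAdd (hE : 0 < E) (k j : Fin N) (s : ℤ) (r : List ℤ) :
    vec E N (colAdd E (List.range N) k j s r) = shear k j s (vec E N r) := by
  ext i
  simp only [vec, getD_colAdd, md_cast hE, shear_apply, Pi.add_apply, Pi.single_apply, Fin.ext_iff]
  split_ifs <;> push_cast <;> rfl

theorem vec_nil : vec E N [] = 0 := by ext i; simp [vec]

theorem mem_dvd_iff {d : ℤ} {r : List ℤ} (hr : r.length ≤ N) :
    (∀ z ∈ r, d ∣ z) ↔ ∀ i : Fin N, d ∣ r.getD i 0 := by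
  refine ⟨fun h i => ?_, fun h z hz => ?_⟩
  · rw [List.getD_eq_getElem?_getD]
    rcases lt_or_ge (i : ℕ) r.length with hk | hk
    · rw [List.getElem?_eq_getElem hk]; exact h _ (List.getElem_mem hk)
    · rw [List.getElem?_eq_none hk]; exact dvd_zero _
  · obtain ⟨i, hi, rfl⟩ := List.mem_iff_getElem.1 hz
    have := h ⟨i, hi.trans_le hr⟩
    simpa [List.getD_eq_getElem?_getD, hi] using this

/-- All entries of the rows are divisible by `d`. -/
def DvdRows (N : ℕ) (d : ℤ) (M : List (List ℤ)) : Prop := ∀ r ∈ M, ∀ i : Fin N, d ∣ r.getD i 0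

/-- The set of the rows as vectors modulo `E`. -/
def rowSet (E N : ℕ) (M : List (List ℤ)) : Set (Fin N → ZMod E) := {v | ∃ r ∈ M, v = vec E N r}

theorem mem_rowSet {M : List (List ℤ)} {r : List ℤ} (h : r ∈ M) : vec E N r ∈ rowSet E N M :=
  ⟨r, h, rfl⟩

theorem rowSet_map {M : List (List ℤ)} {f : List ℤ → List ℤ}
    {F : (Fin N → ZMod E) → Fin N → ZMod E} (h : ∀ r, vec E N (f r) = F (vec E N r)) :
    rowSet E N (M.map f) = F '' rowSet E N M := by
  ext v
  constructor
  · rintro ⟨q, hq, rfl⟩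
    obtain ⟨r, hr, rfl⟩ := List.mem_map.1 hq
    exact ⟨_, mem_rowSet hr, (h r).symm⟩
  · rintro ⟨_, ⟨r, hr, rfl⟩, rfl⟩
    exact ⟨f r, List.mem_map_of_mem hr, (h r).symm⟩

/-- By `dvd_of_dvd_add_stab`, adding a row in this way yields a combination whose common divisors
with `E` divide the new row as well as all earlier ones. -/
theorem rowComb_spec (hE : 0 < E) (M : List (List ℤ)) (hM : ∀ r ∈ M, r.length ≤ N) :
    vec E N (rowComb E (List.range N) M) ∈ Submodule.span (ZMod E) (rowSet E N M) ∧
      (∀ d : ℤ, d ∣ E → (∀ i : Fin N, d ∣ (rowComb E (List.range N) M).getD i 0) →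
        DvdRows N d M) := by
  -- `P` collects the rows that the combination `w` has already absorbed, `M'` those that are still
  -- to come.
  have key : ∀ (M' P : List (List ℤ)) (w : List ℤ), w.length = N → (∀ r ∈ M', r.length ≤ N) →
      (vec E N w ∈ Submodule.span (ZMod E) (rowSet E N P)) →
      (∀ d : ℤ, d ∣ E → (∀ i : Fin N, d ∣ w.getD i 0) → DvdRows N d P) →
      (vec E N (M'.foldl (fun w r => addMul E (List.range N) w
        (stab E (content w) (content r)) r) w) ∈ Submodule.span (ZMod E) (rowSet E N (P ++ M'))) ∧
      (∀ d : ℤ, d ∣ E → (∀ i : Fin N, d ∣ (M'.foldl (fun w r => addMul E (List.range N) w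
        (stab E (content w) (content r)) r) w).getD i 0) → DvdRows N d (P ++ M')) := by
    intro M'
    induction M' with
    | nil => intro P w _ _ h1 h2; simpa using ⟨h1, h2⟩
    | cons r M' ih =>
      intro P w hw hM' h1 h2
      have hP : P ++ r :: M' = (P ++ [r]) ++ M' := by simp
      rw [List.foldl_cons, hP]
      refine ih (P ++ [r]) _ (length_addMul _ _ _ _) (fun r hr => hM' r (by simp [hr])) ?_ ?_
      · rw [vec_addMul hE]
        refine add_mem (Submodule.span_mono ?_ h1) (Submodule.smul_mem _ _
          (Submodule.subset_span (mem_rowSet (by simp))))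
        rintro v ⟨q, hq, rfl⟩
        exact mem_rowSet (by simp [hq])
      · intro d hd h
        have hr : r.length ≤ N := hM' r (by simp)
        have h3 := dvd_of_dvd_add_stab (e := E) (d := d) (a := content w) (b := content r)
          (w := fun i : Fin N => w.getD i 0) (r := fun i : Fin N => r.getD i 0)
          (by exact_mod_cast hE) (fun d => by rw [dvd_content_iff, mem_dvd_iff hw.le])
          (fun d => by rw [dvd_content_iff, mem_dvd_iff hr]) hd fun i => by
            have := h i
            rwa [getD_addMul, dvd_md_iff (by exact_mod_cast hE) hd] at this
        intro q hq
        rcases List.mem_append.1 hq with hq | hq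
        · exact h2 d hd h3.1 q hq
        · rw [List.mem_singleton.1 hq]; exact h3.2
  have := key M [] ((List.range N).map fun _ => 0) (by simp) hM (by
    have : vec E N ((List.range N).map fun _ => 0) = 0 := by
      ext i; rw [vec, getD_map_range]; simp
    rw [this]; exact zero_mem _) (by intro d _ _ r hr; simp at hr)
  simpa [rowComb] using this

/-- `U` and the transpose `V` of its inverse describe a change of coordinates that maps the
submodule `L` to `S`. -/
structure Frame (L : Submodule (ZMod E) (Fin N → ZMod E)) (U V : List (List ℤ))
    (S : Submodule (ZMod E) (Fin N → ZMod E)) : Prop where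
  length_left : U.length = N
  length_right : V.length = N
  dual : ∀ i j : Fin N, vec E N (U.getD i []) ⬝ᵥ vec E N (V.getD j []) = if i = j then 1 else 0
  mem : ∀ x : Fin N → ZMod E, x ∈ L ↔ ∑ i : Fin N, x i • vec E N (U.getD i []) ∈ S

theorem getD_map_of_lt {β γ : Type} (f : β → γ) (l : List β) {i : ℕ} (h : i < l.length)
    (c : γ) (d : β) :
    (l.map f).getD i c = f (l.getD i d) := by
  simp [List.getD_eq_getElem?_getD, h]

theorem Frame.colAdd {L S : Submodule (ZMod E) (Fin N → ZMod E)} {U V : List (List ℤ)}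
    (h : Frame L U V S) (hE : 0 < E) {k j : Fin N} (hkj : k ≠ j) (s : ℤ) :
    Frame L (U.map (colAdd E (List.range N) k j s)) (V.map (colAdd E (List.range N) j k (-s)))
      (S.map (shear k j (s : ZMod E))) := by
  have hU : ∀ i : Fin N, vec E N ((U.map (UnitAb.colAdd E (List.range N) k j s)).getD i []) =
      shear k j (s : ZMod E) (vec E N (U.getD i [])) := fun i => by
    rw [getD_map_of_lt _ _ (by rw [h.length_left]; exact i.2) _ [], vec_colAdd hE]
  have hV : ∀ i : Fin N, vec E N ((V.map (UnitAb.colAdd E (List.range N) j k (-s))).getD i []) =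
      shear j k (-(s : ZMod E)) (vec E N (V.getD i [])) := fun i => by
    rw [getD_map_of_lt _ _ (by rw [h.length_right]; exact i.2) _ [], vec_colAdd hE]
    push_cast; rfl
  refine ⟨by simp [h.length_left], by simp [h.length_right], fun a b => ?_, fun x => ?_⟩
  · rw [hU, hV, shear_dotProduct_shear hkj, h.dual]
  · simp only [hU]
    refine (h.mem x).trans
      (((shear_injective hkj (s : ZMod E)).mem_set_image (s := (S : Set _))).symm.trans ?_)
    rw [map_sum]
    simp only [map_smul]
    exact Iff.rfl

/-- The vectors `dᵢ eᵢ` for the first `k` coordinates. -/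
def diagSet (E N k : ℕ) (ds : List ℤ) : Set (Fin N → ZMod E) :=
  {v | ∃ i : Fin N, (i : ℕ) < k ∧ v = Pi.single i ((ds.getD i 0 : ℤ) : ZMod E)}

/-- The finished vectors vanish at the coordinate `b` and are therefore fixed. -/
theorem shear_image_diagSet {k : ℕ} (ds : List ℤ) {a b : Fin N} (hb : k ≤ b) (s : ZMod E) :
    shear a b s '' diagSet E N k ds = diagSet E N k ds := by
  have h : ∀ v ∈ diagSet E N k ds, shear a b s v = v := by
    rintro v ⟨i, hi, rfl⟩
    refine shear_eq_self _ _ _ (Pi.single_eq_of_ne ?_ _)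
    rintro rfl; omega
  rw [Set.image_congr h, Set.image_id']

/-- The invariant of the first half of a step. -/
structure GatherInv (L : Submodule (ZMod E) (Fin N → ZMod E)) (k : Fin N) (ds : List ℤ)
    (js : List ℕ) (d₀ : ℤ → Prop) (s : List (List ℤ) × List (List ℤ) × List (List ℤ)) : Prop where
  frame : Frame L s.2.1 s.2.2 (Submodule.span (ZMod E) (diagSet E N k ds ∪ rowSet E N s.1))
  zero : ∀ r ∈ s.1, ∀ i : Fin N, i < k → vec E N r i = 0
  ne_nil : s.1 ≠ []
  -- A divisor of `E` that divides the pivot and the pending entries `js` of the first row divides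
  -- everything. When `js` is exhausted, the pivot alone controls all entries.
  dvd : ∀ d : ℤ, d ∣ E → d ∣ (s.1.headD []).getD k 0 →
    (∀ j ∈ js, d ∣ (s.1.headD []).getD j 0) → DvdRows N d s.1
  old : ∀ d : ℤ, d₀ d → d ∣ E ∧ DvdRows N d s.1

theorem DvdRows.colAdd (hE : 0 < E) {d : ℤ} (hd : d ∣ E) {M : List (List ℤ)}
    (h : DvdRows N d M) (k j : Fin N) (s : ℤ) :
    DvdRows N d (M.map (colAdd E (List.range N) k j s)) := by
  intro q hq i
  obtain ⟨r, hr, rfl⟩ := List.mem_map.1 hq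
  rw [getD_colAdd, dvd_md_iff (by exact_mod_cast hE) hd]
  refine dvd_add (h r hr i) ?_
  split_ifs
  · exact (h r hr j).mul_left _
  · exact dvd_zero _

/-- The scalar case of `dvd_of_dvd_add_stab`: the new pivot has as common divisors with `E` those of
the old pivot and the entry `j`, so `j` is no longer pending. -/
theorem GatherInv.step {L : Submodule (ZMod E) (Fin N → ZMod E)} {k : Fin N} {ds : List ℤ}
    {j : Fin N} {js : List ℕ} {d₀ : ℤ → Prop}
    {s : List (List ℤ) × List (List ℤ) × List (List ℤ)} (hE : 0 < E) (hkj : k < j)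
    (hjs : ∀ i ∈ js, i < N ∧ k < i)
    (h : GatherInv L k ds (j :: js) d₀ s) :
    GatherInv L k ds js d₀ (gather E (List.range N) k s j) := by
  obtain ⟨R, U, V⟩ := s
  obtain ⟨h1, h2, h3, h4, h5⟩ := h
  dsimp only at *
  obtain ⟨w, R', rfl⟩ := List.exists_cons_of_ne_nil h3
  have hE' : (0 : ℤ) < E := by exact_mod_cast hE
  refine ⟨?_, ?_, by simp [gather], ?_, fun d hd => ?_⟩
  · have h := h1.colAdd hE hkj.ne (stab E (w.getD k 0) (w.getD j 0))
    rw [Submodule.map_span, Set.image_union, shear_image_diagSet ds (Fin.le_def.1 hkj.le),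
      ← rowSet_map (vec_colAdd hE k j _)] at h
    exact h
  · intro q hq i hi
    obtain ⟨r, hr, rfl⟩ := List.mem_map.1 hq
    rw [vec_colAdd hE, shear_apply_ne hi.ne]
    exact h2 r hr i hi
  · intro d hd hk hj
    simp only [gather, List.map_cons, List.headD_cons] at hk hj ⊢
    rw [getD_colAdd, dvd_md_iff hE' hd, if_pos rfl] at hk
    have h6 := dvd_of_dvd_add_stab (ι := Unit) (e := E) (d := d) (a := w.getD k 0)
      (b := w.getD j 0) (w := fun _ => w.getD k 0) (r := fun _ => w.getD j 0) hE'
      (fun d => by simp) (fun d => by simp) hd (fun _ => hk)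
    refine (h4 d hd (h6.1 ()) fun i hi => ?_).colAdd hE hd k j _
    rcases List.mem_cons.1 hi with rfl | hi
    · exact h6.2 ()
    · have h7 := hj i hi
      have h8 := getD_colAdd (N := N) E k j (stab E (w.getD k 0) (w.getD j 0)) w
        ⟨i, (hjs i hi).1⟩
      dsimp only at h8
      rw [h8, dvd_md_iff hE' hd, if_neg (hjs i hi).2.ne', add_zero] at h7
      exact h7
  · exact ⟨(h5 d hd).1, (h5 d hd).2.colAdd hE (h5 d hd).1 k j _⟩

theorem GatherInv.foldl {L : Submodule (ZMod E) (Fin N → ZMod E)} {k : Fin N} {ds : List ℤ}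
    {d₀ : ℤ → Prop} (hE : 0 < E) (js : List ℕ) (hjs : ∀ i ∈ js, i < N ∧ k < i)
    {s : List (List ℤ) × List (List ℤ) × List (List ℤ)}
    (h : GatherInv L k ds js d₀ s) :
    GatherInv L k ds [] d₀ (js.foldl (gather E (List.range N) k) s) := by
  induction js generalizing s with
  | nil => exact h
  | cons j js ih =>
    exact ih (fun i hi => hjs i (by simp [hi])) (h.step (j := ⟨j, (hjs j (by simp)).1⟩) hE
      (hjs j (by simp)).2 fun i hi => hjs i (by simp [hi]))

/-- The invariant of the clearing of the pivot row. -/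
structure ClearInv (L : Submodule (ZMod E) (Fin N → ZMod E)) (k : Fin N) (T : Set (Fin N → ZMod E))
    (w : List ℤ) (g : ℤ) (js : List ℕ) (v : Fin N → ZMod E)
    (s : List (List ℤ) × List (List ℤ)) : Prop where
  frame : Frame L s.1 s.2 (Submodule.span (ZMod E) (insert v T))
  pivot : v k = g
  todo : ∀ i : Fin N, (i : ℕ) ∈ js → v i = vec E N w i
  done : ∀ i : Fin N, (i : ℕ) ∉ js → i ≠ k → v i = 0

/-- The vectors in `T` vanish at the pivot coordinate, so the shears fix them and only the pivot row
`v` changes. This is why `clear` acts on `U` and `V` alone. Each shear changes only one coordinate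
of `v`, so the quotients can be read from the original row `w`. -/
theorem ClearInv.foldl {L : Submodule (ZMod E) (Fin N → ZMod E)} {k : Fin N}
    {T : Set (Fin N → ZMod E)} {w : List ℤ} {g : ℤ} (hE : 0 < E) (hT : ∀ t ∈ T, t k = 0)
    (hg : ∀ i : Fin N, g ∣ w.getD i 0) (js : List ℕ) (hn : js.Nodup)
    (hjs : ∀ i ∈ js, i < N ∧ k < i) {s : List (List ℤ) × List (List ℤ)} {v : Fin N → ZMod E}
    (h : ClearInv L k T w g js v s) :
    Frame L (js.foldl (clear E (List.range N) k w g) s).1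
      (js.foldl (clear E (List.range N) k w g) s).2
      (Submodule.span (ZMod E) (insert (Pi.single k (g : ZMod E)) T)) := by
  induction js generalizing s v with
  | nil =>
    have : v = Pi.single k (g : ZMod E) := by
      ext i
      rcases eq_or_ne i k with rfl | hi
      · rw [Pi.single_eq_same]; exact h.pivot
      · rw [Pi.single_eq_of_ne hi]; exact h.done i (by simp) hi
    rw [← this]
    exact h.frame
  | cons j js ih =>
    obtain ⟨hj, hkj⟩ := hjs j (by simp)
    have hne : (⟨j, hj⟩ : Fin N) ≠ k := fun hh => hkj.ne (congrArg Fin.val hh).symm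
    obtain ⟨hjn, hn⟩ := List.nodup_cons.1 hn
    refine ih hn (fun i hi => hjs i (by simp [hi]))
      (v := shear ⟨j, hj⟩ k ((-(w.getD j 0 / g) : ℤ) : ZMod E) v) ⟨?_, ?_, ?_, ?_⟩
    · have h1 := h.frame.colAdd hE hne (-(w.getD j 0 / g))
      have h2 : shear ⟨j, hj⟩ k ((-(w.getD j 0 / g) : ℤ) : ZMod E) '' T = T := by
        rw [Set.image_congr fun t ht => shear_eq_self _ _ _ (hT t ht), Set.image_id']
      rw [Submodule.map_span, Set.image_insert_eq, h2, neg_neg] at h1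
      exact h1
    · rw [shear_apply_ne hne.symm]; exact h.pivot
    · intro i hi
      rw [shear_apply_ne (by rintro rfl; exact hjn hi)]
      exact h.todo i (by simp [hi])
    · intro i hi hik
      rcases eq_or_ne i ⟨j, hj⟩ with rfl | hij
      · rw [shear_apply_same, h.pivot, h.todo _ (by simp), vec, ← Int.cast_mul, ← Int.cast_add]
        have := Int.ediv_mul_cancel (hg ⟨j, hj⟩)
        dsimp only at this ⊢
        rw [neg_mul, this]; simp
      · rw [shear_apply_ne hij]
        exact h.done i (by
          rw [List.mem_cons, not_or]
          exact ⟨fun hh => hij (Fin.ext hh), hi⟩) hik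

/-- The invariant of the Smith algorithm. -/
structure SmithInv (L : Submodule (ZMod E) (Fin N → ZMod E)) (k : ℕ) (s : SmithState) : Prop where
  frame : Frame L s.1.2.1 s.1.2.2
    (Submodule.span (ZMod E) (diagSet E N k s.2 ∪ rowSet E N s.1.1))
  zero : ∀ r ∈ s.1.1, ∀ i : Fin N, (i : ℕ) < k → vec E N r i = 0
  length : s.2.length = k
  row_length : ∀ r ∈ s.1.1, r.length ≤ N
  pos : ∀ d ∈ s.2, 0 < d
  dvd : ∀ d ∈ s.2, d ∣ E ∧ DvdRows N d s.1.1
  chain : s.2.Pairwise (· ∣ ·)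

theorem filter_lt_range {k : ℕ} : ∀ i ∈ (List.range N).filter (fun j => decide (k < j)),
    i < N ∧ k < i := fun i hi => by simpa using hi

theorem SmithInv.gathered {L : Submodule (ZMod E) (Fin N → ZMod E)} {k : Fin N}
    {s : SmithState} (hE : 0 < E) (h : SmithInv L k s) :
    GatherInv L k s.2 [] (fun d => d ∈ s.2) (gathered E (List.range N) k s) := by
  obtain ⟨hw, hdvd⟩ := rowComb_spec hE s.1.1 h.row_length
  have hw0 : ∀ i : Fin N, i < k → vec E N (rowComb E (List.range N) s.1.1) i = 0 := by
    intro i hi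
    have : Submodule.span (ZMod E) (rowSet E N s.1.1) ≤
        LinearMap.ker (LinearMap.proj (R := ZMod E) (φ := fun _ : Fin N => ZMod E) i) := by
      rw [Submodule.span_le]
      rintro v ⟨r, hr, rfl⟩
      exact h.zero r hr i hi
    exact this hw
  refine GatherInv.foldl hE _ filter_lt_range ⟨?_, ?_, by simp, ?_, fun d hd => ?_⟩
  · have e : Submodule.span (ZMod E) (diagSet E N k s.2 ∪
        rowSet E N (rowComb E (List.range N) s.1.1 :: s.1.1)) =
        Submodule.span (ZMod E) (diagSet E N k s.2 ∪ rowSet E N s.1.1) := by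
      have e' : rowSet E N (rowComb E (List.range N) s.1.1 :: s.1.1) =
          insert (vec E N (rowComb E (List.range N) s.1.1)) (rowSet E N s.1.1) := by
        ext v; simp [rowSet]
      rw [e', Set.union_insert]
      exact Submodule.span_insert_eq_span (Submodule.span_mono Set.subset_union_right hw)
    exact e.symm ▸ h.frame
  · intro r hr i hi
    rcases List.mem_cons.1 hr with rfl | hr
    · exact hw0 i hi
    · exact h.zero r hr i hi
  · intro d hd hk hj
    -- Entries before the pivot vanish modulo `E`, a multiple of `d`; those after it are pending.
    have hall : ∀ i : Fin N, d ∣ (rowComb E (List.range N) s.1.1).getD i 0 := fun i => by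
      rcases lt_trichotomy i k with hi | rfl | hi
      · exact hd.trans ((cast_eq_zero_iff _).1 (hw0 i hi))
      · exact hk
      · exact hj i (by simpa using hi)
    intro r hr
    rcases List.mem_cons.1 hr with rfl | hr
    · exact hall
    · exact hdvd d hd hall r hr
  · refine ⟨(h.dvd d hd).1, fun r hr => ?_⟩
    rcases List.mem_cons.1 hr with rfl | hr
    · intro i
      -- All rows are `d` times a vector modulo `E`, hence so is their combination.
      have : vec E N (rowComb E (List.range N) s.1.1) ∈
          LinearMap.range (LinearMap.lsmul (ZMod E) (Fin N → ZMod E) (d : ZMod E)) := by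
        refine (Submodule.span_le.2 ?_) hw
        rintro v ⟨r, hr, rfl⟩
        choose c hc using fun i => (h.dvd d hd).2 r hr i
        refine ⟨fun i => c i, ?_⟩
        ext i
        change (d : ZMod E) * (c i : ZMod E) = ((r.getD i 0 : ℤ) : ZMod E)
        rw [hc]; push_cast; rfl
      obtain ⟨c, hc⟩ := this
      rw [← dvd_cast_iff (h.dvd d hd).1]
      exact ⟨c i, (congrFun hc i).symm⟩
    · exact (h.dvd d hd).2 r hr

/-- The pivot `p` of the first row `w` is replaced by `g = gcd(p, E)`, which divides all entries:
`w₁ = u w` with `u p ≡ g` modulo `E` has pivot `g`. Subtracting multiples of `w₁` clears the pivot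
column, and column operations then clear the rest of `w₁`, leaving `g` as the next invariant. -/
theorem SmithInv.step {L : Submodule (ZMod E) (Fin N → ZMod E)} {k : Fin N}
    {s : SmithState} (hE : 0 < E) (h : SmithInv L k s) :
    SmithInv L (k + 1) (smithStep E (List.range N) s k) := by
  have hE' : (0 : ℤ) < E := by exact_mod_cast hE
  obtain ⟨g1, g2, g3, g4, g5⟩ := h.gathered hE
  unfold smithStep
  set t := UnitAb.gathered E (List.range N) k s
  obtain ⟨w, R', ht⟩ := List.exists_cons_of_ne_nil g3
  obtain ⟨x1, x2⟩ := xgcd_spec (a := (t.1.headD []).getD k 0) hE' dvd_rfl (.inr hE'.ne')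
  set gu := xgcd E ((t.1.headD []).getD k 0) E
  set w₁ := addMul E (List.range N) [] gu.2 (t.1.headD []) with hw₁
  have hh : t.1.headD [] = w := by rw [ht]; rfl
  have hw : w ∈ t.1 := by rw [ht]; simp
  rw [hh] at x1 x2 hw₁ g4
  have hgE : gu.1 ∣ E := by rw [x1]; exact Int.gcd_dvd_right ..
  have hgpos : 0 < gu.1 := by
    rw [x1]; exact_mod_cast Int.gcd_pos_of_ne_zero_right _ hE'.ne'
  have hgR : DvdRows N gu.1 t.1 :=
    g4 gu.1 hgE (by rw [x1]; exact Int.gcd_dvd_left ..) (by simp)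
  have hgw : ∀ i : Fin N, gu.1 ∣ w₁.getD i 0 := fun i => by
    rw [hw₁, getD_addMul, dvd_md_iff hE' hgE]
    exact dvd_add (by simp) ((hgR w hw i).mul_left _)
  have hv₁ : vec E N w₁ = (gu.2 : ZMod E) • vec E N w := by
    rw [hw₁, vec_addMul hE, vec_nil, zero_add]
  have hpiv : vec E N w₁ k = gu.1 := by
    have := (cast_eq_zero_iff (E := E) _).2 x2
    push_cast at this
    rw [hv₁, sub_eq_zero.1 this]; rfl
  have hzero : ∀ i : Fin N, i < k → vec E N w₁ i = 0 := fun i hi => by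
    rw [hv₁, Pi.smul_apply, g2 w hw i hi, smul_zero]
  have hred : ∀ r, vec E N (addMul E (List.range N) r (-(r.getD k 0 / gu.1)) w₁) =
      vec E N r - ((r.getD k 0 / gu.1 : ℤ) : ZMod E) • vec E N w₁ := fun r => by
    rw [vec_addMul hE]; push_cast; rw [neg_smul, sub_eq_add_neg]
  have hredk : ∀ r ∈ t.1, vec E N (addMul E (List.range N) r (-(r.getD k 0 / gu.1)) w₁) k = 0 :=
    fun r hr => by
      rw [hred, Pi.sub_apply, Pi.smul_apply, hpiv, smul_eq_mul, ← Int.cast_mul,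
        Int.ediv_mul_cancel (hgR r hr k)]
      exact sub_self _
  set R := t.1.map fun r => addMul E (List.range N) r (-(r.getD k 0 / gu.1)) w₁ with hR
  -- The cofactor `u` need not be a unit modulo `E`, so `w₁` alone could span less than `w`. Nothing
  -- is lost because `w` stays in the list and is reduced like the other rows.
  have hspan : Submodule.span (ZMod E) (diagSet E N k s.2 ∪ rowSet E N t.1) =
      Submodule.span (ZMod E) (insert (vec E N w₁) (diagSet E N k s.2 ∪ rowSet E N R)) := by
    apply le_antisymm <;> rw [Submodule.span_le]
    · rintro v (hv | ⟨r, hr, rfl⟩)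
      · exact Submodule.subset_span (.inr (.inl hv))
      · have h1 : vec E N r = vec E N (addMul E (List.range N) r (-(r.getD k 0 / gu.1)) w₁) +
            ((r.getD k 0 / gu.1 : ℤ) : ZMod E) • vec E N w₁ := by rw [hred]; simp
        rw [h1]
        exact add_mem (Submodule.subset_span (.inr (.inr (mem_rowSet (List.mem_map_of_mem hr)))))
          (Submodule.smul_mem _ _ (Submodule.subset_span (.inl rfl)))
    · have hm : vec E N w₁ ∈ Submodule.span (ZMod E) (diagSet E N k s.2 ∪ rowSet E N t.1) := by
        rw [hv₁]
        exact Submodule.smul_mem _ _ (Submodule.subset_span (.inr (mem_rowSet hw)))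
      rintro v (rfl | hv | ⟨q, hq, rfl⟩)
      · exact hm
      · exact Submodule.subset_span (.inl hv)
      · obtain ⟨r, hr, rfl⟩ := List.mem_map.1 hq
        rw [hred]
        exact sub_mem (Submodule.subset_span (.inr (mem_rowSet hr))) (Submodule.smul_mem _ _ hm)
  have hframe := ClearInv.foldl (L := L) (k := k) (T := diagSet E N k s.2 ∪ rowSet E N R)
    (w := w₁) (g := gu.1) (s := t.2) (v := vec E N w₁) hE (by
      rintro v (⟨i, hi, rfl⟩ | ⟨q, hq, rfl⟩)
      · exact Pi.single_eq_of_ne (by rintro rfl; omega) _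
      · obtain ⟨r, hr, rfl⟩ := List.mem_map.1 hq
        exact hredk r hr) hgw ((List.range N).filter fun j => decide ((k : ℕ) < j))
    (List.nodup_range.filter _) filter_lt_range
    ⟨hspan ▸ g1, hpiv, fun _ _ => rfl, fun i hi hik => hzero i (by
      have : ¬ (k : ℕ) < i := fun hh => hi (by simpa using hh)
      rw [Fin.lt_def]
      have : (i : ℕ) ≠ k := fun hh => hik (Fin.ext hh)
      omega)⟩
  have hdiag : insert (Pi.single k (gu.1 : ZMod E)) (diagSet E N k s.2 ∪ rowSet E N R) =
      diagSet E N (k + 1) (s.2 ++ [gu.1]) ∪ rowSet E N R := by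
    rw [← Set.insert_union]
    congr 1
    ext v
    have hlt : ∀ i : Fin N, (i : ℕ) < k → (s.2 ++ [gu.1]).getD i 0 = s.2.getD i 0 :=
      fun i hi => List.getD_append _ _ _ _ (by rw [h.length]; exact hi)
    have heq : (s.2 ++ [gu.1]).getD k 0 = gu.1 := by
      rw [List.getD_append_right _ _ _ _ h.length.le, h.length]; simp
    constructor
    · rintro (rfl | ⟨i, hi, rfl⟩)
      · exact ⟨k, by omega, by rw [heq]⟩
      · exact ⟨i, by omega, by rw [hlt i hi]⟩
    · rintro ⟨i, hi, rfl⟩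
      rcases Nat.lt_succ_iff_lt_or_eq.1 hi with hi | hi
      · exact .inr ⟨i, hi, by rw [hlt i hi]⟩
      · rw [Fin.ext hi, heq]; exact .inl rfl
  have hdvdR : ∀ d : ℤ, d ∣ E → DvdRows N d t.1 → DvdRows N d R := by
    intro d hd hdt q hq i
    obtain ⟨r, hr, rfl⟩ := List.mem_map.1 hq
    rw [getD_addMul, dvd_md_iff hE' hd]
    refine dvd_add (hdt r hr i) (Dvd.dvd.mul_left ?_ _)
    rw [hw₁, getD_addMul, dvd_md_iff hE' hd]
    exact dvd_add (by simp) ((hdt w hw i).mul_left _)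
  refine ⟨?_, ?_, ?_, ?_, ?_, ?_, ?_⟩
  · exact hdiag ▸ hframe
  · intro q hq i hi
    obtain ⟨r, hr, rfl⟩ := List.mem_map.1 hq
    rcases Nat.lt_succ_iff_lt_or_eq.1 hi with hi | hi
    · rw [hred, Pi.sub_apply, Pi.smul_apply, hzero i hi, g2 r hr i hi]; simp
    · rw [Fin.ext hi]; exact hredk r hr
  · change (s.2 ++ [gu.1]).length = _
    rw [List.length_append, h.length]; rfl
  · intro q hq
    obtain ⟨r, hr, rfl⟩ := List.mem_map.1 hq
    rw [length_addMul]
  · intro d hd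
    rcases List.mem_append.1 hd with hd | hd
    · exact h.pos d hd
    · rwa [List.mem_singleton.1 hd]
  · intro d hd
    rcases List.mem_append.1 hd with hd | hd
    · exact ⟨(g5 d hd).1, hdvdR d (g5 d hd).1 (g5 d hd).2⟩
    · rw [List.mem_singleton.1 hd]; exact ⟨hgE, hdvdR _ hgE hgR⟩
  -- Earlier invariants divide `E` and all remaining entries, in particular the pivot, hence the
  -- gcd.
  · refine List.pairwise_append.2 ⟨h.chain, by simp, fun d hd c hc => ?_⟩
    rw [List.mem_singleton.1 hc, x1]
    exact Int.dvd_coe_gcd ((g5 d hd).2 w hw k) (g5 d hd).1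

theorem vec_idMat (hE : 0 < E) (i : Fin N) :
    vec E N ((idMat E (List.range N)).getD i []) = Pi.single i 1 := by
  rw [idMat, getD_map_range]
  ext j
  rw [vec, getD_map_range, md_cast hE, Pi.single_apply]
  simp only [Fin.ext_iff, eq_comm (a := (i : ℕ))]
  split_ifs <;> simp

theorem smithInv_init (hE : 0 < E) (M : List (List ℤ)) :
    SmithInv (Submodule.span (ZMod E) (rowSet E N M)) 0
      ((M.map fun r => addMul E (List.range N) [] 1 r, idMat E (List.range N),
        idMat E (List.range N)), []) := by
  have hrow : rowSet E N (M.map fun r => addMul E (List.range N) [] 1 r) = rowSet E N M := by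
    rw [rowSet_map (F := fun v => v) fun r => by
      rw [vec_addMul hE, vec_nil, zero_add, Int.cast_one, one_smul], Set.image_id']
  refine ⟨⟨by simp [idMat], by simp [idMat], fun i j => ?_, fun x => ?_⟩, fun _ _ i hi =>
    absurd hi (Nat.not_lt_zero _), rfl, fun r hr => ?_, by simp, by simp, by simp⟩
  · rw [vec_idMat hE, vec_idMat hE, single_dotProduct, Pi.single_apply, one_mul]
  · have h1 : diagSet E N 0 [] = ∅ := by
      ext v
      simp only [diagSet, Set.mem_ofPred_eq, Set.mem_empty_iff_false, iff_false]
      rintro ⟨i, hi, -⟩; omega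
    rw [h1, Set.empty_union, hrow]
    simp only [vec_idMat hE]
    rw [← pi_eq_sum_univ']
  · obtain ⟨q, -, rfl⟩ := List.mem_map.1 hr
    rw [length_addMul]

theorem smithInv_foldl (hE : 0 < E) (M : List (List ℤ)) (m : ℕ) (hm : m ≤ N) :
    SmithInv (Submodule.span (ZMod E) (rowSet E N M)) m
      ((List.range m).foldl (smithStep E (List.range N))
        ((M.map fun r => addMul E (List.range N) [] 1 r, idMat E (List.range N),
          idMat E (List.range N)), [])) := by
  induction m with
  | zero => exact smithInv_init hE M
  | succ m ih =>
    rw [List.range_succ, List.foldl_append]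
    exact SmithInv.step (k := ⟨m, hm⟩) hE (ih (by omega))

theorem mem_span_diagSet (ds : List ℤ) (v : Fin N → ZMod E) :
    v ∈ Submodule.span (ZMod E) (diagSet E N N ds) ↔
      ∀ i : Fin N, ((ds.getD i 0 : ℤ) : ZMod E) ∣ v i := by
  constructor
  · intro hv i
    induction hv using Submodule.span_induction with
    | mem v hv =>
      obtain ⟨j, -, rfl⟩ := hv
      rw [Pi.single_apply]
      split_ifs with hij
      · rw [hij]
      · exact dvd_zero _
    | zero => exact dvd_zero _
    | add v w _ _ h1 h2 => exact dvd_add h1 h2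
    | smul c v _ h => exact h.mul_left c
  · intro h
    choose c hc using h
    have : v = ∑ i : Fin N, c i • (Pi.single i ((ds.getD i 0 : ℤ) : ZMod E)) := by
      ext j
      rw [Finset.sum_apply, Finset.sum_eq_single j (fun i _ hij => by simp [hij.symm]) (by simp)]
      rw [Pi.smul_apply, Pi.single_eq_same, hc, smul_eq_mul, mul_comm]
    rw [this]
    exact sum_mem fun i _ => Submodule.smul_mem _ _ (Submodule.subset_span ⟨i, i.2, rfl⟩)

/-- Correctness of the Smith algorithm. -/
theorem smith_spec (hE : 0 < E) (M : List (List ℤ)) :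
    (smith E (List.range N) M).2.length = N ∧
    (∀ d ∈ (smith E (List.range N) M).2, 0 < d ∧ d ∣ E) ∧
    (smith E (List.range N) M).2.Pairwise (· ∣ ·) ∧
    (∀ x : Fin N → ℤ, (fun i => (x i : ZMod E)) ∈ Submodule.span (ZMod E) (rowSet E N M) ↔
      ∀ j : Fin N, (smith E (List.range N) M).2.getD j 0 ∣
        ∑ i : Fin N, x i * entry (smith E (List.range N) M).1.2.1 i j) ∧
    ∀ i j : Fin N, ((∑ k : Fin N, entry (smith E (List.range N) M).1.2.2 k i *
      entry (smith E (List.range N) M).1.2.1 k j : ℤ) : ZMod E) = if i = j then 1 else 0 := by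
  have h := smithInv_foldl hE M N le_rfl
  change SmithInv _ N (smith E (List.range N) M) at h
  set s := smith E (List.range N) M
  refine ⟨h.length, fun d hd => ⟨h.pos d hd, (h.dvd d hd).1⟩, h.chain, fun x => ?_, fun i j => ?_⟩
  -- After `N` steps all coordinates of the remaining rows vanish modulo `E`.
  · have hz : Submodule.span (ZMod E) (diagSet E N N s.2 ∪ rowSet E N s.1.1) =
        Submodule.span (ZMod E) (diagSet E N N s.2) := by
      refine le_antisymm (Submodule.span_le.2 ?_) (Submodule.span_mono Set.subset_union_left)
      rintro v (hv | ⟨r, hr, rfl⟩)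
      · exact Submodule.subset_span hv
      · rw [show vec E N r = 0 from funext fun i => h.zero r hr i i.2]
        exact zero_mem _
    rw [h.frame.mem, hz, mem_span_diagSet]
    refine forall_congr' fun j => ?_
    have hj : s.2.getD j 0 ∈ s.2 := by
      rw [List.getD_eq_getElem?_getD, List.getElem?_eq_getElem (by rw [h.length]; exact j.2)]
      exact List.getElem_mem _
    rw [← dvd_cast_iff (h.dvd _ hj).1, Finset.sum_apply]
    simp only [Pi.smul_apply, smul_eq_mul, vec, entry]
    push_cast; rfl
  · let U : Matrix (Fin N) (Fin N) (ZMod E) := fun i => vec E N (s.1.2.1.getD i [])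
    let V : Matrix (Fin N) (Fin N) (ZMod E) := fun i => vec E N (s.1.2.2.getD i [])
    have h1 : U * V.transpose = 1 := by
      ext a b
      rw [Matrix.one_apply]
      exact h.frame.dual a b
    -- The frame pairs rows of `U` with rows of `V`; preimages need the product in the other order.
    have h3 : V.transpose * U = 1 := mul_eq_one_comm.1 h1
    have h2 := congrFun (congrFun h3 i) j
    rw [Matrix.one_apply] at h2
    rw [← h2]
    push_cast
    rfl

end Smith

/-! ## Abelianized presentations -/

/-- The vector of the exponent sums of a word, whose letters are given by their numbers. -/
def expVec (is : List ℕ) (w : List (ℕ × ℤ)) : List ℤ :=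
  is.map fun i => ((w.filter fun l => decide (l.1 = i)).map fun l => l.2).sum

/-- The matrix of relations of an abelianized presentation. -/
def relMat (n : ℕ) (T : List (List (ℕ × ℤ))) : List (List ℤ) :=
  T.map fun w => expVec (indices n T) w

/-- A multiple of the exponent of an abelianized presentation, if this is finite. -/
def modulus (n : ℕ) (T : List (List (ℕ × ℤ))) : ℕ := (minor n (relMat n T)).1.natAbs

/-- The Smith form of an abelianized presentation. -/
def smithOf (n : ℕ) (T : List (List (ℕ × ℤ))) : SmithState :=
  smith (modulus n T) (indices n T) (relMat n T)

/-- The image of a word in the group given by the Smith form. -/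
def image (p : List (ℕ × ℤ) × (List ℕ × List (List ℤ) × List ℤ)) : List ℤ :=
  p.2.1.map fun j =>
    (p.2.1.map fun i => (expVec p.2.1 p.1).getD i 0 * entry p.2.2.1 i j).sum % p.2.2.2.getD j 0

/-- A word with the given image. -/
def preimage (p : List ℤ × (List ℕ × List (List ℤ))) : List (ℕ × ℤ) :=
  p.2.1.map fun i => (i, (p.2.1.map fun j => p.1.getD j 0 * entry p.2.2 i j).sum)

/-- The data of the abelianization from an effective presentation; the programs are assembled
from the given programs and the programs `P` and `Q` for `image` and `preimage`. -/
def answer (P Q : Prog) (x : (ℕ × List (List (ℕ × ℤ))) × (Data × Data)) :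
    List ℤ × ((ℤ × (Data × (ℤ × ((ℤ × (Data × (ℤ × (List ℕ × List (List ℤ) × List ℤ)))) × Data)))) ×
      (ℤ × ((ℤ × ((ℤ × (Data × (ℤ × (List ℕ × List (List ℤ))))) × Data)) × Data))) :=
  ((smithOf x.1.1 x.1.2).2,
    -- The numbers 4, 5 and 1 are the codes of `seq`, `fork` and `const` in `Prog.encode`. Both
    -- components are thus encoded programs, `a` followed by `P` and `Q` followed by `b`, with the
    -- Smith data built in as constants.
    ((4, (x.2.1, (4, ((5, ((Prog.op .id).encode, (1, (indices x.1.1 x.1.2,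
      (smithOf x.1.1 x.1.2).1.2.1, (smithOf x.1.1 x.1.2).2)))), P.encode)))),
    (4, ((4, ((5, ((Prog.op .id).encode, (1, (indices x.1.1 x.1.2,
      (smithOf x.1.1 x.1.2).1.2.2)))), Q.encode)), x.2.2))))

/-! ### Running time of the computations with presentations. -/

section PT

variable {α : Type} [Enc α]

@[fun_prop]
theorem PT.expVec {is : α → List ℕ} {w : α → List (ℕ × ℤ)} (his : PT is) (hw : PT w) :
    PT fun x => expVec (is x) (w x) := by
  unfold UnitAb.expVec; fun_prop

@[fun_prop]
theorem PT.relMat {n : α → ℕ} {T : α → List (List (ℕ × ℤ))} (hn : PT n) (hT : PT T) :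
    PT fun x => relMat (n x) (T x) := by
  unfold UnitAb.relMat; fun_prop

@[fun_prop]
theorem PT.smithOf {n : α → ℕ} {T : α → List (List (ℕ × ℤ))} (hn : PT n) (hT : PT T) :
    PT fun x => smithOf (n x) (T x) := by
  unfold UnitAb.smithOf modulus; fun_prop

theorem PT.image : PT image := by
  unfold UnitAb.image; fun_prop

theorem PT.preimage : PT preimage := by
  unfold UnitAb.preimage; fun_prop

theorem PT.answer (P Q : Prog) : PT (answer P Q) := by
  unfold UnitAb.answer; fun_prop

end PT

/-- The exponent sums of a word. -/
def Word.expo {n : ℕ} (w : Word n) (i : Fin n) : ℤ :=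
  ((w.filter fun l => decide (l.1 = i)).map fun l => l.2).sum

/-- In a commutative group only the exponent sums of a word matter. -/
theorem map_toFree {n : ℕ} {H : Type*} [CommGroup H] (χ : FreeGroup (Fin n) →* H) (w : Word n) :
    χ w.toFree = ∏ i, χ (FreeGroup.of i) ^ w.expo i := by
  induction w with
  | nil => simp [Word.toFree, Word.expo]
  | cons l w ih =>
    have h : Word.toFree (l :: w) = FreeGroup.of l.1 ^ l.2 * Word.toFree w := by
      simp [Word.toFree]
    have h2 : ∀ i, Word.expo (l :: w) i = (if l.1 = i then l.2 else 0) + Word.expo w i := fun i => by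
      by_cases hi : l.1 = i <;> simp [Word.expo, hi]
    rw [h, map_mul, map_zpow, ih]
    simp only [h2, zpow_add, Finset.prod_mul_distrib]
    congr 1
    rw [Finset.prod_eq_single l.1 (fun i _ hi => by simp [hi.symm]) (by simp)]
    simp

/-! ### The lattice of relations and its rank. -/

namespace Presentation

variable (P : Presentation)

/-- The lattice of relations of the abelianized presentation. -/
def lattice : AddSubgroup (Fin P.n → ℤ) :=
  AddSubgroup.closure {v | ∃ w ∈ P.relators, v = w.expo}

theorem map_eval {H : Type*} [CommGroup H] (χ : P.Grp →* H) (w : Word P.n) :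
    χ (P.eval w) = ∏ i, χ (PresentedGroup.of i) ^ w.expo i :=
  map_toFree (χ.comp (PresentedGroup.mk _)) w

theorem eval_relator {w : Word P.n} (hw : w ∈ P.relators) : P.eval w = 1 :=
  PresentedGroup.one_of_mem ⟨w, hw, rfl⟩

theorem map_eval_eq_one {H : Type*} [CommGroup H] (χ : P.Grp →* H) {w : Word P.n}
    (hw : w.expo ∈ P.lattice) : χ (P.eval w) = 1 := by
  rw [map_eval]
  suffices ∀ x ∈ P.lattice, ∏ i, χ (PresentedGroup.of i) ^ x i = 1 from this _ hw
  intro x hx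
  induction hx using AddSubgroup.closure_induction with
  | mem x hx =>
    obtain ⟨w, hw, rfl⟩ := hx
    rw [← map_eval, P.eval_relator hw, map_one]
  | zero => simp
  | add x y _ _ h1 h2 => simp only [Pi.add_apply, zpow_add, Finset.prod_mul_distrib, h1, h2, one_mul]
  | neg x _ h => simp only [Pi.neg_apply, zpow_neg, Finset.prod_inv_distrib, h, inv_one]

/-- The homomorphism from a presented group to a commutative group given by images of the
generators. -/
theorem exists_hom {H : Type*} [CommGroup H] (h : Fin P.n → H)
    (hr : ∀ w ∈ P.relators, ∏ i, h i ^ w.expo i = 1) :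
    ∃ χ : P.Grp →* H, ∀ w, χ (P.eval w) = ∏ i, h i ^ w.expo i := by
  have hrel : ∀ r ∈ {r : FreeGroup (Fin P.n) | ∃ w ∈ P.relators, r = w.toFree},
      FreeGroup.lift h r = 1 := by
    rintro _ ⟨w, hw, rfl⟩
    rw [map_toFree]; simpa using hr w hw
  refine ⟨PresentedGroup.toGroup hrel, fun w => ?_⟩
  rw [map_eval]; simp

/-- A vector orthogonal to all relators defines a homomorphism to `ℤ`, and a finite group has only
the trivial one. -/
theorem eq_zero_of_finite [Finite P.Grp] {c : Fin P.n → ℤ}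
    (hc : ∀ w ∈ P.relators, w.expo ⬝ᵥ c = 0) : c = 0 := by
  have hp : ∀ x : Fin P.n → ℤ, ∏ i, Multiplicative.ofAdd (c i) ^ x i =
      Multiplicative.ofAdd (x ⬝ᵥ c) := fun x => by
    simp only [← ofAdd_zsmul, ← ofAdd_sum, smul_eq_mul]; rfl
  obtain ⟨χ, hχ⟩ := P.exists_hom (fun i => Multiplicative.ofAdd (c i)) fun w hw => by
    rw [hp, hc w hw]; rfl
  ext i
  have h1 := hχ [(i, 1)]
  rw [hp] at h1
  have h2 : Word.expo [(i, (1 : ℤ))] = Pi.single i 1 := by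
    ext j
    rw [Pi.single_apply]
    by_cases hj : i = j
    · simp [Word.expo, hj]
    · simp [Word.expo, hj, Ne.symm hj]
  rw [h2, single_one_dotProduct] at h1
  obtain ⟨k, hk, hk1⟩ := isOfFinOrder_iff_pow_eq_one.1 (isOfFinOrder_of_finite (P.eval [(i, 1)]))
  have h3 := congrArg χ hk1
  rw [map_pow, h1, map_one, ← ofAdd_nsmul] at h3
  have h4 : k • c i = 0 := h3
  simpa [hk.ne'] using h4

/-- By `eq_zero_of_finite`, pairing with the relators is an injection of `ℤⁿ` into `ℤᵐ`, where `m`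
is the number of relators. -/
theorem le_length_of_finite [Finite P.Grp] : P.n ≤ P.relators.length := by
  let F : (Fin P.n → ℤ) →ₗ[ℤ] (Fin P.relators.length → ℤ) :=
    LinearMap.pi fun k => Fintype.linearCombination ℤ (P.relators.get k).expo
  have hF : ∀ c k, F c k = (P.relators.get k).expo ⬝ᵥ c := fun c k => by
    simp [F, Fintype.linearCombination_apply, dotProduct, mul_comm]
  have hinj : Function.Injective F := (injective_iff_map_eq_zero F).2 fun c hc =>
    P.eq_zero_of_finite fun w hw => by
      obtain ⟨k, rfl⟩ := List.get_of_mem hw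
      rw [← hF, hc]; rfl
  exact card_le_of_injective ℤ F hinj |> fun h => by simpa using h

/-- The relators with letters given by their numbers. -/
def relatorData : List (List (ℕ × ℤ)) :=
  P.relators.map fun w => w.map fun l => ((l.1 : ℕ), l.2)

theorem encode_eq : P.encode = enc (P.n, P.relatorData) := by
  rw [enc_pair, encode]
  congr 1
  change Data.ofList _ = Data.ofList _
  congr 1
  rw [relatorData, List.map_map]
  refine List.map_congr_left fun w _ => ?_
  change Data.ofList _ = Data.ofList _
  rw [List.map_map]; rfl

theorem indices_eq_range [Finite P.Grp] : indices P.n P.relatorData = List.range P.n := by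
  rw [indices_eq, relatorData, List.length_map, min_eq_left P.le_length_of_finite]

end Presentation

theorem getD_expVec {n : ℕ} (w : Word n) (i : Fin n) :
    (expVec (List.range n) (w.map fun l => ((l.1 : ℕ), l.2))).getD i 0 = w.expo i := by
  rw [expVec, getD_map_range, List.filter_map, List.map_map, Word.expo]
  congr 2
  refine List.filter_congr fun l _ => ?_
  simp [Fin.ext_iff]

namespace Presentation

variable (P : Presentation) [Finite P.Grp]

theorem relMat_eq : relMat P.n P.relatorData =
    P.relators.map fun w => expVec (List.range P.n) (w.map fun l => ((l.1 : ℕ), l.2)) := by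
  rw [relMat, P.indices_eq_range, relatorData, List.map_map]; rfl

theorem exists_toVec_eq {r : List ℤ} (hr : r ∈ relMat P.n P.relatorData) :
    ∃ w ∈ P.relators, toVec P.n r = w.expo := by
  rw [relMat_eq] at hr
  obtain ⟨w, hw, rfl⟩ := List.mem_map.1 hr
  exact ⟨w, hw, funext fun i => getD_expVec w i⟩

/-- Full rank makes every row exchange succeed, so all rows of `B` are relators, and `det B • z = (z
adj B) B` is a combination of them. -/
theorem modulus_spec : 0 < modulus P.n P.relatorData ∧
    ∀ z : Fin P.n → ℤ, (modulus P.n P.relatorData : ℤ) • z ∈ P.lattice := by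
  obtain ⟨B, hB, h⟩ := exists_minorInv_foldl (N := P.n) (x := 2 ^ sz (relMat P.n P.relatorData))
    (one_le_pow₀ (by norm_num)) (fun r hr i => abs_toVec_le P.n hr i) P.n le_rfl
  have hi : indices P.n (relMat P.n P.relatorData) = List.range P.n := by
    rw [indices_eq, relMat, List.length_map, relatorData, List.length_map,
      min_eq_left P.le_length_of_finite]
  have hm : minor P.n (relMat P.n P.relatorData) =
      (List.range P.n).foldl (exchangeStep (List.range P.n) (relMat P.n P.relatorData))
        (1, (List.range P.n).map fun i => (List.range P.n).map fun j => if i = j then 1 else 0) := by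
    rw [minor, hi]
  rw [← hm] at hB
  have hrow : ∀ i, B i ∈ P.lattice := fun i => by
    obtain ⟨r, hr, hBr⟩ := h (fun c hc => by
      by_contra! hcon
      refine hc (P.eq_zero_of_finite fun w hw => ?_)
      have hmem : expVec (List.range P.n) (w.map fun l => ((l.1 : ℕ), l.2)) ∈
          relMat P.n P.relatorData := by
        rw [relMat_eq]; exact List.mem_map_of_mem hw
      rw [← hcon _ hmem, show toVec P.n _ = w.expo from funext fun i => getD_expVec w i]) i i.2
    obtain ⟨w, hw, hrw⟩ := P.exists_toVec_eq hr
    rw [hBr, hrw]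
    exact AddSubgroup.subset_closure ⟨w, hw, rfl⟩
  have hdet : ∀ z : Fin P.n → ℤ, B.det • z ∈ P.lattice := fun z => by
    have h1 : B.det • z = Matrix.vecMul (Matrix.vecMul z B.adjugate) B := by
      rw [Matrix.vecMul_vecMul, Matrix.adjugate_mul, Matrix.vecMul_smul, Matrix.vecMul_one]
    rw [h1, Matrix.vecMul_eq_sum]
    exact sum_mem fun i _ => zsmul_mem (hrow i) _
  refine ⟨Int.natAbs_pos.2 hB.ne, fun z => ?_⟩
  rw [modulus, ← hB.det]
  rcases Int.natAbs_eq B.det with hd | hd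
  · rw [← hd]; exact hdet z
  · rw [← neg_neg ((B.det.natAbs : ℤ)), ← hd, neg_smul]
    exact neg_mem (hdet z)

/-- The lattice contains `E ℤⁿ`, so reduction modulo `E` preserves membership in both directions. -/
theorem mem_span_rowSet_iff (x : Fin P.n → ℤ) :
    (fun i => (x i : ZMod (modulus P.n P.relatorData))) ∈
      Submodule.span (ZMod (modulus P.n P.relatorData))
        (rowSet (modulus P.n P.relatorData) P.n (relMat P.n P.relatorData)) ↔ x ∈ P.lattice := by
  obtain ⟨-, hE⟩ := P.modulus_spec
  set E := modulus P.n P.relatorData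
  have hvec : ∀ r, vec E P.n r = fun i => ((toVec P.n r i : ℤ) : ZMod E) := fun r => rfl
  constructor
  · intro hx
    have key : ∀ v ∈ Submodule.span (ZMod E) (rowSet E P.n (relMat P.n P.relatorData)),
        ∃ y ∈ P.lattice, v = fun i => (y i : ZMod E) := by
      intro v hv
      induction hv using Submodule.span_induction with
      | mem v hv =>
        obtain ⟨r, hr, rfl⟩ := hv
        obtain ⟨w, hw, hrw⟩ := P.exists_toVec_eq hr
        exact ⟨w.expo, AddSubgroup.subset_closure ⟨w, hw, rfl⟩, by rw [hvec, hrw]⟩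
      | zero => exact ⟨0, zero_mem _, by ext i; simp⟩
      | add u v _ _ h1 h2 =>
        obtain ⟨y, hy, rfl⟩ := h1
        obtain ⟨z, hz, rfl⟩ := h2
        exact ⟨y + z, add_mem hy hz, by ext i; simp⟩
      | smul c v _ h =>
        obtain ⟨y, hy, rfl⟩ := h
        obtain ⟨c, rfl⟩ := ZMod.intCast_surjective c
        exact ⟨c • y, zsmul_mem hy c, by ext i; simp⟩
    obtain ⟨y, hy, hxy⟩ := key _ hx
    have h1 : ∀ i, ∃ z : ℤ, x i - y i = E * z := fun i => by
      have := congrFun hxy i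
      exact (ZMod.intCast_eq_intCast_iff_dvd_sub _ _ _).1 this.symm
    choose z hz using h1
    have h2 : x = y + (E : ℤ) • z := by
      ext i; simp only [Pi.add_apply, Pi.smul_apply, smul_eq_mul, ← hz]; ring
    rw [h2]
    exact add_mem hy (hE z)
  · intro hx
    induction hx using AddSubgroup.closure_induction with
    | mem x hx =>
      obtain ⟨w, hw, rfl⟩ := hx
      refine Submodule.subset_span ⟨expVec (List.range P.n) (w.map fun l => ((l.1 : ℕ), l.2)), ?_, ?_⟩
      · rw [relMat_eq]; exact List.mem_map_of_mem hw
      · ext i; rw [vec, getD_expVec]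
    | zero =>
      have h0 : (fun i => (((0 : Fin P.n → ℤ) i : ℤ) : ZMod E)) = 0 := by ext i; simp
      rw [h0]; exact zero_mem _
    | add x y _ _ h1 h2 => convert add_mem h1 h2 using 1; ext i; simp
    | neg x _ h => convert neg_mem h using 1; ext i; simp

end Presentation

/-! ## The abelianization of a presented group -/

namespace Presentation

variable (P : Presentation) [Finite P.Grp]

/-- The image of a vector under the coordinate transformation. -/
def coord (y : Fin P.n → ℤ) (j : Fin P.n) : ℤ :=
  ∑ i : Fin P.n, y i * entry (smithOf P.n P.relatorData).1.2.1 i j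

theorem smithOf_eq : smithOf P.n P.relatorData = smith (modulus P.n P.relatorData)
    (List.range P.n) (relMat P.n P.relatorData) := by
  rw [smithOf, P.indices_eq_range]

theorem length_smithOf : (smithOf P.n P.relatorData).2.length = P.n := by
  rw [smithOf_eq]; exact (smith_spec (N := P.n) P.modulus_spec.1 _).1

theorem getD_smithOf_mem (j : Fin P.n) :
    (smithOf P.n P.relatorData).2.getD j 0 ∈ (smithOf P.n P.relatorData).2 := by
  rw [List.getD_eq_getElem?_getD, List.getElem?_eq_getElem (by rw [P.length_smithOf]; exact j.2)]
  exact List.getElem_mem _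

theorem smithOf_pos (j : Fin P.n) : 0 < (smithOf P.n P.relatorData).2.getD j 0 := by
  have := P.getD_smithOf_mem j
  have h := (smith_spec (N := P.n) P.modulus_spec.1 (relMat P.n P.relatorData)).2.1
  rw [← smithOf_eq] at h
  exact (h _ this).1

/-- The orders of the cyclic groups of the Smith form. -/
def smithDim (j : Fin P.n) : ℕ := ((smithOf P.n P.relatorData).2.getD j 0).natAbs

/-- The group of the Smith form. -/
abbrev smithGroup : FinAb where
  n := P.n
  d := P.smithDim
  d_pos j := Int.natAbs_pos.2 (P.smithOf_pos j).ne'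

theorem smithDim_eq (j : Fin P.n) :
    ((P.smithDim j : ℕ) : ℤ) = (smithOf P.n P.relatorData).2.getD j 0 :=
  Int.natAbs_of_nonneg (P.smithOf_pos j).le

theorem eq_ofFn_getD {l : List ℤ} {n : ℕ} (h : l.length = n) :
    l = List.ofFn fun i : Fin n => l.getD i 0 := by
  subst h
  apply List.ext_getElem <;> simp

theorem encode_smithGroup : P.smithGroup.encode = enc (smithOf P.n P.relatorData).2 := by
  conv_rhs => rw [eq_ofFn_getD P.length_smithOf]
  change Data.ofList _ = Data.ofList _
  rw [List.map_ofFn]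
  congr 2
  funext j
  exact congrArg Data.int (P.smithDim_eq j)

theorem smithGroup_dvd {i j : Fin P.n} (hij : i ≤ j) : P.smithDim i ∣ P.smithDim j := by
  rw [← Int.natCast_dvd_natCast, P.smithDim_eq, P.smithDim_eq]
  rcases hij.eq_or_lt with rfl | hlt
  · exact dvd_rfl
  have h := (smith_spec (N := P.n) P.modulus_spec.1 (relMat P.n P.relatorData)).2.2.1
  rw [← smithOf_eq] at h
  have hl := P.length_smithOf
  have := List.pairwise_iff_getElem.1 h i j (by rw [hl]; exact i.2) (by rw [hl]; exact j.2) hlt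
  simpa [List.getD_eq_getElem?_getD, hl] using this

theorem coord_eq_zero_iff (y : Fin P.n → ℤ) :
    (∀ j, ((P.coord y j : ℤ) : ZMod (P.smithDim j)) = 0) ↔ y ∈ P.lattice := by
  rw [← P.mem_span_rowSet_iff]
  have h := (smith_spec (N := P.n) P.modulus_spec.1 (relMat P.n P.relatorData)).2.2.2.1 y
  rw [← smithOf_eq] at h
  rw [h]
  exact forall_congr' fun j => by
    rw [ZMod.intCast_zmod_eq_zero_iff_dvd, P.smithDim_eq]; rfl

/-- A vector with given coordinates. -/
def lift (x : Fin P.n → ℤ) (i : Fin P.n) : ℤ :=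
  ∑ l : Fin P.n, x l * entry (smithOf P.n P.relatorData).1.2.2 i l

/-- The matrices are inverse to each other only modulo `E`; this suffices because every invariant
divides `E`. -/
theorem coord_lift (x : Fin P.n → ℤ) (j : Fin P.n) :
    ((P.coord (P.lift x) j : ℤ) : ZMod (P.smithDim j)) = x j := by
  have hE : ((P.coord (P.lift x) j : ℤ) : ZMod (modulus P.n P.relatorData)) = x j := by
    have h := (smith_spec (N := P.n) P.modulus_spec.1 (relMat P.n P.relatorData)).2.2.2.2
    rw [← smithOf_eq] at h
    have e : P.coord (P.lift x) j = ∑ l : Fin P.n, x l * ∑ i : Fin P.n,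
        entry (smithOf P.n P.relatorData).1.2.2 i l *
          entry (smithOf P.n P.relatorData).1.2.1 i j := by
      simp only [coord, lift, Finset.sum_mul, Finset.mul_sum]
      rw [Finset.sum_comm]
      exact Finset.sum_congr rfl fun _ _ => Finset.sum_congr rfl fun _ _ => by ring
    rw [e, Int.cast_sum]
    rw [Finset.sum_eq_single j (fun l _ hl => by rw [Int.cast_mul, h, if_neg hl, mul_zero])
      (by simp), Int.cast_mul, h, if_pos rfl, mul_one]
  rw [ZMod.intCast_eq_intCast_iff_dvd_sub] at hE ⊢
  have h := (smith_spec (N := P.n) P.modulus_spec.1 (relMat P.n P.relatorData)).2.1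
  rw [← smithOf_eq] at h
  rw [P.smithDim_eq]
  exact (h _ (P.getD_smithOf_mem j)).2.trans hE

theorem exists_abelianization : ∃ χ : P.Grp →* Multiplicative ((j : Fin P.n) → ZMod (P.smithDim j)),
    ∀ w, χ (P.eval w) = Multiplicative.ofAdd fun j => ((P.coord w.expo j : ℤ) : ZMod (P.smithDim j)) := by
  let h : Fin P.n → Multiplicative ((j : Fin P.n) → ZMod (P.smithDim j)) := fun i =>
    Multiplicative.ofAdd fun j => ((entry (smithOf P.n P.relatorData).1.2.1 i j : ℤ) : ZMod (P.smithDim j))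
  have hp : ∀ x : Fin P.n → ℤ, ∏ i, h i ^ x i =
      Multiplicative.ofAdd fun j => ((P.coord x j : ℤ) : ZMod (P.smithDim j)) := fun x => by
    simp only [h, ← ofAdd_zsmul, ← ofAdd_sum]
    congr 1
    funext j
    rw [Finset.sum_apply, coord]
    push_cast
    exact Finset.sum_congr rfl fun i _ => by rw [Pi.smul_apply, zsmul_eq_mul]
  obtain ⟨χ, hχ⟩ := P.exists_hom h fun w hw => by
    rw [hp]
    have := (P.coord_eq_zero_iff w.expo).2 (AddSubgroup.subset_closure ⟨w, hw, rfl⟩)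
    simp only [this]; rfl
  exact ⟨χ, fun w => by rw [hχ, hp]⟩

/-- The word with exponents `y`. -/
def wordOf {n : ℕ} (y : Fin n → ℤ) : Word n := List.ofFn fun i => (i, y i)

theorem expo_wordOf {n : ℕ} (y : Fin n → ℤ) : (wordOf y).expo = y := by
  ext i
  have h : ∀ w : Word n, w.expo i = (w.map fun l => if l.1 = i then l.2 else 0).sum := fun w => by
    induction w with
    | nil => rfl
    | cons l w ih =>
      rw [List.map_cons, List.sum_cons, ← ih]
      by_cases hl : l.1 = i <;> simp [Word.expo, hl]
  rw [h, wordOf, List.map_ofFn, List.sum_ofFn]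
  simp

theorem image_eq (w : Word P.n) : P.smithGroup.encodeElem
      (fun j => ((P.coord w.expo j : ℤ) : ZMod (P.smithDim j))) =
    enc (image (w.map fun l => ((l.1 : ℕ), l.2), indices P.n P.relatorData,
      (smithOf P.n P.relatorData).1.2.1, (smithOf P.n P.relatorData).2)) := by
  rw [image, P.indices_eq_range]
  dsimp only
  rw [map_range_eq_ofFn]
  change Data.ofList _ = Data.ofList _
  rw [List.map_ofFn]
  congr 2
  funext j
  refine congrArg Data.int ?_
  have : NeZero (P.smithDim j) := ⟨(Int.natAbs_pos.2 (P.smithOf_pos j).ne').ne'⟩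
  beta_reduce
  rw [ZMod.val_intCast, P.smithDim_eq, sum_map_range, coord]
  simp only [getD_expVec]

theorem preimage_eq (x : (j : Fin P.n) → ZMod (P.smithDim j)) {y : List ℤ}
    (hy : ∀ j : Fin P.n, y.getD j 0 = ((x j).val : ℤ)) :
    (wordOf (P.lift fun j => ((x j).val : ℤ))).encode =
    enc (preimage (y, indices P.n P.relatorData, (smithOf P.n P.relatorData).1.2.2)) := by
  rw [preimage, P.indices_eq_range]
  dsimp only
  rw [map_range_eq_ofFn, Word.encode, wordOf]
  change Data.ofList _ = Data.ofList _
  rw [List.map_ofFn, List.map_ofFn]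
  congr 2
  funext i
  refine congrArg (fun z => Data.pair (Data.int _) (Data.int z)) ?_
  dsimp only
  rw [sum_map_range, lift]
  simp only [hy]

end Presentation

/-! ## Running times -/

/-- Identifies the output and the unused random bits of a given run with those of a known one, as
needed when a deterministic part of a composite program is analysed. -/
theorem Eval.det {Ω : Data → Data} {p : Prog} {x y : Data} {ω ω' : ℕ → Bool} {t : ℕ}
    (h : Eval Ω p x ω y ω' t) : ∀ {y₂ : Data} {ω₂ : ℕ → Bool} {t₂ : ℕ},
      Eval Ω p x ω y₂ ω₂ t₂ → y = y₂ ∧ ω' = ω₂ := by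
  induction h with
  | op | const | coin | query => intro _ _ _ h2; cases h2; exact ⟨rfl, rfl⟩
  | seq _ _ ih1 ih2 =>
    intro _ _ _ h2
    cases h2 with
    | seq a b =>
      obtain ⟨rfl, rfl⟩ := ih1 a
      exact ih2 b
  | fork _ _ ih1 ih2 =>
    intro _ _ _ h2
    cases h2 with
    | fork a b =>
      obtain ⟨rfl, rfl⟩ := ih1 a
      obtain ⟨rfl, rfl⟩ := ih2 b
      exact ⟨rfl, rfl⟩
  | condThen _ hv _ ih1 ih2 =>
    intro _ _ _ h2
    cases h2 with
    | condThen a _ b =>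
      obtain ⟨rfl, rfl⟩ := ih1 a
      exact ih2 b
    | condElse a _ => exact absurd (ih1 a).1 hv
  | condElse _ _ ih1 ih2 =>
    intro _ _ _ h2
    cases h2 with
    | condThen a hv b => exact absurd (ih1 a).1.symm hv
    | condElse a b =>
      obtain ⟨-, rfl⟩ := ih1 a
      exact ih2 b
  | loopStop _ ih1 =>
    intro _ _ _ h2
    cases h2 with
    | loopStop a => exact ⟨rfl, (ih1 a).2⟩
    | loopStep a hv _ _ => exact absurd (ih1 a).1.symm hv
  | loopStep _ hv _ _ ih1 ih2 ih3 =>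
    intro _ _ _ h2
    cases h2 with
    | loopStop a => exact absurd (ih1 a).1 hv
    | loopStep a _ b c =>
      obtain ⟨rfl, rfl⟩ := ih1 a
      obtain ⟨rfl, rfl⟩ := ih2 b
      exact ih3 c

instance : MeasureTheory.IsProbabilityMeasure coinMeasure := by
  unfold coinMeasure; infer_instance

theorem runTime_le {Ω : Data → Data} {p : Prog} {x y : Data} {ω ω' : ℕ → Bool} {t : ℕ}
    (h : Eval Ω p x ω y ω' t) : runTime Ω p x ω ≤ t := iInf₂_le t ⟨y, ω', h⟩

/-- The output of an algorithm is not longer than its expected running time. -/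
theorem RunsInExpectedTime.size_le {Ω : Data → Data} {p : Prog} {x y : Data} {B : ℕ}
    (h : RunsInExpectedTime Ω p x (fun z => z = y) B) : y.size ≤ B := by
  -- All halting runs have the same output `y`, so its length is below the running time for every
  -- `ω`; integration keeps this constant.
  have h1 : ∀ ω, (y.size : ℝ≥0∞) ≤ runTime Ω p x ω := fun ω =>
    le_iInf₂ fun t ⟨z, ω', hz⟩ => by
      have := hz.size_le
      rw [h.1 _ _ _ _ hz] at this
      exact_mod_cast this
  have h2 := (MeasureTheory.lintegral_mono h1).trans h.2
  rw [MeasureTheory.lintegral_const, MeasureTheory.measure_univ, mul_one] at h2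
  exact_mod_cast h2

/-- A probabilistic algorithm followed by a deterministic one. -/
theorem RunsInExpectedTime.seq_right {Ω : Data → Data} {p q : Prog} {x y z : Data} {B C : ℕ}
    (h : RunsInExpectedTime Ω p x (fun d => d = y) B)
    (hq : ∀ ω, ∃ t ≤ C, Eval Ω q y ω z ω t) :
    RunsInExpectedTime Ω (.seq p q) x (fun d => d = z) (B + (1 + C)) := by
  refine ⟨fun ω d ω' t hd => ?_, ?_⟩
  · cases hd with
    | @seq _ _ _ y' _ _ ω₁ _ _ _ a b =>
      obtain rfl := h.1 _ _ _ _ a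
      obtain ⟨_, -, hz⟩ := hq ω₁
      exact (b.det hz).1
  · have h1 : ∀ ω, runTime Ω (.seq p q) x ω ≤ runTime Ω p x ω + ((1 + C : ℕ) : ℝ≥0∞) := fun ω => by
      conv_rhs => rw [runTime]
      simp only [ENNReal.iInf_add]
      -- Where `p` does not halt, the infimum is over the empty set, so the bound is `∞` and nothing
      -- is to be shown.
      refine le_iInf₂ fun t ⟨y', ω', ht⟩ => ?_
      obtain rfl := h.1 _ _ _ _ ht
      obtain ⟨u, hu, hz⟩ := hq ω'
      refine (runTime_le (.seq ht hz)).trans ?_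
      exact_mod_cast (by omega : 1 + t + u ≤ t + (1 + C))
    refine (MeasureTheory.lintegral_mono h1).trans ?_
    rw [MeasureTheory.lintegral_add_right _ measurable_const, MeasureTheory.lintegral_const,
      MeasureTheory.measure_univ, mul_one, Nat.cast_add B]
    exact add_le_add h.2 le_rfl

/-- A deterministic algorithm followed by a probabilistic one. -/
theorem RunsInExpectedTime.seq_left {Ω : Data → Data} {p q : Prog} {x y : Data} {B C : ℕ}
    {good : Data → Prop} (h : RunsInExpectedTime Ω q y good B)
    (hp : ∀ ω, ∃ t ≤ C, Eval Ω p x ω y ω t) :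
    RunsInExpectedTime Ω (.seq p q) x good (B + (1 + C)) := by
  refine ⟨fun ω d ω' t hd => ?_, ?_⟩
  · cases hd with
    | seq a b =>
      obtain ⟨_, -, hz⟩ := hp ω
      obtain ⟨rfl, rfl⟩ := hz.det a
      exact h.1 _ _ _ _ b
  · have h1 : ∀ ω, runTime Ω (.seq p q) x ω ≤ runTime Ω q y ω + ((1 + C : ℕ) : ℝ≥0∞) := fun ω => by
      conv_rhs => rw [runTime]
      simp only [ENNReal.iInf_add]
      refine le_iInf₂ fun t ⟨y', ω', ht⟩ => ?_
      obtain ⟨u, hu, hz⟩ := hp ω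
      refine (runTime_le (.seq hz ht)).trans ?_
      exact_mod_cast (by omega : 1 + u + t ≤ t + (1 + C))
    refine (MeasureTheory.lintegral_mono h1).trans ?_
    rw [MeasureTheory.lintegral_add_right _ measurable_const, MeasureTheory.lintegral_const,
      MeasureTheory.measure_univ, mul_one, Nat.cast_add B]
    exact add_le_add h.2 le_rfl

theorem RunsInExpectedTime.mono {Ω : Data → Data} {p : Prog} {x : Data} {good good' : Data → Prop}
    {B B' : ℕ} (h : RunsInExpectedTime Ω p x good B) (hg : ∀ y, good y → good' y) (hB : B ≤ B') :
    RunsInExpectedTime Ω p x good' B' :=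
  ⟨fun ω y ω' t he => hg y (h.1 ω y ω' t he), h.2.trans (by exact_mod_cast hB)⟩

/-! ### Built-in constants and the assembly of the abelianization. -/

/-- A program applied to the pair of the input and a fixed object. -/
def Prog.curry (K : Data) (p : Prog) : Prog := .seq (.fork (.op .id) (.const K)) p

theorem exists_eval_curry {α β γ : Type} [Enc α] [Enc β] [Enc γ] {f : α × β → γ} {p : Prog}
    {q : Polynomial ℕ} {Ω : Data → Data} {ω : ℕ → Bool} {a : α} {b : β}
    (h : ∃ t ≤ q.eval (sz (a, b)), Eval Ω p (enc (a, b)) ω (enc (f (a, b))) ω t) {B : ℕ}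
    (ha : sz a ≤ B) (hb : sz b ≤ B) :
    ∃ t ≤ 4 + 5 * B + q.eval (1 + 2 * B),
      Eval Ω (.curry (enc b) p) (enc a) ω (enc (f (a, b))) ω t := by
  obtain ⟨t, ht, he⟩ := h
  refine ⟨_, ?_, .seq (.fork (Eval.op .id _ _) (Eval.const _ _ _)) he⟩
  have h1 : q.eval (sz (a, b)) ≤ q.eval (1 + 2 * B) := eval_mono q (by rw [sz_pair]; omega)
  change 1 + (1 + sz a + (1 + sz a + sz a) + (1 + sz a + sz b)) + t ≤ _
  omega

theorem Word.encode_eq {n : ℕ} (w : Word n) :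
    w.encode = enc (w.map fun l => ((l.1 : ℕ), l.2)) := by
  change Data.ofList _ = Data.ofList _
  rw [List.map_map]; rfl

instance (R : FinRing) : Finite R.Carrier := by
  have : ∀ i, NeZero (R.add.d i) := fun i => ⟨(R.add.d_pos i).ne'⟩
  exact inferInstanceAs (Finite ((i : Fin R.add.n) → ZMod (R.add.d i)))

/-- The isomorphism to a presented group, followed by the map to the Smith group, has the commutator
subgroup as kernel. -/
theorem Presentation.ker_eq_commutator {G : Type*} [Group G] (P : Presentation) [Finite P.Grp]
    (f : G ≃* P.Grp) {α : G → Word P.n} (hα : ∀ g, f g = P.eval (α g))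
    {χ : P.Grp →* Multiplicative ((j : Fin P.n) → ZMod (P.smithDim j))}
    (hχ : ∀ w, χ (P.eval w) =
      Multiplicative.ofAdd fun j => ((P.coord w.expo j : ℤ) : ZMod (P.smithDim j))) :
    (χ.comp f.toMonoidHom).ker = commutator G := by
  refine le_antisymm (fun g hg => ?_) (Abelianization.commutator_subset_ker _)
  have h1 : χ (f g) = 1 := hg
  rw [hα, hχ] at h1
  have h2 := (P.coord_eq_zero_iff (α g).expo).1 fun j => congrFun (ofAdd_eq_one.1 h1) j
  -- Words with exponents in the lattice die in every commutative quotient, in particular in the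
  -- abelianization of `G`.
  have h3 := P.map_eval_eq_one (Abelianization.of.comp f.symm.toMonoidHom) h2
  rw [← hα] at h3
  have h4 : Abelianization.of g = 1 := by simpa using h3
  rwa [← MonoidHom.mem_ker, Abelianization.ker_of] at h4

/-- `W` bounds the lengths of the built-in constants, of the inputs and of the words `α g`. The
conditions on `q` say that it exceeds the times of the two composite programs. -/
theorem isAbelianization_answer {Ω : Data → Data} {p qi qp : Polynomial ℕ} {Pi Pp : Prog}
    (hi : ∀ a (Ω : Data → Data) (ω : ℕ → Bool),
      ∃ t ≤ qi.eval (sz a), Eval Ω Pi (enc a) ω (enc (image a)) ω t)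
    (hp : ∀ a (Ω : Data → Data) (ω : ℕ → Bool),
      ∃ t ≤ qp.eval (sz a), Eval Ω Pp (enc a) ω (enc (preimage a)) ω t)
    {R : FinRing} {D : Data} (hD : IsEffectivePresentation Ω p R D) :
    ∃ x, D = enc x ∧ ∀ W q : Polynomial ℕ, sz (answer Pi Pp x) ≤ W.eval R.size →
      (∀ s, s + p.eval s ≤ W.eval s) →
      (∀ s, p.eval s + (1 + (4 + 5 * W.eval s + qi.eval (1 + 2 * W.eval s))) ≤ q.eval s) →
      (∀ s, p.eval (s + (4 + 5 * W.eval s + qp.eval (1 + 2 * W.eval s))) +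
        (1 + (4 + 5 * W.eval s + qp.eval (1 + 2 * W.eval s))) ≤ q.eval s) →
      IsAbelianization Ω q R (enc (answer Pi Pp x)) := by
  obtain ⟨P, a, b, α, β, rfl, ⟨f, hf, hfs⟩, ha, hb⟩ := hD
  have : Finite P.Grp := Finite.of_equiv _ f.toEquiv
  refine ⟨((P.n, P.relatorData), (a.encode, b.encode)), ?_, fun W q hW hW' hq₁ hq₂ => ?_⟩
  · rw [P.encode_eq]; rfl
  obtain ⟨χ, hχ⟩ := P.exists_abelianization
  set K₁ := (indices P.n P.relatorData, (smithOf P.n P.relatorData).1.2.1,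
    (smithOf P.n P.relatorData).2) with hK₁
  set K₂ := (indices P.n P.relatorData, (smithOf P.n P.relatorData).1.2.2) with hK₂
  have hans : enc (answer Pi Pp ((P.n, P.relatorData), (a.encode, b.encode))) =
      .pair P.smithGroup.encode (.pair (Prog.seq a (.curry (enc K₁) Pi)).encode
        (Prog.seq (.curry (enc K₂) Pp) b).encode) := by
    rw [P.encode_smithGroup]; rfl
  -- The constants occur inside the encoded answer, hence are no longer than it.
  have hsz : sz K₁ ≤ W.eval R.size ∧ sz K₂ ≤ W.eval R.size := by
    rw [sz, hans] at hW
    simp only [Prog.curry, Prog.encode, Data.size] at hW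
    change _ at hW
    constructor
    · change (enc K₁).size ≤ _; omega
    · change (enc K₂).size ≤ _; omega
  refine ⟨P.smithGroup, .seq a (.curry (enc K₁) Pi), .seq (.curry (enc K₂) Pp) b,
    χ.comp f.toMonoidHom, hans, fun i j hij => P.smithGroup_dvd hij, fun x => ?_,
    P.ker_eq_commutator f hf hχ, fun g => ?_, fun x => ?_⟩
  · refine ⟨f.symm (P.eval (Presentation.wordOf (P.lift fun j => ((x.toAdd j).val : ℤ)))), ?_⟩
    change χ (f (f.symm _)) = x
    rw [f.apply_symm_apply, hχ, Presentation.expo_wordOf]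
    simp only [P.coord_lift]
    refine congrArg Multiplicative.ofAdd (a₂ := x.toAdd) (funext fun j => ?_)
    have : NeZero (P.smithDim j) := ⟨(Int.natAbs_pos.2 (P.smithOf_pos j).ne').ne'⟩
    simp
  · set s := R.size + (R.encodeUnit g).size
    have hs : R.size ≤ s := Nat.le_add_right _ _
    have hWs := eval_mono W hs
    have h1 : (α g).encode.size ≤ p.eval s := (ha g).size_le
    have h2 := hW' s
    refine ((ha g).seq_right (z := P.smithGroup.encodeElem (χ (f g)).toAdd)
      (C := 4 + 5 * W.eval s + qi.eval (1 + 2 * W.eval s)) fun ω => ?_).mono (fun _ h => h) (hq₁ s)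
    rw [hf, hχ, toAdd_ofAdd, P.image_eq, Word.encode_eq]
    rw [Word.encode_eq] at h1
    exact exists_eval_curry (hi _ Ω ω) (h1.trans (by omega)) (hsz.1.trans hWs)
  · set s := R.size + (P.smithGroup.encodeElem x).size with hs'
    have hs : R.size ≤ s := Nat.le_add_right _ _
    have hWs := eval_mono W hs
    have h2 := hW' s
    set w := Presentation.wordOf (P.lift fun j => ((x j).val : ℤ)) with hw
    have hx : P.smithGroup.encodeElem x = enc (List.ofFn fun j => ((x j).val : ℤ)) := by
      change Data.ofList _ = Data.ofList _
      rw [List.map_ofFn]; rfl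
    have hpre : ∀ ω, ∃ t ≤ 4 + 5 * W.eval s + qp.eval (1 + 2 * W.eval s),
        Eval Ω (.curry (enc K₂) Pp) (P.smithGroup.encodeElem x) ω w.encode ω t := fun ω => by
      rw [hw, P.preimage_eq x (y := List.ofFn fun j => ((x j).val : ℤ)) (fun j => by
        simp [List.getD_eq_getElem?_getD]), hx]
      exact exists_eval_curry (hp _ Ω ω) (by
        have : sz (List.ofFn fun j => ((x j).val : ℤ)) ≤ s := by
          rw [hs', hx]; exact Nat.le_add_left _ _
        omega) (hsz.2.trans hWs)
    refine ((hb w).seq_left hpre).mono (fun y hy => ⟨f.symm (P.eval w), ?_, by rw [hfs, hy]⟩) ?_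
    · change χ (f (f.symm _)) = _
      rw [f.apply_symm_apply, hχ, hw, Presentation.expo_wordOf]
      simp only [P.coord_lift]
      refine congrArg Multiplicative.ofAdd (funext fun j => ?_)
      have : NeZero (P.smithDim j) := ⟨(Int.natAbs_pos.2 (P.smithOf_pos j).ne').ne'⟩
      simp
    -- The word given to `b` is no longer than the time spent on computing it; this explains the
    -- argument of `p` in `hq₂`.
    · refine le_trans (Nat.add_le_add_right (eval_mono p ?_) _) (hq₂ s)
      obtain ⟨t, ht, he⟩ := hpre fun _ => true
      have := he.size_le
      omega

end UnitAb

theorem mainTheorem9 :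
    ∃ M : UnitAb.Prog, M.CoinFree ∧
      ∀ p : Polynomial ℕ, ∃ q : Polynomial ℕ, ∀ Ω O : UnitAb.Data → UnitAb.Data,
        UnitAb.SolvesEffectivePresentation Ω p O →
        ∀ R : UnitAb.FinRing, ∃ D : UnitAb.Data,
          UnitAb.RunsInTime O M R.encode D (q.eval R.size) ∧
          UnitAb.IsAbelianization Ω q R D := by
  obtain ⟨Pi, -, qi, hi⟩ := UnitAb.PT.image
  obtain ⟨Pp, -, qp, hp⟩ := UnitAb.PT.preimage
  obtain ⟨A, hA, qa, ha⟩ := UnitAb.PT.answer Pi Pp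
  refine ⟨.seq .query A, ⟨trivial, hA⟩, fun p => ?_⟩
  -- `X + p` covers inputs and words, and `qa.comp p` the length of the answer, whose computation
  -- from data of length at most `p` takes at most that time.
  let W : Polynomial ℕ := Polynomial.X + p + qa.comp p
  let Ci : Polynomial ℕ := 4 + 5 * W + qi.comp (1 + 2 * W)
  let Cp : Polynomial ℕ := 4 + 5 * W + qp.comp (1 + 2 * W)
  have hW : ∀ s, W.eval s = s + p.eval s + qa.eval (p.eval s) := fun s => by simp [W]
  have hCi : ∀ s, Ci.eval s = 4 + 5 * W.eval s + qi.eval (1 + 2 * W.eval s) := fun s => by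
    simp [Ci]
  have hCp : ∀ s, Cp.eval s = 4 + 5 * W.eval s + qp.eval (1 + 2 * W.eval s) := fun s => by
    simp [Cp]
  -- The three summands are for the time of `M` itself, of the image program and of the preimage
  -- program.
  let q : Polynomial ℕ := (2 + W) + (p + (1 + Ci)) + (p.comp (Polynomial.X + Cp) + (1 + Cp))
  have hq : ∀ s, q.eval s = (2 + W.eval s) + (p.eval s + (1 + Ci.eval s)) +
      (p.eval (s + Cp.eval s) + (1 + Cp.eval s)) := fun s => by simp [q]
  refine ⟨q, fun Ω O hO R => ?_⟩
  obtain ⟨hsz, hE⟩ := hO R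
  obtain ⟨x, hx, h⟩ := UnitAb.isAbelianization_answer hi hp hE
  have hx' : UnitAb.sz x ≤ p.eval R.size := by rw [UnitAb.sz, ← hx]; exact hsz
  have hqa : qa.eval (UnitAb.sz x) ≤ qa.eval (p.eval R.size) := UnitAb.eval_mono qa hx'
  refine ⟨_, fun ω => ?_, h W q ?_ (fun s => by rw [hW]; omega)
    (fun s => by rw [hq, hCi]; omega) (fun s => by rw [hq, hCp]; omega)⟩
  · obtain ⟨t, ht, he⟩ := ha x O ω
    rw [← hx] at he
    refine ⟨ω, _, ?_, .seq (.query _ _) he⟩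
    change 1 + (1 + R.size + _) + t ≤ _
    rw [hq, hW]
    omega
  -- Any oracle and any random bits would do: one run suffices to bound the length of the answer.
  · obtain ⟨t, ht, he⟩ := ha x O fun _ => true
    have := he.size_le
    change (UnitAb.Enc.enc (UnitAb.answer Pi Pp x)).size ≤ _
    rw [hW]; omega
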